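/- Let $n>k\ge 2$, $0\le l<k$, and let $\Omega\subset\mathbb R^n$ be a bounded domain with smooth boundary. Let $\psi\in C^\infty(\overline\Omega\times\mathbb R)$, $\psi>0$. For a function $u$ on $\Omega$ with $|Du|<1$ put $w=\sqrt{1-|Du|^2}$, $g_{ij}=\delta_{ij}-u_iu_j$, $h_{ij}=u_{ij}/w$, $H=g^{ij}h_{ij}$, $\eta=Hg-h$, and let $\lambda(\eta)=(\lambda_1,\dots,\lambda_n)$ be the eigenvalues of $\eta$ with respect to $g$. This defines $$G(D^2u,Du)=\frac{\sigma_k(\lambda(\eta))}{\sigma_l(\lambda(\eta))},\qquad \sigma_j=\text{the $j$-th elementary symmetric polynomial}.$$ Let $u\in C^3(\overline\Omega)$ satisfy $\sup_\Omega|Du|\le 1-\theta_0$ with $0<\theta_0<1$, $\sigma_j(\lambda(\eta))>0$ in $\Omega$ for $1\le j\le k$, and $$G(D^2u,Du)=\psi(x,u)\ \text{ in }\Omega,\qquad u=0\ \text{ on }\partial\Omega .$$ Given $x_0\in\partial\Omega$, take orthonormal coordinates $x=(x',x_n)$ with origin $x_0$ and positive $x_n$-axis along the inner normal, such that, for some $s>0$,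 the part of $\Omega$ in the cylinder $\{|x'|<s,\ |x_n|<s\}$ is given there by $x_n>\rho(x')$, with $\rho$ smooth and $|\rho|<s$ on $\{|x'|<s\}$, $\rho(0)=0$, $D\rho(0)=0$. For $\delta>0$ let $$\omega_\delta=\{x\in\Omega:\ \rho(x')<x_n<\rho(x')+\delta^2,\ |x'|<\delta\},$$ and for $1\le\alpha\le n-1$ let $$W=u_\alpha+\rho_\alpha u_n-\tfrac12\sum_{\beta=1}^{n-1}u_\beta^2 .$$ Write $G^{ij}=\dfrac{\partial G}{\partial r_{ij}}(D^2u,Du)$, where $G=G(r,p)$ is regarded as a function of a symmetric matrix $r$ and a vector $p$, and $L=G^{ij}\partial_{ij}$. Then there are $\delta_0>0$ and $C>0$, depending only on $n$, $\theta_0$, $\partial\Omega$ and (an upper bound for) $\|\psi\|_{C^1(\overline\Omega\times[-\mu_0,\mu_0])}$, where $\mu_0=\|u\|_{C^0(\overline\Omega)}$, and in particular not on $x_0$, $\alpha$ and the choice of coordinates, such that for every $0<\delta\le\min(\delta_0,s)$, $$LW\le C\Big(1+|DW|+\sum_iG^{ii}+\sum_{i,j}G^{ij}W_iW_j\Big)\quad\text{on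 }\omega_\delta .$$ -/

import Mathlib

open scoped ContDiff

noncomputable section

namespace MinkowskiQuotient

/-- Euclidean space `ℝⁿ` with its Euclidean norm. -/
abbrev E (n : ℕ) : Type := EuclideanSpace ℝ (Fin n)

/-! ### Partial derivatives -/

/-- The partial derivative `f_i = ∂f/∂x_i`. -/
def pd {n : ℕ} (i : Fin n) (f : E n → ℝ) (x : E n) : ℝ :=
  fderiv ℝ f x (EuclideanSpace.single i 1)

/-- The ordinary gradient `Df = (f_1, …, f_n)`, as a tuple. -/
def grad {n : ℕ} (f : E n → ℝ) (x : E n) : Fin n → ℝ := fun i => pd i f x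

/-- The ordinary Hessian matrix `D²f = (f_ij)`. -/
def hess {n : ℕ} (f : E n → ℝ) (x : E n) : Matrix (Fin n) (Fin n) ℝ :=
  Matrix.of fun i j => pd j (pd i f) x

/-! ### Geometry of a spacelike graph in Minkowski space

All quantities at a point of the graph of `u` are functions of `r = D²u` and `p = Du`. -/

/-- `w = √(1 - |p|²)`. -/
def lorentzFactor {n : ℕ} (p : Fin n → ℝ) : ℝ := Real.sqrt (1 - ∑ i, p i ^ 2)

/-- The induced metric `g_ij = δ_ij - p_i p_j`. -/
def metric {n : ℕ} (p : Fin n → ℝ) : Matrix (Fin n) (Fin n) ℝ :=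
  1 - Matrix.vecMulVec p p

/-- The second fundamental form `h_ij = r_ij / w` for the upward unit normal. -/
def secondForm {n : ℕ} (r : Matrix (Fin n) (Fin n) ℝ) (p : Fin n → ℝ) :
    Matrix (Fin n) (Fin n) ℝ :=
  (lorentzFactor p)⁻¹ • r

/-- The mean curvature `H = tr (g⁻¹ h)`, the sum of the principal curvatures. -/
def meanCurvature {n : ℕ} (r : Matrix (Fin n) (Fin n) ℝ) (p : Fin n → ℝ) : ℝ :=
  Matrix.trace ((metric p)⁻¹ * secondForm r p)

/-- The tensor `η = H g - h`. -/
def etaTensor {n : ℕ} (r : Matrix (Fin n) (Fin n) ℝ) (p : Fin n → ℝ) :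
    Matrix (Fin n) (Fin n) ℝ :=
  meanCurvature r p • metric p - secondForm r p

/-- The eigenvalues `λ(η)` of `η` with respect to `g`, with multiplicity. For symmetric `r` and
`|p| < 1` there are `n` of them, and they are the numbers `λ_i = ∑_{j ≠ i} κ_j`, where the `κ_j`
are the principal curvatures (the eigenvalues of `h` with respect to `g`). -/
def etaEigenvalues {n : ℕ} (r : Matrix (Fin n) (Fin n) ℝ) (p : Fin n → ℝ) : Multiset ℝ :=
  ((metric p)⁻¹ * etaTensor r p).charpoly.roots

/-- The Gårding cone `Γ_k = {λ : σ_j(λ) > 0, j = 1, …, k}`. -/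
def gardingCone (k : ℕ) : Set (Multiset ℝ) :=
  {s | ∀ j : ℕ, 1 ≤ j → j ≤ k → 0 < s.esymm j}

/-- The operator `G(r, p) = σ_k(λ(η)) / σ_l(λ(η))`. -/
def G {n : ℕ} (k l : ℕ) (r : Matrix (Fin n) (Fin n) ℝ) (p : Fin n → ℝ) : ℝ :=
  (etaEigenvalues r p).esymm k / (etaEigenvalues r p).esymm l

/-- The derivative `G^{ij} = ∂G/∂r_ij` of `G(·, p)` as a function on the space of symmetric
matrices, normalized as usual so that the differential of `G(·, p)` in the direction of a symmetric
matrix `s` is `∑ G^{ij} s_ij`: it is the derivative in the direction `(E_ij + E_ji) / 2`. -/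
def Gderiv {n : ℕ} (k l : ℕ) (r : Matrix (Fin n) (Fin n) ℝ) (p : Fin n → ℝ) (i j : Fin n) : ℝ :=
  deriv (fun t : ℝ => G k l
    (r + t • ((1 / 2 : ℝ) • (Matrix.single i j (1 : ℝ) + Matrix.single j i (1 : ℝ)))) p) 0

/-- The coefficients `G^{ij}` at the point `x` for the function `v`. -/
def coeff {n : ℕ} (k l : ℕ) (v : E n → ℝ) (x : E n) (i j : Fin n) : ℝ :=
  Gderiv k l (hess v x) (grad v x) i j

/-- The linearized operator `L f = G^{ij} f_ij` at the function `v`. -/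
def linearized {n : ℕ} (k l : ℕ) (v f : E n → ℝ) (x : E n) : ℝ :=
  ∑ i, ∑ j, coeff k l v x i j * hess f x i j

/-- The graph of `u` over `Ω` is `(η, k)`-convex: `λ(η) ∈ Γ_k` at each of its points. -/
def IsEtaConvex {n : ℕ} (k : ℕ) (Ω : Set (E n)) (u : E n → ℝ) : Prop :=
  ∀ x ∈ Ω, etaEigenvalues (hess u x) (grad u x) ∈ gardingCone k

/-- `u` solves the Dirichlet problem `σ_k/σ_l (λ(η[M_u])) = ψ(x, u)` in `Ω`, `u = 0` on `∂Ω`. -/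
def SolvesDirichlet {n : ℕ} (k l : ℕ) (Ω : Set (E n)) (ψ : E n × ℝ → ℝ) (u : E n → ℝ) : Prop :=
  (∀ x ∈ Ω, G k l (hess u x) (grad u x) = ψ (x, u x)) ∧ ∀ x ∈ frontier Ω, u x = 0

/-! ### Boundary coordinates -/

/-- The first `m` coordinates `y' = (y_1, …, y_m)` of `y ∈ ℝ^{m+1}`. -/
def horiz {m : ℕ} (y : E (m + 1)) : E m := WithLp.toLp 2 fun a => y a.castSucc

/-- In the orthonormal coordinates `y` centred at `x₀`, `x = x₀ + R y`, the domain `Ω` is near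
`x₀` the part above the graph `y_n = ρ(y')` of a smooth function `ρ`, which vanishes at `0`
together with its gradient; so the positive `y_n`-axis is the inner normal direction at `x₀`. -/
structure IsBoundaryGraph {m : ℕ} (Ω : Set (E (m + 1))) (x₀ : E (m + 1))
    (R : E (m + 1) ≃ₗᵢ[ℝ] E (m + 1)) (s : ℝ) (ρ : E m → ℝ) : Prop where
  radius_pos : 0 < s
  smooth : ContDiffOn ℝ ∞ ρ (Metric.ball 0 s)
  map_zero : ρ 0 = 0
  fderiv_zero : fderiv ℝ ρ 0 = 0
  abs_lt : ∀ z ∈ Metric.ball (0 : E m) s, |ρ z| < s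
  mem_iff : ∀ y : E (m + 1), horiz y ∈ Metric.ball (0 : E m) s → |y (Fin.last m)| < s →
    (x₀ + R y ∈ Ω ↔ ρ (horiz y) < y (Fin.last m))

/-- `∂Ω` is smooth: near each of its points, `Ω` lies above the graph of a smooth function in
suitable orthonormal coordinates. -/
def HasSmoothBoundary {m : ℕ} (Ω : Set (E (m + 1))) : Prop :=
  ∀ x₀ ∈ frontier Ω, ∃ (R : E (m + 1) ≃ₗᵢ[ℝ] E (m + 1)) (s : ℝ) (ρ : E m → ℝ),
    IsBoundaryGraph Ω x₀ R s ρ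

/-- The set `ω_δ = {ρ(y') < y_n < ρ(y') + δ², |y'| < δ} ∩ Ω`, in the coordinates `y`. -/
def omegaSet {m : ℕ} (Ω : Set (E (m + 1))) (x₀ : E (m + 1))
    (R : E (m + 1) ≃ₗᵢ[ℝ] E (m + 1)) (ρ : E m → ℝ) (δ : ℝ) : Set (E (m + 1)) :=
  {y | x₀ + R y ∈ Ω ∧ ρ (horiz y) < y (Fin.last m) ∧
    y (Fin.last m) < ρ (horiz y) + δ ^ 2 ∧ ‖horiz y‖ < δ}

/-- The function `W = v_α + ρ_α v_n - ½ ∑_{β < n} v_β²`. -/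
def auxW {m : ℕ} (ρ : E m → ℝ) (v : E (m + 1) → ℝ) (α : Fin m) (y : E (m + 1)) : ℝ :=
  pd α.castSucc v y + pd α ρ (horiz y) * pd (Fin.last m) v y
    - (1 / 2) * ∑ β : Fin m, pd β.castSucc v y ^ 2

end MinkowskiQuotient

end

/-! ### Newton's inequalities and the Gårding cone -/

namespace MinkowskiQuotient
open Polynomial

/-! Write `T = ∑ G^{ii}` and `P_s = ∂G/∂p_s`. Differentiating the equation in direction `c` gives
`G^{ij} u_{ijc} + P_s u_{cs} = ∂_c(ψ(x,u))`. The third derivatives in `LW` enter only through `∑_c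
τ_c u_{ijc}`, with `τ_β = δ_{αβ} - u_β` and `τ_n = ρ_α`. Since `∑_c τ_c u_{cs} = W_s - (ρ_α)_s u_n`,
they can be traded for bounded terms and a term `P_s W_s`. As `P` is `O(1 + T|D²u|)`, the dangerous
contributions have size `T|D²u|` and `T|D²u||DW|`. The squares in `W` supply the good term `-∑_β
G^{ij} u_{βi} u_{βj}`.

Two facts make the absorption work. The first is uniform ellipticity, `G^{ij} ξ_i ξ_j ≥ c T |ξ|²`.
The eigenvalues are `λ_i = ∑_{j≠i} κ_j`, so the derivative of `σ_k/σ_l` in `κ_b` is the sum of its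
derivatives in the `λ_a`, `a ≠ b`. In `Γ_k` with `k < n` no single `λ`-derivative dominates the
others (`dquot_le_sum_erase`, a consequence of Newton's inequalities), so all `κ`-derivatives are
comparable; the bound on `|Du|` transfers this to `G^{ij}` (`exists_structure`). The second is
Euler's relation `G^{ij} u_{ij} = (k-l)ψ`, which controls `T|u_{nn}|` by `1 + T X`, where `X` sums
`|u_{βj}|` over tangential `β`. Ellipticity bounds the good term from above by a negative multiple
of `T X²`, and `T|DW|²` by a multiple of `G^{ij} W_i W_j`, so Young's inequality concludes
(`exists_absorption_constant`).

Uniformity in `x₀` and in the coordinates needs bounds on three orders of derivatives of `ρ`. By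
implicit differentiation of a local defining function of `Ω`, these are fixed smooth functions of
the boundary point and the frame, evaluated on a compact set; compactness of `∂Ω` finishes
(`exists_uniform_bounds`). -/

theorem esymm_cons (a : ℝ) (s : Multiset ℝ) (j : ℕ) :
    (a ::ₘ s).esymm (j + 1) = s.esymm (j + 1) + a * s.esymm j := by
  simp only [Multiset.esymm, Multiset.powersetCard_cons, Multiset.map_add, Multiset.map_map,
    Multiset.sum_add, Function.comp_def, Multiset.prod_cons, Multiset.sum_map_mul_left]

theorem esymm_zero' (s : Multiset ℝ) : s.esymm 0 = 1 := by
  simp [Multiset.esymm]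

theorem coeff_prod_one_add (s : Multiset ℝ) (j : ℕ) :
    (s.map fun a => (1 + C a * X : ℝ[X])).prod.coeff j = s.esymm j := by
  induction s using Multiset.induction_on generalizing j with
  | empty =>
    rcases j with _ | j
    · simp [esymm_zero']
    · simp [Multiset.esymm, coeff_one, Multiset.powersetCard_zero_right]
  | cons a s ih =>
    rw [Multiset.map_cons, Multiset.prod_cons, add_mul, one_mul, coeff_add, ih, mul_assoc]
    rcases j with _ | j
    · simp [esymm_zero']
    · rw [coeff_C_mul, coeff_X_mul, ih, esymm_cons]

/-- Laguerre's inequality at the origin for a product of linear factors. -/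
theorem laguerre_prod (s : Multiset ℝ) :
    0 ≤ (s.map fun a => (X - C a : ℝ[X])).prod.coeff 1 ^ 2
        - 2 * (s.map fun a => (X - C a : ℝ[X])).prod.coeff 0
          * (s.map fun a => (X - C a : ℝ[X])).prod.coeff 2 ∧
    (s.map fun a => (X - C a : ℝ[X])).prod.coeff 1 ^ 2 ≤ (s.card : ℝ) *
      ((s.map fun a => (X - C a : ℝ[X])).prod.coeff 1 ^ 2
        - 2 * (s.map fun a => (X - C a : ℝ[X])).prod.coeff 0
          * (s.map fun a => (X - C a : ℝ[X])).prod.coeff 2) := by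
  induction s using Multiset.induction_on with
  | empty => simp [coeff_one]
  | cons a s ih =>
    rw [Multiset.map_cons, Multiset.prod_cons, sub_mul]
    simp only [coeff_sub, coeff_C_mul, coeff_X_mul, coeff_X_mul_zero, Multiset.card_cons]
    generalize (s.map fun a => (X - C a : ℝ[X])).prod.coeff 0 = c0 at *
    generalize (s.map fun a => (X - C a : ℝ[X])).prod.coeff 1 = c1 at *
    generalize (s.map fun a => (X - C a : ℝ[X])).prod.coeff 2 = c2 at *
    push_cast
    have hN : (0 : ℝ) ≤ s.card := Nat.cast_nonneg _
    generalize (s.card : ℝ) = N at *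
    obtain ⟨h1, ih⟩ := ih
    constructor
    · have e : (c0 - a * c1) ^ 2 - 2 * (0 - a * c0) * (c1 - a * c2)
          = c0 ^ 2 + a ^ 2 * (c1 ^ 2 - 2 * c0 * c2) := by ring
      rw [e]; positivity
    rcases eq_or_lt_of_le hN with h0 | h0
    · subst h0
      have : c1 = 0 := by nlinarith
      subst this
      nlinarith [mul_nonneg (sq_nonneg a) h1]
    · have key : 0 ≤ N * ((N + 1) * ((c0 - a * c1) ^ 2 - 2 * (0 - a * c0) * (c1 - a * c2))
          - (c0 - a * c1) ^ 2) := by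
        have e : N * ((N + 1) * ((c0 - a * c1) ^ 2 - 2 * (0 - a * c0) * (c1 - a * c2))
          - (c0 - a * c1) ^ 2) = (N * c0 + a * c1) ^ 2 
            + (N + 1) * a ^ 2 * (N * (c1 ^ 2 - 2 * c0 * c2) - c1 ^ 2) := by ring
        rw [e]
        have := mul_nonneg (mul_nonneg (by linarith : 0 ≤ N + 1) (sq_nonneg a)) (sub_nonneg.2 ih)
        positivity
      have := nonneg_of_mul_nonneg_right key h0
      linarith

/-- Rolle's theorem with multiplicities: differentiation loses at most one real root, while the
degree drops. -/
theorem Splits.derivative_real {p : ℝ[X]} (hp : p.Splits) : (derivative p).Splits := by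
  rcases Nat.eq_zero_or_pos p.natDegree with h0 | h0
  · rw [natDegree_eq_zero.1 h0 |>.choose_spec.symm]; simp
  rw [splits_iff_card_roots] at *
  have h1 := card_roots_le_derivative p
  have h2 := card_roots' (derivative p)
  have h3 := natDegree_derivative_lt h0.ne'
  omega

theorem splits_iterate_derivative {p : ℝ[X]} (hp : p.Splits) (j : ℕ) :
    (derivative^[j] p).Splits := by
  induction j with
  | zero => exact hp
  | succ j ih => rw [Function.iterate_succ_apply']; exact Splits.derivative_real ih

/-- The leading coefficient scales out quadratically. `N` may exceed the degree because the bracket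
is nonnegative, so an upper bound for the degree is enough. -/
theorem laguerre {q : ℝ[X]} (hq : q.Splits) {N : ℕ} (hN : q.natDegree ≤ N) :
    q.coeff 1 ^ 2 ≤ (N : ℝ) * (q.coeff 1 ^ 2 - 2 * q.coeff 0 * q.coeff 2) := by
  obtain ⟨h0, h⟩ := laguerre_prod q.roots
  rw [splits_iff_card_roots.1 hq] at h
  replace h := h.trans (mul_le_mul_of_nonneg_right (Nat.cast_le.2 hN) h0)
  have e := hq.eq_prod_roots
  set P := (q.roots.map fun a => (X - C a : ℝ[X])).prod
  have hc : ∀ i, q.coeff i = q.leadingCoeff * P.coeff i := fun i => by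
    conv_lhs => rw [e]
    rw [coeff_C_mul]
  rw [hc 0, hc 1, hc 2]
  have := mul_le_mul_of_nonneg_left h (sq_nonneg q.leadingCoeff)
  linarith

/-- Newton's inequalities for the elementary symmetric functions of real numbers. -/
theorem newton_esymm (s : Multiset ℝ) (j : ℕ) :
    ((s.card : ℝ) - j) * (j + 2) * (s.esymm (j + 2) * s.esymm j)
      ≤ (j + 1) * (s.card - j - 1) * s.esymm (j + 1) ^ 2 := by
  have hz : ∀ i, s.card < i → s.esymm i = 0 := fun i hi => by
    simp [Multiset.esymm, Multiset.powersetCard_eq_empty _ hi]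
  rcases lt_or_ge s.card (j + 2) with h | h
  · rw [hz _ h]
    rcases lt_or_ge s.card (j + 1) with h' | h'
    · rw [hz _ h']; simp
    · have : s.card = j + 1 := by omega
      rw [this]; push_cast; simp
  -- Differentiating `∏ (X + a)` `d` times leaves a real-rooted polynomial of degree at most `j +
  -- 2`, with lowest coefficients `d! σ_{j+2}`, `(d+1)! σ_{j+1}` and `((d+2)!/2) σ_j`. Laguerre's
  -- inequality for it is Newton's inequality.
  · obtain ⟨d, hd⟩ := Nat.exists_eq_add_of_le h
    have hs : (s.map fun a => (X + C a : ℝ[X])).prod.Splits := by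
      refine Splits.multisetProd ?_
      intro f hf
      obtain ⟨a, -, rfl⟩ := Multiset.mem_map.1 hf
      exact Splits.X_add_C a
    have hdeg : (derivative^[d] (s.map fun a => (X + C a : ℝ[X])).prod).natDegree ≤ j + 2 := by
      refine (natDegree_iterate_derivative _ _).trans ?_
      have := natDegree_multiset_prod_le (s.map fun a => (X + C a : ℝ[X]))
      simp only [Multiset.map_map, Function.comp_def, natDegree_X_add_C, Multiset.map_const',
        Multiset.sum_replicate, smul_eq_mul, mul_one] at this
      omega
    have hl := laguerre (splits_iterate_derivative hs d) hdeg
    simp only [coeff_iterate_derivative] at hl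
    rw [Multiset.prod_X_add_C_coeff _ (by omega), Multiset.prod_X_add_C_coeff _ (by omega),
      Multiset.prod_X_add_C_coeff _ (by omega)] at hl
    rw [show s.card - (0 + d) = j + 2 by omega, show s.card - (1 + d) = j + 1 by omega,
      show s.card - (2 + d) = j by omega] at hl
    have d0 : (0 + d).descFactorial d = d.factorial := by simp [Nat.descFactorial_self]
    have d1 : (1 + d).descFactorial d = (d + 1) * d.factorial := by
      rw [add_comm, ← Nat.factorial_succ, ← Nat.descFactorial_self (d+1), Nat.descFactorial_succ]; simp
    have d2 : 2 * (2 + d).descFactorial d = (d + 2) * ((d + 1) * d.factorial) := by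
      have := Nat.factorial_mul_descFactorial (show d ≤ 2 + d by omega)
      rw [show 2 + d - d = 2 by omega, show 2 + d = d + 2 by omega, Nat.factorial_two] at this
      rw [add_comm 2 d, this, Nat.factorial_succ, Nat.factorial_succ]
    have d2' : (2 : ℝ) * ((2 + d).descFactorial d : ℝ) = (d + 2) * ((d + 1) * d.factorial) := by
      exact_mod_cast d2
    rw [d0, d1] at hl
    simp only [nsmul_eq_mul, Nat.cast_mul] at hl
    push_cast at hl
    rw [hd]
    push_cast
    have hf : (0 : ℝ) < d.factorial := by exact_mod_cast Nat.factorial_pos d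
    generalize (d.factorial : ℝ) = F at *
    generalize ((2 + d).descFactorial d : ℝ) = Q at *
    have hQ : Q = (d + 2) * ((d + 1) * F) / 2 := by linarith
    subst hQ
    have hpos : 0 < ((d : ℝ) + 1) * F ^ 2 := by positivity
    have : 0 ≤ (((d : ℝ) + 1) * F ^ 2) * ((j + 1) * (j + 2 + d - j - 1) * s.esymm (j + 1) ^ 2 -
        (j + 2 + d - j) * (j + 2) * (s.esymm (j + 2) * s.esymm j)) := by
      linarith
    have := nonneg_of_mul_nonneg_right this hpos
    linarith

theorem newton_esymm_weak (s : Multiset ℝ) (j : ℕ) :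
    s.esymm (j + 2) * s.esymm j ≤ s.esymm (j + 1) ^ 2 := by
  rcases lt_or_ge s.card (j + 2) with h | h
  · rw [show s.esymm (j + 2) = 0 by simp [Multiset.esymm, Multiset.powersetCard_eq_empty _ h]]
    nlinarith [sq_nonneg (s.esymm (j + 1))]
  · have h1 := newton_esymm s j
    have h2 : (j : ℝ) + 2 ≤ s.card := by exact_mod_cast h
    have h3 : (0 : ℝ) ≤ j := Nat.cast_nonneg _
    by_contra hc
    have hc := not_le.1 hc
    have hpos : (0 : ℝ) < (s.card - j) * (j + 2) := by nlinarith
    have : ((s.card : ℝ) - j) * (j + 2) * s.esymm (j + 1) ^ 2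
        < ((s.card : ℝ) - j) * (j + 2) * (s.esymm (j + 2) * s.esymm j) :=
      mul_lt_mul_of_pos_left hc hpos
    nlinarith [sq_nonneg (s.esymm (j + 1))]

/-- Deleting one entry maps the cone `Γ_k` to `Γ_{k-1}`. -/
theorem esymm_pos_of_cons {k : ℕ} {b : ℝ} {s : Multiset ℝ}
    (h : ∀ j ≤ k, 0 < (b ::ₘ s).esymm j) : ∀ j < k, 0 < s.esymm j := by
  intro j
  induction j with
  | zero => intro _; simp [esymm_zero']
  | succ j ih =>
    intro hj
    have h0 := ih (by omega)
    have h1 := h (j + 1) (by omega)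
    have h2 := h (j + 2) (by omega)
    rw [esymm_cons] at h1 h2
    have hN := newton_esymm_weak s j
    -- If `σ_{j+1}(s) ≤ 0`, the two cone inequalities give `b > 0` and `σ_{j+2} σ_j > -b σ_{j+1} σ_j
    -- ≥ σ_{j+1}²`, against Newton.
    by_contra hc
    have hc := not_lt.1 hc
    have hb : 0 < b := by
      by_contra hb
      nlinarith [mul_nonneg (neg_nonneg.2 (not_lt.1 hb)) h0.le]
    have e1 : -(b * s.esymm (j + 1)) * s.esymm j < s.esymm (j + 2) * s.esymm j :=
      mul_lt_mul_of_pos_right (by linarith) h0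
    have e2 : -s.esymm (j + 1) * (-s.esymm (j + 1)) ≤ -s.esymm (j + 1) * (b * s.esymm j) :=
      mul_le_mul_of_nonneg_left (by linarith) (by linarith)
    nlinarith

end MinkowskiQuotient

/-! ### Derivatives of `σ_k/σ_l`: none dominates the others -/

namespace MinkowskiQuotient
open Polynomial

variable {n : ℕ}

/-- The elementary symmetric function `σ_j(λ)`. -/
noncomputable def sig (x : Fin n → ℝ) (j : ℕ) : ℝ := (Finset.univ.val.map x).esymm j

/-- The elementary symmetric function `σ_{j;i}(λ)`, with the entry `λ_i` deleted. -/
noncomputable def sigE (x : Fin n → ℝ) (i : Fin n) (j : ℕ) : ℝ := ((Finset.univ.erase i).val.map x).esymm j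

/-- The partial derivative `∂σ_j/∂λ_i`. -/
noncomputable def dsig (x : Fin n → ℝ) (i : Fin n) : ℕ → ℝ
  | 0 => 0
  | j + 1 => sigE x i j

theorem dsig_succ (x : Fin n → ℝ) (i : Fin n) (j : ℕ) : dsig x i (j + 1) = sigE x i j := rfl

theorem univ_map_eq_cons (x : Fin n → ℝ) (i : Fin n) :
    Finset.univ.val.map x = x i ::ₘ (Finset.univ.erase i).val.map x := by
  rw [← Multiset.map_cons, ← Finset.insert_val_of_notMem (Finset.notMem_erase i _),
    Finset.insert_erase (Finset.mem_univ i)]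

theorem sig_eq (x : Fin n → ℝ) (i : Fin n) (j : ℕ) :
    sig x j = sigE x i j + x i * dsig x i j := by
  rcases j with _ | j
  · simp [sig, sigE, dsig, esymm_zero']
  · simp only [sig, dsig, sigE]; rw [univ_map_eq_cons x i, esymm_cons]

theorem sig_zero (x : Fin n → ℝ) : sig x 0 = 1 := esymm_zero' _
-- Euler's relation, read off from the derivative of the generating polynomial `∏ (1 + λ_a X)`.
theorem sum_mul_dsig (x : Fin n → ℝ) (j : ℕ) : ∑ i, x i * dsig x i j = j * sig x j := by
  rcases j with _ | j
  · simp [dsig]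
  · have h : ∀ s : Finset (Fin n), ∀ i, (∏ a ∈ s, (1 + C (x a) * X : ℝ[X])).coeff i
        = (s.val.map x).esymm i := fun s i => by
      rw [← coeff_prod_one_add, Multiset.map_map]; rfl
    have h1 := congrArg (fun p => Polynomial.coeff p j)
      (derivative_prod_finset (s := Finset.univ) (f := fun a => (1 + C (x a) * X : ℝ[X])))
    simp only [coeff_derivative, finsetSum_coeff, h] at h1
    rw [sig]; push_cast
    rw [mul_comm, h1]
    refine Finset.sum_congr rfl fun i _ => ?_
    have e : derivative (1 + C (x i) * X : ℝ[X]) = C (x i) := by simp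
    rw [e, coeff_mul_C, h, mul_comm]; rfl

theorem sum_sigE (x : Fin n → ℝ) (j : ℕ) : ∑ i, sigE x i j = (n - j) * sig x j := by
  have : ∀ i, sigE x i j = sig x j - x i * dsig x i j := fun i => by rw [sig_eq x i j]; ring
  simp only [this, Finset.sum_sub_distrib, sum_mul_dsig]
  simp; ring

theorem card_erase_map (x : Fin n → ℝ) (i : Fin n) :
    (((Finset.univ.erase i).val.map x).card : ℝ) = n - 1 := by
  have : 0 < n := i.pos
  simp [Nat.cast_sub (Nat.succ_le_of_lt this)]

theorem sigE_pos {k : ℕ} {x : Fin n → ℝ} (h : ∀ j ≤ k, 0 < sig x j) (i : Fin n) :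
    ∀ j < k, 0 < sigE x i j := by
  simp only [sig, univ_map_eq_cons x i] at h
  exact esymm_pos_of_cons h

theorem dsig_nonneg {k : ℕ} {x : Fin n → ℝ} (h : ∀ j ≤ k, 0 < sig x j) (i : Fin n) :
    ∀ j ≤ k, 0 ≤ dsig x i j := by
  intro j hj
  rcases j with _ | j
  · exact le_rfl
  · exact (sigE_pos h i j hj).le

/-- Newton's inequality for the `n - 1` remaining entries. Writing `dsig` for `σ_{j-1;i}` includes
`j = 0`. -/
theorem newton_sigE (x : Fin n → ℝ) (i : Fin n) (j : ℕ) :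
    ((n : ℝ) - j) * (j + 1) * (sigE x i (j + 1) * dsig x i j)
      ≤ j * (n - j - 1) * sigE x i j ^ 2 := by
  rcases j with _ | j
  · simp [dsig]
  · have := newton_esymm ((Finset.univ.erase i).val.map x) j
    rw [card_erase_map] at this
    simp only [dsig, sigE]
    push_cast at this ⊢
    linarith

/-- The numerator of `∂(σ_{j+1}/σ_j)/∂λ_i`. -/
noncomputable def quotNum (x : Fin n → ℝ) (i : Fin n) (j : ℕ) : ℝ :=
  dsig x i (j + 1) * sig x j - sig x (j + 1) * dsig x i j

/-- After expansion in `λ_i` the terms containing `λ_i` cancel, and a Newton difference remains. -/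
theorem quotNum_eq (x : Fin n → ℝ) (i : Fin n) (j : ℕ) :
    quotNum x i j = sigE x i j ^ 2 - sigE x i (j + 1) * dsig x i j := by
  rw [quotNum, sig_eq x i j, sig_eq x i (j + 1)]; simp only [dsig]; ring

/-- Newton's inequality is strict enough to leave a definite share: `(n-j)(j+1) - j(n-j-1) = n`,
while `(n-j)(j+1) ≤ n²`. -/
theorem quotNum_ge {j : ℕ} (hj : j + 2 ≤ n) (x : Fin n → ℝ) (i : Fin n) :
    sigE x i j ^ 2 ≤ n * quotNum x i j := by
  have h := newton_sigE x i j
  rw [quotNum_eq]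
  have hj' : (j : ℝ) + 2 ≤ n := by exact_mod_cast hj
  have hj0 : (0 : ℝ) ≤ j := Nat.cast_nonneg _
  generalize sigE x i (j + 1) * dsig x i j = t at *
  have hq : 0 ≤ sigE x i j ^ 2 := sq_nonneg _
  generalize sigE x i j ^ 2 = q at *
  have hA : (0 : ℝ) < (n - j) * (j + 1) := by nlinarith
  have h1 : (n : ℝ) * q ≤ (n - j) * (j + 1) * (q - t) := by linarith
  have h2 : 0 ≤ q - t := by
    have : 0 ≤ ((n : ℝ) - j) * (j + 1) * (q - t) := le_trans (by positivity) h1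
    exact nonneg_of_mul_nonneg_right this hA
  have h3 : ((n : ℝ) - j) * (j + 1) ≤ n * n := by
    apply mul_le_mul <;> linarith
  have h4 := mul_le_mul_of_nonneg_right h3 h2
  have hn : (0 : ℝ) < n := by linarith
  have : (n : ℝ) * q ≤ n * (n * (q - t)) := by linarith
  exact le_of_mul_le_mul_left this hn

/-- The sum equals `(n-j-1) σ_{j;i} + (n-j) λ_i ∂_iσ_j`, so only `λ_i < 0` is in question. Then
`σ_{j+1} > 0` gives `-λ_i σ_{j;i} < σ_{j+1;i}`, and Newton bounds the negative part by `j/(j+1)` of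
the positive one. -/
theorem sum_erase_sigE_ge {j : ℕ} (hj : j + 2 ≤ n) {x : Fin n → ℝ}
    (hx : ∀ i ≤ j + 1, 0 < sig x i) (i : Fin n) :
    sigE x i j ≤ n * ∑ a ∈ Finset.univ.erase i, sigE x a j := by
  have hS : ∑ a ∈ Finset.univ.erase i, sigE x a j = (n - j) * sig x j - sigE x i j := by
    rw [← sum_sigE, ← Finset.add_sum_erase _ _ (Finset.mem_univ i)]; ring
  rw [hS]
  have hN := newton_sigE x i j
  have hs := sigE_pos hx i j (by omega)
  have hd := dsig_nonneg hx i j (by omega)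
  have h1 := hx (j + 1) le_rfl
  rw [sig_eq x i (j + 1)] at h1
  simp only [dsig] at h1
  rw [sig_eq x i j]
  have hj' : (j : ℝ) + 2 ≤ n := by exact_mod_cast hj
  have hj0 : (0 : ℝ) ≤ j := Nat.cast_nonneg _
  generalize sigE x i (j + 1) = s2 at *
  generalize sigE x i j = s1 at *
  generalize dsig x i j = s0 at *
  generalize x i = b at *
  generalize (n : ℝ) = N at *
  have e : (N - j) * (s1 + b * s0) - s1 = (N - j - 1) * s1 + b * ((N - j) * s0) := by ring
  rw [e]
  have hnj : 0 < N - j - 1 := by linarith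
  have hfin : s1 ≤ (j + 1) * ((N - j - 1) * s1 + b * ((N - j) * s0)) := by
    rcases le_or_gt 0 b with hb | hb
    · have : 0 ≤ b * ((N - j) * s0) := by
        apply mul_nonneg hb; apply mul_nonneg _ hd; linarith
      nlinarith [mul_nonneg hj0 (mul_nonneg hnj.le hs.le), mul_nonneg hj0 this,
        mul_nonneg (by linarith : 0 ≤ N - j - 2) hs.le]
    · have h2 : -b * s1 * ((N - j) * (j + 1) * s0) ≤ s2 * ((N - j) * (j + 1) * s0) := by
        apply mul_le_mul_of_nonneg_right (by linarith)
        have : 0 ≤ N - j := by linarith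
        positivity
      have h3 : s1 * (-b * ((N - j) * (j + 1) * s0)) ≤ s1 * (j * (N - j - 1) * s1) := by
        linarith
      have h4 := le_of_mul_le_mul_left h3 hs
      nlinarith [mul_nonneg (by linarith : 0 ≤ N - j - 2) hs.le]
  have hpos : 0 ≤ (N - j - 1) * s1 + b * ((N - j) * s0) := by
    have : 0 < (j : ℝ) + 1 := by linarith
    exact nonneg_of_mul_nonneg_right (hs.le.trans hfin) this
  have := mul_le_mul_of_nonneg_right (by linarith : (j : ℝ) + 1 ≤ N) hpos
  linarith

theorem quotNum_nonneg {j : ℕ} (hj : j + 2 ≤ n) (x : Fin n → ℝ) (i : Fin n) :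
    0 ≤ quotNum x i j := by
  have hn : (0 : ℝ) < n := by exact_mod_cast i.pos
  exact nonneg_of_mul_nonneg_right ((sq_nonneg _).trans (quotNum_ge hj x i)) hn

/-- No single partial derivative of `σ_{j+1}/σ_j` dominates the others. -/
theorem quotNum_le_sum_erase {j : ℕ} (hj : j + 2 ≤ n) {x : Fin n → ℝ}
    (hx : ∀ i ≤ j + 1, 0 < sig x i) (i : Fin n) :
    quotNum x i j ≤ n ^ 3 * (n + 1) * ∑ a ∈ Finset.univ.erase i, quotNum x a j := by
  set S := ∑ a ∈ Finset.univ.erase i, sigE x a j with hSdef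
  have hA := sum_erase_sigE_ge hj hx i
  have hS : S = (n - j) * sig x j - sigE x i j := by
    rw [hSdef, ← sum_sigE, ← Finset.add_sum_erase _ _ (Finset.mem_univ i)]; ring
  rw [← hSdef] at hA
  have hj' : (j : ℝ) + 2 ≤ n := by exact_mod_cast hj
  have hj0 : (0 : ℝ) ≤ j := Nat.cast_nonneg _
  have hs := sigE_pos hx i j (by omega)
  have hσ := hx j (by omega)
  have hS0 : 0 ≤ S := by
    have : (0 : ℝ) < n := by linarith
    exact nonneg_of_mul_nonneg_right (hs.le.trans hA) this
  -- `(n-j) σ_j = S + σ_{j;i} ≤ (n+1) S` and `n - j ≥ 1`. The final constant collects `n(n+1)` from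
  -- here and `hA`, a factor `n` from Cauchy–Schwarz and a factor `n` from `quotNum_ge`.
  have h1 : sig x j ≤ (n + 1) * S := by nlinarith
  have h2 : quotNum x i j ≤ sigE x i j * sig x j := by
    have := mul_nonneg (hx (j + 1) le_rfl).le (dsig_nonneg hx i j (by omega))
    simp only [quotNum, dsig_succ]; linarith
  have h3 : sigE x i j * sig x j ≤ (n * S) * ((n + 1) * S) :=
    mul_le_mul hA h1 hσ.le (by positivity)
  have h4 : S ^ 2 ≤ n * ∑ a ∈ Finset.univ.erase i, sigE x a j ^ 2 := by
    have := sq_sum_le_card_mul_sum_sq (s := Finset.univ.erase i) (f := fun a => sigE x a j)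
    refine this.trans (mul_le_mul_of_nonneg_right ?_ (Finset.sum_nonneg fun _ _ => sq_nonneg _))
    exact_mod_cast (Finset.card_le_univ _).trans (by simp)
  have h5 : ∑ a ∈ Finset.univ.erase i, sigE x a j ^ 2
      ≤ n * ∑ a ∈ Finset.univ.erase i, quotNum x a j := by
    rw [Finset.mul_sum]; exact Finset.sum_le_sum fun a _ => quotNum_ge hj x a
  have hn : (0 : ℝ) ≤ n := by linarith
  calc quotNum x i j ≤ (n * (n + 1)) * S ^ 2 := by linarith
    _ ≤ (n * (n + 1)) * (n * (n * ∑ a ∈ Finset.univ.erase i, quotNum x a j)) := by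
        apply mul_le_mul_of_nonneg_left _ (by positivity)
        exact h4.trans (mul_le_mul_of_nonneg_left h5 hn)
    _ = _ := by ring

/-- The partial derivative `∂(σ_k/σ_l)/∂λ_i`. -/
noncomputable def dquot (k l : ℕ) (x : Fin n → ℝ) (i : Fin n) : ℝ :=
  (dsig x i k * sig x l - sig x k * dsig x i l) / sig x l ^ 2

/-- The logarithmic derivative of `σ_k/σ_l` telescopes over the consecutive quotients `σ_{j+1}/σ_j`,
which reduces every estimate to those. -/
theorem dquot_eq_sum {k l : ℕ} (hl : l ≤ k) {x : Fin n → ℝ} (hx : ∀ i ≤ k, 0 < sig x i)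
    (i : Fin n) : dquot k l x i = sig x k / sig x l *
      ∑ j ∈ Finset.Ico l k, quotNum x i j / (sig x (j + 1) * sig x j) := by
  have h : ∀ j ∈ Finset.Ico l k, quotNum x i j / (sig x (j + 1) * sig x j)
      = dsig x i (j + 1) / sig x (j + 1) - dsig x i j / sig x j := fun j hj => by
    have hj := Finset.mem_Ico.1 hj
    have h1 := hx j (by omega)
    have h2 := hx (j + 1) (by omega)
    rw [quotNum]; field_simp
  rw [Finset.sum_congr rfl h, Finset.sum_Ico_sub (fun j => dsig x i j / sig x j) hl]
  have h1 := hx l hl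
  have h2 := hx k le_rfl
  rw [dquot]; field_simp

theorem dquot_nonneg {k l : ℕ} (hk : k < n) (hl : l ≤ k) {x : Fin n → ℝ}
    (hx : ∀ i ≤ k, 0 < sig x i) (i : Fin n) : 0 ≤ dquot k l x i := by
  rw [dquot_eq_sum hl hx]
  have h1 := hx l hl
  have h2 := hx k le_rfl
  refine mul_nonneg (by positivity) (Finset.sum_nonneg fun j hj => ?_)
  have hj := Finset.mem_Ico.1 hj
  have h1 := hx j (by omega)
  have h2 := hx (j + 1) (by omega)
  exact div_nonneg (quotNum_nonneg (by omega) x i) (by positivity)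

theorem dquot_le_sum_erase {k l : ℕ} (hk : k < n) (hl : l ≤ k) {x : Fin n → ℝ}
    (hx : ∀ i ≤ k, 0 < sig x i) (i : Fin n) :
    dquot k l x i ≤ n ^ 3 * (n + 1) * ∑ a ∈ Finset.univ.erase i, dquot k l x a := by
  have h1 := hx l hl
  have h2 := hx k le_rfl
  simp only [dquot_eq_sum hl hx]
  rw [← Finset.mul_sum, Finset.sum_comm, mul_left_comm, Finset.mul_sum _ _ ((n : ℝ) ^ 3 * (n + 1))]
  refine mul_le_mul_of_nonneg_left (Finset.sum_le_sum fun j hj => ?_) (by positivity)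
  have hj := Finset.mem_Ico.1 hj
  have h1 := hx j (by omega)
  have h2 := hx (j + 1) (by omega)
  rw [← Finset.sum_div, ← mul_div_assoc]
  exact div_le_div_of_nonneg_right
    (quotNum_le_sum_erase (by omega) (fun a ha => hx a (by omega)) i) (by positivity)

theorem sum_mul_dquot {k l : ℕ} {x : Fin n → ℝ} (hx : 0 < sig x l) :
    ∑ i, x i * dquot k l x i = ((k : ℝ) - l) * (sig x k / sig x l) := by
  have : ∀ i, x i * dquot k l x i
      = (x i * dsig x i k * sig x l - sig x k * (x i * dsig x i l)) / sig x l ^ 2 := fun i => by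
    rw [dquot]; ring
  simp only [this]
  rw [← Finset.sum_div, Finset.sum_sub_distrib, ← Finset.sum_mul, ← Finset.mul_sum,
    sum_mul_dsig, sum_mul_dsig]
  field_simp

end MinkowskiQuotient

/-! ### Differentiating symmetric functions of matrix eigenvalues -/

namespace MinkowskiQuotient
open Matrix

variable {n : ℕ}

/-- The `j`-th elementary symmetric function of the eigenvalues, as a polynomial in the entries. -/
noncomputable def esymmMat (j : ℕ) (M : Matrix (Fin n) (Fin n) ℝ) : ℝ :=
  (-1) ^ j * M.charpoly.coeff (n - j)

theorem esymm_roots_eq_esymmMat {j : ℕ} (hj : j ≤ n) {M : Matrix (Fin n) (Fin n) ℝ}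
    (hM : M.charpoly.roots.card = n) : M.charpoly.roots.esymm j = esymmMat j M := by
  have hd : M.charpoly.natDegree = n := by simp [M.charpoly_natDegree_eq_dim]
  rw [esymmMat, Polynomial.coeff_eq_esymm_roots_of_card (by rw [hM, hd]) (by rw [hd]; omega), hd,
    M.charpoly_monic.leadingCoeff, one_mul, show n - (n - j) = j by omega, ← mul_assoc, ← mul_pow]
  simp

theorem roots_charpoly_diagonal (x : Fin n → ℝ) :
    (diagonal x).charpoly.roots = Finset.univ.val.map x := by
  rw [charpoly_diagonal, Polynomial.roots_prod]
  · simp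
  · simp [Finset.prod_ne_zero_iff, Polynomial.X_sub_C_ne_zero]

theorem esymmMat_diagonal {j : ℕ} (hj : j ≤ n) (x : Fin n → ℝ) :
    esymmMat j (diagonal x) = sig x j := by
  rw [← esymm_roots_eq_esymmMat hj (by simp [roots_charpoly_diagonal]), roots_charpoly_diagonal, sig]

theorem charpoly_conj_of_mul_eq_one {V V' M : Matrix (Fin n) (Fin n) ℝ} (h : V' * V = 1) :
    (V' * M * V).charpoly = M.charpoly := by
  rw [charpoly_mul_comm, ← mul_assoc, mul_eq_one_comm.1 h, one_mul]

theorem hasDerivAt_eval_mvPolynomial {ι : Type*} [Fintype ι] (P : MvPolynomial ι ℝ)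
    {c : ℝ → ι → ℝ} {c' : ι → ℝ} {t : ℝ} (hc : ∀ i, HasDerivAt (fun t => c t i) (c' i) t) :
    HasDerivAt (fun t => MvPolynomial.eval (c t) P)
      (∑ i, MvPolynomial.eval (c t) (MvPolynomial.pderiv i P) * c' i) t := by
  classical
  induction P using MvPolynomial.induction_on with
  | C a => simpa using hasDerivAt_const t a
  | add p q hp hq =>
    simp only [map_add, add_mul, Finset.sum_add_distrib]
    exact hp.add hq
  | mul_X p i hp =>
    simp only [map_mul, MvPolynomial.eval_X, MvPolynomial.pderiv_mul, map_add, add_mul,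
      Finset.sum_add_distrib, MvPolynomial.pderiv_X]
    refine (hp.fun_mul (hc i)).congr_deriv ?_
    rw [Finset.sum_mul]
    congr 1
    · exact Finset.sum_congr rfl fun j _ => by ring
    · rw [Finset.sum_eq_single i]
      · simp
      · intro j _ hj; simp [hj.symm]
      · simp

/-- Entrywise derivative at `0` of a curve of matrices. -/
def EntryDeriv {a b : ℕ} (A : ℝ → Matrix (Fin a) (Fin b) ℝ) (A' : Matrix (Fin a) (Fin b) ℝ) : Prop :=
  ∀ i j, HasDerivAt (fun t => A t i j) (A' i j) 0

theorem EntryDeriv.const {a b : ℕ} (A : Matrix (Fin a) (Fin b) ℝ) :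
    EntryDeriv (fun _ => A) 0 := fun _ _ => hasDerivAt_const _ _

theorem EntryDeriv.mul {A B : ℝ → Matrix (Fin n) (Fin n) ℝ} {A' B' : Matrix (Fin n) (Fin n) ℝ}
    (hA : EntryDeriv A A') (hB : EntryDeriv B B') :
    EntryDeriv (fun t => A t * B t) (A' * B 0 + A 0 * B') := fun i j => by
  simp only [mul_apply, Matrix.add_apply, ← Finset.sum_add_distrib]
  exact HasDerivAt.fun_sum fun c _ => (hA i c).fun_mul (hB c j)

theorem EntryDeriv.smul {f : ℝ → ℝ} {f' : ℝ} {A : ℝ → Matrix (Fin n) (Fin n) ℝ}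
    {A' : Matrix (Fin n) (Fin n) ℝ} (hf : HasDerivAt f f' 0) (hA : EntryDeriv A A') :
    EntryDeriv (fun t => f t • A t) (f' • A 0 + f 0 • A') := fun i j => by
  simpa using hf.fun_mul (hA i j)

theorem EntryDeriv.sub {A B : ℝ → Matrix (Fin n) (Fin n) ℝ} {A' B' : Matrix (Fin n) (Fin n) ℝ}
    (hA : EntryDeriv A A') (hB : EntryDeriv B B') :
    EntryDeriv (fun t => A t - B t) (A' - B') := fun i j => (hA i j).sub (hB i j)

theorem EntryDeriv.trace {A : ℝ → Matrix (Fin n) (Fin n) ℝ} {A' : Matrix (Fin n) (Fin n) ℝ}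
    (hA : EntryDeriv A A') : HasDerivAt (fun t => (A t).trace) A'.trace 0 := by
  simp only [Matrix.trace, diag_apply]
  exact HasDerivAt.fun_sum fun c _ => hA c c

theorem EntryDeriv.line (M X : Matrix (Fin n) (Fin n) ℝ) :
    EntryDeriv (fun t : ℝ => M + t • X) X := fun i j => by
  simp only [Matrix.add_apply, Matrix.smul_apply, smul_eq_mul]
  simpa using ((hasDerivAt_id (0 : ℝ)).mul_const (X i j)).const_add (M i j)

/-- Coefficients of the universal characteristic polynomial are polynomials in the entries. Hence no
differentiability of individual eigenvalues, which may be multiple, is needed. -/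
theorem exists_hasDerivAt_esymmMat (j : ℕ) (M : Matrix (Fin n) (Fin n) ℝ) :
    ∃ D : Fin n → Fin n → ℝ, ∀ (A : ℝ → Matrix (Fin n) (Fin n) ℝ) (A' : Matrix (Fin n) (Fin n) ℝ),
      EntryDeriv A A' → A 0 = M →
      HasDerivAt (fun t => esymmMat j (A t)) (∑ a, ∑ b, D a b * A' a b) 0 := by
  have key : ∀ M : Matrix (Fin n) (Fin n) ℝ, M.charpoly.coeff (n - j) =
      MvPolynomial.eval (fun ab : Fin n × Fin n => M ab.1 ab.2)
        ((charpoly.univ ℝ (Fin n)).coeff (n - j)) := fun M =>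
    (charpoly.univ_coeff_eval₂Hom (Fin n) (RingHom.id ℝ) (fun ab => M ab.1 ab.2) (n - j)).symm
  refine ⟨fun a b => (-1) ^ j * MvPolynomial.eval (fun ab : Fin n × Fin n => M ab.1 ab.2)
    (MvPolynomial.pderiv (a, b) ((charpoly.univ ℝ (Fin n)).coeff (n - j))), fun A A' hA h0 => ?_⟩
  have h := (hasDerivAt_eval_mvPolynomial ((charpoly.univ ℝ (Fin n)).coeff (n - j))
    (c := fun t ab => A t ab.1 ab.2) (c' := fun ab => A' ab.1 ab.2) (fun ab => hA ab.1 ab.2)).const_mul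
      ((-1 : ℝ) ^ j)
  simp only [esymmMat, key]
  refine h.congr_deriv ?_
  rw [Finset.mul_sum, Fintype.sum_prod_type]
  simp only [h0]
  exact Finset.sum_congr rfl fun a _ => Finset.sum_congr rfl fun b _ => by ring

theorem sig_update_add (x : Fin n → ℝ) (a : Fin n) (j : ℕ) (t : ℝ) :
    sig (Function.update x a (x a + t)) j = sig x j + t * dsig x a j := by
  have hE : ∀ j, sigE (Function.update x a (x a + t)) a j = sigE x a j := fun j => by
    rw [sigE, sigE]
    exact congrArg (fun m : Multiset ℝ => m.esymm j) <| Multiset.map_congr rfl fun b hb =>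
      Function.update_of_ne (Finset.mem_erase.1 (show b ∈ Finset.univ.erase a from hb)).1 _ _
  have hd : dsig (Function.update x a (x a + t)) a j = dsig x a j := by
    rcases j with _ | j
    · rfl
    · exact hE j
  rw [sig_eq _ a, sig_eq x a, hE, hd, Function.update_self]; ring

/-- The derivative of `σ_j` of the eigenvalues at a diagonal matrix. -/
theorem hasDerivAt_esymmMat_diagonal {j : ℕ} (hj : j ≤ n) (x : Fin n → ℝ)
    {A : ℝ → Matrix (Fin n) (Fin n) ℝ} {A' : Matrix (Fin n) (Fin n) ℝ} (hA : EntryDeriv A A')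
    (h0 : A 0 = diagonal x) :
    HasDerivAt (fun t => esymmMat j (A t)) (∑ a, dsig x a j * A' a a) 0 := by
  obtain ⟨D, hD⟩ := exists_hasDerivAt_esymmMat j (diagonal x)
  have hsingle : ∀ a b, HasDerivAt
      (fun t : ℝ => esymmMat j (diagonal x + t • Matrix.single a b (1 : ℝ))) (D a b) 0 := fun a b => by
    have h := hD _ _ (EntryDeriv.line (diagonal x) (Matrix.single a b 1)) (by simp)
    refine h.congr_deriv ?_
    simp [Matrix.single_apply, ite_and]
  have hoff : ∀ a b, a ≠ b → D a b = 0 := fun a b hab => by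
    have h1 := hsingle a b
    -- Conjugation by the diagonal sign matrix that flips coordinate `a` reverses the sign of the
    -- off-diagonal perturbation. The function is therefore even in `t` and its derivative at `0`
    -- vanishes.
    have hev : ∀ t : ℝ, esymmMat j (diagonal x + t • Matrix.single a b (1 : ℝ))
        = esymmMat j (diagonal x + (-t) • Matrix.single a b (1 : ℝ)) := fun t => by
      set ε : Matrix (Fin n) (Fin n) ℝ := diagonal (Function.update 1 a (-1)) with hε
      have hεε : ε * ε = 1 := by
        rw [hε, diagonal_mul_diagonal, ← diagonal_one]
        congr 1; ext i
        by_cases h : i = a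
        · subst h; simp
        · simp [Function.update_of_ne h]
      rw [esymmMat, esymmMat, ← charpoly_conj_of_mul_eq_one hεε]
      congr 3
      ext c d
      rw [hε, mul_diagonal, diagonal_mul]
      by_cases hcd : c = d
      · subst hcd
        have : Matrix.single a b (1 : ℝ) c c = 0 := by
          rw [Matrix.single_apply]; simp only [ite_eq_right_iff]; rintro ⟨rfl, rfl⟩; exact absurd rfl hab
        simp only [Matrix.add_apply, Matrix.smul_apply, this, smul_zero, add_zero]
        by_cases h : c = a
        · subst h; simp
        · simp [Function.update_of_ne h]
      · simp only [Matrix.add_apply, diagonal_apply_ne _ hcd, zero_add, Matrix.smul_apply,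
          smul_eq_mul, Matrix.single_apply]
        by_cases h : a = c ∧ b = d
        · obtain ⟨rfl, rfl⟩ := h
          simp [Function.update_of_ne hab.symm]
        · simp [h]
    have h2 : HasDerivAt (fun t : ℝ => esymmMat j (diagonal x + t • Matrix.single a b (1 : ℝ)))
        (-(D a b)) 0 := by
      have := HasDerivAt.scomp (0 : ℝ) (g₁ := fun t : ℝ => esymmMat j (diagonal x + t • Matrix.single a b (1 : ℝ)))
        (h := fun t => -t) (g₁' := D a b) (h' := -1)
        (by rw [neg_zero]; exact h1) (hasDerivAt_neg 0)
      simp only [Function.comp_def, ← hev] at this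
      simpa using this
    have := h1.unique h2
    linarith
  have hdiag : ∀ a, D a a = dsig x a j := fun a => by
    have h1 := hsingle a a
    -- Along `E_aa` the matrix stays diagonal, and `σ_j` is affine in each entry.
    have : (fun t : ℝ => esymmMat j (diagonal x + t • Matrix.single a a (1 : ℝ)))
        = fun t => sig x j + t * dsig x a j := by
      ext t
      rw [← sig_update_add, ← esymmMat_diagonal hj]
      congr 1
      ext c d
      by_cases hcd : c = d
      · subst hcd
        by_cases h : c = a
        · subst h; simp
        · simp [Function.update_of_ne h, Ne.symm h]
      · simp only [Matrix.add_apply, diagonal_apply_ne _ hcd, zero_add, Matrix.smul_apply,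
          smul_eq_mul, Matrix.single_apply]
        rw [if_neg]; · simp
        rintro ⟨rfl, rfl⟩; exact hcd rfl
    rw [this] at h1
    refine h1.unique ?_
    simpa using ((hasDerivAt_id (0 : ℝ)).mul_const (dsig x a j)).const_add (sig x j)
  refine (hD A A' hA h0).congr_deriv ?_
  refine Finset.sum_congr rfl fun a _ => ?_
  rw [Finset.sum_eq_single a (fun b _ hb => by rw [hoff a b hb.symm, zero_mul]) (by simp), hdiag]

end MinkowskiQuotient

/-! ### Frames for the spacelike graph and the chain rule for `G` -/

namespace MinkowskiQuotient
open Matrix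

variable {n : ℕ}

/-- The inverse metric `g^{ij} = δ_ij + p_i p_j / w²`. -/
noncomputable def invMetric (p : Fin n → ℝ) : Matrix (Fin n) (Fin n) ℝ :=
  1 + (1 - ∑ i, p i ^ 2)⁻¹ • vecMulVec p p

/-- The shape operator `g⁻¹ h`. -/
noncomputable def shapeOp (r : Matrix (Fin n) (Fin n) ℝ) (p : Fin n → ℝ) : Matrix (Fin n) (Fin n) ℝ :=
  (lorentzFactor p)⁻¹ • (invMetric p * r)

theorem dotProduct_self_eq (p : Fin n → ℝ) : p ⬝ᵥ p = ∑ i, p i ^ 2 := by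
  simp [dotProduct, sq]

theorem lorentzFactor_pos {p : Fin n → ℝ} (hp : ∑ i, p i ^ 2 < 1) : 0 < lorentzFactor p :=
  Real.sqrt_pos.2 (by linarith)

theorem lorentzFactor_sq {p : Fin n → ℝ} (hp : ∑ i, p i ^ 2 < 1) :
    lorentzFactor p ^ 2 = 1 - ∑ i, p i ^ 2 := Real.sq_sqrt (by linarith)

theorem invMetric_mulVec (p v : Fin n → ℝ) :
    invMetric p *ᵥ v = v + ((1 - ∑ i, p i ^ 2)⁻¹ * (p ⬝ᵥ v)) • p := by
  rw [invMetric, add_mulVec, one_mulVec, smul_mulVec, vecMulVec_mulVec]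
  ext i
  simp [mul_assoc, mul_comm]

theorem invMetric_transpose (p : Fin n → ℝ) : (invMetric p)ᵀ = invMetric p := by
  simp [invMetric, transpose_vecMulVec]

theorem metric_mul_invMetric {p : Fin n → ℝ} (hp : ∑ i, p i ^ 2 < 1) :
    metric p * invMetric p = 1 := by
  have h : (1 - ∑ i, p i ^ 2) ≠ 0 := by linarith
  rw [metric, invMetric, sub_mul, one_mul, mul_add, mul_one, mul_smul_comm,
    vecMulVec_mul_vecMulVec, dotProduct_self_eq]
  ext i j
  simp only [Matrix.sub_apply, Matrix.add_apply, Matrix.smul_apply, smul_eq_mul, vecMulVec_apply,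
    Pi.smul_apply]
  field_simp
  ring

theorem metric_inv {p : Fin n → ℝ} (hp : ∑ i, p i ^ 2 < 1) : (metric p)⁻¹ = invMetric p :=
  inv_eq_right_inv (metric_mul_invMetric hp)

theorem inv_metric_mul_eta {p : Fin n → ℝ} (hp : ∑ i, p i ^ 2 < 1) (r : Matrix (Fin n) (Fin n) ℝ) :
    (metric p)⁻¹ * etaTensor r p = (shapeOp r p).trace • 1 - shapeOp r p := by
  rw [etaTensor, meanCurvature, metric_inv hp, mul_sub, mul_smul_comm,
    mul_eq_one_comm.1 (metric_mul_invMetric hp), secondForm, shapeOp, mul_smul_comm]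

theorem exists_sqrt_invMetric {p : Fin n → ℝ} (hp : ∑ i, p i ^ 2 < 1) :
    ∃ B : Matrix (Fin n) (Fin n) ℝ, Bᵀ = B ∧ B * B = invMetric p := by
  set w := lorentzFactor p with hw
  have hw0 := lorentzFactor_pos hp
  have hw2 := lorentzFactor_sq hp
  -- `(1 + c p⊗p)² = 1 + (2c + c²|p|²) p⊗p`. With `|p|² = 1 - w²`, this `c` solves `2c + c²|p|² =
  -- 1/w²`.
  obtain ⟨c, hc⟩ : ∃ c, c = (w * (1 + w))⁻¹ := ⟨_, rfl⟩
  refine ⟨1 + c • vecMulVec p p, by simp [transpose_vecMulVec], ?_⟩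
  rw [invMetric, ← hw2, add_mul, one_mul, mul_add, mul_one, mul_smul_comm, smul_mul_assoc,
    vecMulVec_mul_vecMulVec, dotProduct_self_eq, show ∑ i, p i ^ 2 = 1 - w ^ 2 by linarith, ← hw]
  ext i j
  simp only [Matrix.add_apply, Matrix.smul_apply, smul_eq_mul, vecMulVec_apply,
    Pi.smul_apply]
  rw [← hw] at hw0
  rw [hc]
  field_simp
  ring

/-- Simultaneous diagonalization of the first and second fundamental forms. -/
theorem exists_frame {p : Fin n → ℝ} (hp : ∑ i, p i ^ 2 < 1) {r : Matrix (Fin n) (Fin n) ℝ}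
    (hr : rᵀ = r) : ∃ (V : Matrix (Fin n) (Fin n) ℝ) (x : Fin n → ℝ),
      V * Vᵀ = invMetric p ∧ (lorentzFactor p)⁻¹ • (Vᵀ * r * V) = diagonal x := by
  obtain ⟨B, hB, hBB⟩ := exists_sqrt_invMetric hp
  have hA : ((lorentzFactor p)⁻¹ • (B * r * B)).IsHermitian := by
    rw [IsHermitian, conjTranspose_eq_transpose_of_trivial, transpose_smul, transpose_mul,
      transpose_mul, hr, hB, mul_assoc]
  have hs := hA.conjStarAlgAut_star_eigenvectorUnitary
  rw [Unitary.conjStarAlgAut_star_apply] at hs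
  set U : Matrix (Fin n) (Fin n) ℝ := (hA.eigenvectorUnitary : Matrix (Fin n) (Fin n) ℝ) with hU
  have hUs : star U = Uᵀ := by
    rw [star_eq_conjTranspose, conjTranspose_eq_transpose_of_trivial]
  have hUU : U * Uᵀ = 1 := by rw [← hUs]; exact Unitary.coe_mul_star_self _
  -- `B` is the symmetric root of `g⁻¹`, and the orthogonal `U` diagonalizes `B h B`; it does not
  -- affect `V Vᵀ`.
  refine ⟨B * U, hA.eigenvalues, ?_, ?_⟩
  · rw [transpose_mul, hB, mul_assoc, ← mul_assoc U, hUU, one_mul, hBB]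
  · rw [hUs] at hs
    rw [transpose_mul, hB]
    refine Eq.trans ?_ (hs.trans rfl)
    rw [mul_smul_comm, smul_mul_assoc]
    simp only [mul_assoc]

/-- The eigenvalues `λ_i = ∑_{j ≠ i} κ_j`. -/
def coSum (x : Fin n → ℝ) (i : Fin n) : ℝ := ∑ j, x j - x i

section Frame

variable {p : Fin n → ℝ} {r V : Matrix (Fin n) (Fin n) ℝ} {x : Fin n → ℝ}

/-- A frame orthonormal for `g` has inverse `Vᵀ g`, so conjugation by `V` turns `g⁻¹h` and `g⁻¹η`
into diagonal matrices. -/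
theorem frame_inv (hp : ∑ i, p i ^ 2 < 1) (hV : V * Vᵀ = invMetric p) :
    (Vᵀ * metric p) * V = 1 := by
  apply mul_eq_one_comm.1
  rw [← mul_assoc, hV]
  exact mul_eq_one_comm.1 (metric_mul_invMetric hp)

theorem frame_inv_mul_invMetric (hp : ∑ i, p i ^ 2 < 1) :
    (Vᵀ * metric p) * invMetric p = Vᵀ := by
  rw [mul_assoc, metric_mul_invMetric hp, mul_one]

theorem frame_shapeOp (hp : ∑ i, p i ^ 2 < 1)
    (hx : (lorentzFactor p)⁻¹ • (Vᵀ * r * V) = diagonal x) :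
    (Vᵀ * metric p) * shapeOp r p * V = diagonal x := by
  rw [shapeOp, mul_smul_comm, ← mul_assoc, frame_inv_mul_invMetric hp, smul_mul_assoc, hx]

theorem conj_trace_sub {V' S : Matrix (Fin n) (Fin n) ℝ} (h : V' * V = 1) :
    V' * (S.trace • 1 - S) * V = (V' * S * V).trace • 1 - V' * S * V := by
  rw [mul_sub, sub_mul, mul_smul_comm, mul_one, smul_mul_assoc, h, mul_assoc V' S V,
    trace_mul_comm V', mul_assoc S, mul_eq_one_comm.1 h, mul_one]

theorem trace_sub_diagonal (x : Fin n → ℝ) :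
    (diagonal x).trace • (1 : Matrix (Fin n) (Fin n) ℝ) - diagonal x = diagonal (coSum x) := by
  ext i j
  by_cases h : i = j
  · subst h; simp [coSum, trace_diagonal]
  · simp [h]

theorem frame_eta (hp : ∑ i, p i ^ 2 < 1) (hV : V * Vᵀ = invMetric p)
    (hx : (lorentzFactor p)⁻¹ • (Vᵀ * r * V) = diagonal x) :
    (Vᵀ * metric p) * ((metric p)⁻¹ * etaTensor r p) * V = diagonal (coSum x) := by
  rw [inv_metric_mul_eta hp, conj_trace_sub (frame_inv hp hV), frame_shapeOp hp hx,
    trace_sub_diagonal]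

theorem etaEigenvalues_eq (hp : ∑ i, p i ^ 2 < 1) (hV : V * Vᵀ = invMetric p)
    (hx : (lorentzFactor p)⁻¹ • (Vᵀ * r * V) = diagonal x) :
    etaEigenvalues r p = Finset.univ.val.map (coSum x) := by
  rw [etaEigenvalues, ← charpoly_conj_of_mul_eq_one (frame_inv hp hV), frame_eta hp hV hx,
    roots_charpoly_diagonal]

end Frame

/-- The frame shows that the characteristic polynomial of `g⁻¹η` has all its roots real. Vieta then
expresses `G` through polynomials in matrix entries, which can be differentiated. -/
theorem etaEigenvalues_esymm {j : ℕ} (hj : j ≤ n) {p : Fin n → ℝ} (hp : ∑ i, p i ^ 2 < 1)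
    {r : Matrix (Fin n) (Fin n) ℝ} (hr : rᵀ = r) :
    (etaEigenvalues r p).esymm j = esymmMat j ((shapeOp r p).trace • 1 - shapeOp r p) := by
  obtain ⟨V, x, hV, hx⟩ := exists_frame hp hr
  have h := etaEigenvalues_eq hp hV hx
  rw [← inv_metric_mul_eta hp, ← esymm_roots_eq_esymmMat hj]
  · rfl
  · rw [← etaEigenvalues, h]; simp

theorem hasDerivAt_sum_sq {p : ℝ → Fin n → ℝ} {p' : Fin n → ℝ}
    (hp' : ∀ i, HasDerivAt (fun t => p t i) (p' i) 0) :
    HasDerivAt (fun t => 1 - ∑ i, p t i ^ 2) (-(2 * (p 0 ⬝ᵥ p'))) 0 := by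
  have : HasDerivAt (fun t => ∑ i, p t i ^ 2) (2 * (p 0 ⬝ᵥ p')) 0 := by
    rw [dotProduct, Finset.mul_sum]
    refine HasDerivAt.fun_sum fun i _ => ((hp' i).fun_pow 2).congr_deriv ?_
    push_cast; ring
  exact this.const_sub 1

theorem hasDerivAt_lorentzFactor_inv {p : ℝ → Fin n → ℝ} {p' : Fin n → ℝ}
    (hp : ∑ i, p 0 i ^ 2 < 1) (hp' : ∀ i, HasDerivAt (fun t => p t i) (p' i) 0) :
    HasDerivAt (fun t => (lorentzFactor (p t))⁻¹)
      ((1 - ∑ i, p 0 i ^ 2)⁻¹ * (p 0 ⬝ᵥ p') * (lorentzFactor (p 0))⁻¹) 0 := by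
  have hw0 := lorentzFactor_pos hp
  have h : HasDerivAt (fun t => lorentzFactor (p t))
      (-(2 * (p 0 ⬝ᵥ p')) / (2 * lorentzFactor (p 0))) 0 :=
    (hasDerivAt_sum_sq hp').sqrt (by linarith)
  refine (h.fun_inv hw0.ne').congr_deriv ?_
  rw [← lorentzFactor_sq hp]
  field_simp

/-- This is `-g⁻¹ g' g⁻¹`. In this factored form the frame absorbs both inverse metrics, whereas the
derivative of the explicit formula for `g⁻¹` would not simplify. -/
theorem entryDeriv_invMetric {p : ℝ → Fin n → ℝ} {p' : Fin n → ℝ}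
    (hp : ∑ i, p 0 i ^ 2 < 1) (hp' : ∀ i, HasDerivAt (fun t => p t i) (p' i) 0) :
    EntryDeriv (fun t => invMetric (p t))
      (invMetric (p 0) * (vecMulVec p' (p 0) + vecMulVec (p 0) p') * invMetric (p 0)) := fun i j => by
  have hq : HasDerivAt (fun t => (1 - ∑ i, p t i ^ 2)⁻¹) _ 0 :=
    (hasDerivAt_sum_sq hp').fun_inv (by linarith)
  have h := ((hq.fun_mul ((hp' i).fun_mul (hp' j))).const_add ((1 : Matrix (Fin n) (Fin n) ℝ) i j))
  refine (h.congr_deriv ?_)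
  have hT : ∀ v, v ᵥ* invMetric (p 0) = invMetric (p 0) *ᵥ v := fun v => by
    rw [← mulVec_transpose, invMetric_transpose]
  have e : invMetric (p 0) * (vecMulVec p' (p 0) + vecMulVec (p 0) p') * invMetric (p 0)
      = vecMulVec (invMetric (p 0) *ᵥ p') (invMetric (p 0) *ᵥ p 0)
        + vecMulVec (invMetric (p 0) *ᵥ p 0) (invMetric (p 0) *ᵥ p') := by
    rw [mul_add, add_mul, mul_vecMulVec, mul_vecMulVec, vecMulVec_mul, vecMulVec_mul, hT, hT]
  rw [e]
  simp only [Matrix.add_apply, vecMulVec_apply, invMetric_mulVec, Pi.add_apply, Pi.smul_apply,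
    smul_eq_mul, dotProduct_self_eq]
  have h1 : (1 - ∑ i, p 0 i ^ 2) ≠ 0 := by linarith
  generalize p 0 ⬝ᵥ p' = d
  generalize ∑ i, p 0 i ^ 2 = q at *
  field_simp
  ring

/-- The weights `F_i = ∑_{j ≠ i} ∂(σ_k/σ_l)/∂λ_j`, the derivatives of `σ_k/σ_l(λ(η))` with respect
to the principal curvatures `κ_i`. -/
noncomputable def curvWeight (k l : ℕ) (x : Fin n → ℝ) (i : Fin n) : ℝ :=
  ∑ a ∈ Finset.univ.erase i, dquot k l (coSum x) a

/-- The transpose of the linear map `κ ↦ λ`: it converts derivatives in `λ` into derivatives in `κ`.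
-/
theorem sum_coSum_mul (f y : Fin n → ℝ) :
    ∑ a, f a * (∑ b, y b - y a) = ∑ b, (∑ a ∈ Finset.univ.erase b, f a) * y b := by
  have : ∀ b, ∑ a ∈ Finset.univ.erase b, f a = ∑ a, f a - f b := fun b => by
    rw [← Finset.add_sum_erase _ _ (Finset.mem_univ b)]; ring
  simp only [this, mul_sub, sub_mul, Finset.sum_sub_distrib, ← Finset.sum_mul, ← Finset.mul_sum]

/-- The chain rule for `G` along curves of symmetric matrices and spacelike gradients. -/
theorem hasDerivAt_G {k l : ℕ} (hk : k ≤ n) (hl : l ≤ n) {r : ℝ → Matrix (Fin n) (Fin n) ℝ}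
    {r' : Matrix (Fin n) (Fin n) ℝ} {p : ℝ → Fin n → ℝ} {p' : Fin n → ℝ}
    (hr : ∀ᶠ t in nhds (0 : ℝ), (r t)ᵀ = r t) (hr' : EntryDeriv r r')
    (hp : ∑ i, p 0 i ^ 2 < 1) (hp' : ∀ i, HasDerivAt (fun t => p t i) (p' i) 0)
    {V : Matrix (Fin n) (Fin n) ℝ} {x : Fin n → ℝ} (hV : V * Vᵀ = invMetric (p 0))
    (hx : (lorentzFactor (p 0))⁻¹ • (Vᵀ * r 0 * V) = diagonal x) (hsig : 0 < sig (coSum x) l) :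
    HasDerivAt (fun t => G k l (r t) (p t))
      (∑ b, curvWeight k l x b * ((1 - ∑ i, p 0 i ^ 2)⁻¹ * (p 0 ⬝ᵥ p') * x b
        + 2 * (Vᵀ *ᵥ p') b * (Vᵀ *ᵥ p 0) b * x b
        + (lorentzFactor (p 0))⁻¹ * (Vᵀ * r' * V) b b)) 0 := by
  -- The frame is frozen at `t = 0`. A fixed conjugation leaves characteristic polynomials unchanged
  -- and makes the matrix diagonal at `t = 0`, so no derivative of the frame is needed.
  set V' := Vᵀ * metric (p 0) with hV'
  have hVV : V' * V = 1 := frame_inv hp hV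
  set w := lorentzFactor (p 0) with hw
  -- derivative of the shape operator in the frame
  have hS := EntryDeriv.smul (hasDerivAt_lorentzFactor_inv hp hp')
    ((entryDeriv_invMetric hp hp').mul hr')
  set S' := ((1 - ∑ i, p 0 i ^ 2)⁻¹ * (p 0 ⬝ᵥ p') * (lorentzFactor (p 0))⁻¹) •
      (invMetric (p 0) * r 0) + (lorentzFactor (p 0))⁻¹ •
      (invMetric (p 0) * (vecMulVec p' (p 0) + vecMulVec (p 0) p') * invMetric (p 0) * r 0
        + invMetric (p 0) * r') with hS'
  have hK : EntryDeriv (fun t => V' * shapeOp (r t) (p t) * V) (V' * S' * V) := by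
    have := ((EntryDeriv.const V').mul hS).mul (EntryDeriv.const V)
    simpa [shapeOp] using this
  have hY : ∀ b, (V' * S' * V) b b = (1 - ∑ i, p 0 i ^ 2)⁻¹ * (p 0 ⬝ᵥ p') * x b
        + 2 * (Vᵀ *ᵥ p') b * (Vᵀ *ᵥ p 0) b * x b + w⁻¹ * (Vᵀ * r' * V) b b := fun b => by
    have hVg : V' * invMetric (p 0) = Vᵀ := frame_inv_mul_invMetric hp
    have e1 : V' * S' * V = ((1 - ∑ i, p 0 i ^ 2)⁻¹ * (p 0 ⬝ᵥ p')) • (w⁻¹ • (Vᵀ * r 0 * V))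
        + (Vᵀ * (vecMulVec p' (p 0) + vecMulVec (p 0) p') * V) * (w⁻¹ • (Vᵀ * r 0 * V))
        + w⁻¹ • (Vᵀ * r' * V) := by
      rw [hS', ← hV]
      simp only [mul_add, add_mul, mul_smul_comm, smul_mul_assoc, smul_add, smul_smul]
      rw [← hw]
      have hVg' : ∀ M : Matrix (Fin n) (Fin n) ℝ, V' * (V * (Vᵀ * M)) = Vᵀ * M := fun M => by
        rw [← mul_assoc, hVV, one_mul]
      simp only [mul_assoc, hVg']
      abel
    rw [e1, hx]
    simp only [Matrix.add_apply, Matrix.smul_apply, smul_eq_mul, diagonal_apply_eq, mul_diagonal]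
    congr 2
    rw [mul_add, add_mul, mul_vecMulVec, mul_vecMulVec, vecMulVec_mul, vecMulVec_mul]
    simp only [Matrix.add_apply, vecMulVec_apply, ← mulVec_transpose]
    ring
  have hM : EntryDeriv (fun t => (V' * shapeOp (r t) (p t) * V).trace • (1 : Matrix (Fin n) (Fin n) ℝ)
      - V' * shapeOp (r t) (p t) * V) ((V' * S' * V).trace • 1 - V' * S' * V) := by
    have := (EntryDeriv.smul hK.trace (EntryDeriv.const (1 : Matrix (Fin n) (Fin n) ℝ))).sub hK
    simpa using this
  have h0 : (V' * shapeOp (r 0) (p 0) * V).trace • (1 : Matrix (Fin n) (Fin n) ℝ)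
      - V' * shapeOp (r 0) (p 0) * V = diagonal (coSum x) := by
    rw [frame_shapeOp hp hx, trace_sub_diagonal]
  have hdk := hasDerivAt_esymmMat_diagonal hk (coSum x) hM h0
  have hdl := hasDerivAt_esymmMat_diagonal hl (coSum x) hM h0
  have e0 : ∀ j ≤ n, esymmMat j ((V' * shapeOp (r 0) (p 0) * V).trace • (1 : Matrix (Fin n) (Fin n) ℝ)
      - V' * shapeOp (r 0) (p 0) * V) = sig (coSum x) j := fun j hj => by
    rw [h0, esymmMat_diagonal hj]
  have hdiv := hdk.fun_div hdl (by rw [e0 l hl]; exact hsig.ne')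
  have hpev : ∀ᶠ t in nhds (0 : ℝ), ∑ i, p t i ^ 2 < 1 := by
    have := (hasDerivAt_sum_sq hp').continuousAt.eventually (lt_mem_nhds (show (0 : ℝ) < _ by linarith))
    filter_upwards [this] with t ht
    linarith
  have hG : (fun t => G k l (r t) (p t)) =ᶠ[nhds 0] fun t =>
      esymmMat k ((V' * shapeOp (r t) (p t) * V).trace • (1 : Matrix (Fin n) (Fin n) ℝ)
        - V' * shapeOp (r t) (p t) * V) /
      esymmMat l ((V' * shapeOp (r t) (p t) * V).trace • (1 : Matrix (Fin n) (Fin n) ℝ)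
        - V' * shapeOp (r t) (p t) * V) := by
    filter_upwards [hpev, hr] with t h1 h2
    rw [G, etaEigenvalues_esymm hk h1 h2, etaEigenvalues_esymm hl h1 h2, ← conj_trace_sub hVV]
    simp only [esymmMat, charpoly_conj_of_mul_eq_one hVV]
  refine (hdiv.congr_of_eventuallyEq hG).congr_deriv ?_
  rw [e0 k hk, e0 l hl]
  simp only [← hY]
  simp only [curvWeight]
  rw [← sum_coSum_mul, Finset.sum_mul, Finset.mul_sum, ← Finset.sum_sub_distrib, Finset.sum_div]
  refine Finset.sum_congr rfl fun a _ => ?_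
  simp only [Matrix.sub_apply, Matrix.smul_apply, smul_eq_mul, one_apply_eq, mul_one, dquot]
  simp only [Matrix.trace, diag_apply]
  ring

end MinkowskiQuotient

/-! ### Uniform ellipticity and the size of the derivatives of `G` -/

namespace MinkowskiQuotient
open Matrix

variable {n : ℕ}

theorem frame_quadratic (V M : Matrix (Fin n) (Fin n) ℝ) (b : Fin n) :
    (Vᵀ * M * V) b b = ∑ c, ∑ d, V c b * V d b * M c d := by
  simp only [mul_apply, transpose_apply, Finset.sum_mul]
  rw [Finset.sum_comm]
  exact Finset.sum_congr rfl fun c _ => Finset.sum_congr rfl fun d _ => by ring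

theorem sum_frame_sq {p : Fin n → ℝ} {V : Matrix (Fin n) (Fin n) ℝ} (hV : V * Vᵀ = invMetric p)
    (ξ : Fin n → ℝ) :
    ∑ b, (∑ a, V a b * ξ a) ^ 2
      = ∑ a, ξ a ^ 2 + (1 - ∑ i, p i ^ 2)⁻¹ * (∑ a, p a * ξ a) ^ 2 := by
  have h1 : ∑ b, (∑ a, V a b * ξ a) ^ 2 = (Vᵀ *ᵥ ξ) ⬝ᵥ (Vᵀ *ᵥ ξ) := by
    simp [dotProduct, mulVec, sq]
  rw [h1, dotProduct_mulVec, vecMul_transpose, mulVec_mulVec, hV, invMetric_mulVec,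
    add_dotProduct, smul_dotProduct, dotProduct_self_eq]
  simp only [dotProduct, smul_eq_mul]; ring

/-- The dimensional constant in the uniform ellipticity estimate. -/
noncomputable def ellConst (n : ℕ) : ℝ := (n : ℝ) ^ 3 * (n + 1) + 1

theorem ellConst_pos (n : ℕ) : 0 < ellConst n := by unfold ellConst; positivity

/-- The weight of `κ_b` omits only the `b`-th `λ`-derivative, and that one is dominated by the rest.
This comparability of all weights is the source of uniform ellipticity. -/
theorem curvWeight_bounds {k l : ℕ} (hk : k < n) (hl : l ≤ k) {x : Fin n → ℝ}
    (hx : ∀ j ≤ k, 0 < sig (coSum x) j) (b : Fin n) :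
    (∑ a, dquot k l (coSum x) a) ≤ ellConst n * curvWeight k l x b ∧
      curvWeight k l x b ≤ ∑ a, dquot k l (coSum x) a := by
  have h1 := dquot_le_sum_erase hk hl hx b
  have h2 := dquot_nonneg hk hl hx b
  rw [← Finset.add_sum_erase _ _ (Finset.mem_univ b), curvWeight, ellConst]
  constructor <;> linarith

theorem sum_curvWeight_mul {k l : ℕ} {x : Fin n → ℝ} (hx : 0 < sig (coSum x) l) :
    ∑ b, curvWeight k l x b * x b = ((k : ℝ) - l) * (sig (coSum x) k / sig (coSum x) l) := by
  rw [← sum_mul_dquot hx]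
  simp only [curvWeight]
  rw [← sum_coSum_mul]
  exact Finset.sum_congr rfl fun a _ => by rw [coSum, mul_comm]

theorem Gderiv_eq {k l : ℕ} (hk : k ≤ n) (hl : l ≤ n) {p : Fin n → ℝ}
    {r V : Matrix (Fin n) (Fin n) ℝ} {x : Fin n → ℝ} (hr : rᵀ = r) (hp : ∑ i, p i ^ 2 < 1)
    (hV : V * Vᵀ = invMetric p) (hx : (lorentzFactor p)⁻¹ • (Vᵀ * r * V) = diagonal x)
    (hsig : 0 < sig (coSum x) l) (a b : Fin n) :
    Gderiv k l r p a b
      = ∑ c, curvWeight k l x c * ((lorentzFactor p)⁻¹ * (V a c * V b c)) := by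
  set s : Matrix (Fin n) (Fin n) ℝ :=
    (1 / 2 : ℝ) • (Matrix.single a b (1 : ℝ) + Matrix.single b a (1 : ℝ)) with hs
  have hst : sᵀ = s := by simp [hs, add_comm]
  have h := hasDerivAt_G (k := k) hk hl (r := fun t => r + t • s) (p := fun _ => p) (p' := 0)
    (Filter.Eventually.of_forall fun t => by simp [hr, hst]) (EntryDeriv.line r s) hp
    (fun i => hasDerivAt_const _ _) hV (by simpa using hx) hsig
  rw [Gderiv, ← hs, h.deriv]
  refine Finset.sum_congr rfl fun c _ => ?_
  rw [frame_quadratic]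
  simp only [dotProduct_zero, mul_zero, zero_mul, mulVec_zero, Pi.zero_apply, zero_add]
  congr 2
  simp only [hs, Matrix.smul_apply, Matrix.add_apply, Matrix.single_apply, smul_eq_mul, mul_add,
    Finset.sum_add_distrib, mul_ite, mul_one, mul_zero]
  have e1 : ∑ i, ∑ j, (if a = i ∧ b = j then V i c * V j c * (1 / 2) else 0)
      = V a c * V b c * (1 / 2) := by
    simp [ite_and]
  have e2 : ∑ i, ∑ j, (if b = i ∧ a = j then V i c * V j c * (1 / 2) else 0)
      = V b c * V a c * (1 / 2) := by
    simp [ite_and]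
  rw [e1, e2]; ring

set_option maxHeartbeats 1600000 in
/-- Uniform ellipticity of `G^{ij}`, Euler's relation, and the structure of the derivatives of
`G`. -/
theorem exists_structure {θ : ℝ} (hθ : 0 < θ) (hθ1 : θ < 1) {k l : ℕ} (hk : k < n) (hl : l < k)
    {r : Matrix (Fin n) (Fin n) ℝ} {p : Fin n → ℝ} (hr : rᵀ = r) (hp : ∑ i, p i ^ 2 ≤ (1 - θ) ^ 2)
    (hcone : etaEigenvalues r p ∈ gardingCone k) :
    ∃ P : Fin n → ℝ,
      (∀ ξ : Fin n → ℝ, θ / (n * ellConst n) * (∑ a, Gderiv k l r p a a) * ∑ a, ξ a ^ 2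
        ≤ ∑ a, ∑ b, Gderiv k l r p a b * ξ a * ξ b) ∧
      (0 ≤ ∑ a, Gderiv k l r p a a) ∧
      (∀ a b, |Gderiv k l r p a b| ≤ ∑ a, Gderiv k l r p a a) ∧
      (∑ a, ∑ b, Gderiv k l r p a b * r a b = ((k : ℝ) - l) * G k l r p) ∧
      (∀ s, |P s| ≤ (n * θ⁻¹ + 2 * n ^ 2 * ellConst n * θ⁻¹ ^ 4) *
        (|G k l r p| + (∑ a, Gderiv k l r p a a) * ∑ a, ∑ b, |r a b|)) ∧
      ∀ (rr : ℝ → Matrix (Fin n) (Fin n) ℝ) (r' : Matrix (Fin n) (Fin n) ℝ)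
        (pp : ℝ → Fin n → ℝ) (p' : Fin n → ℝ), (∀ᶠ t in nhds (0 : ℝ), (rr t)ᵀ = rr t) →
        EntryDeriv rr r' → (∀ i, HasDerivAt (fun t => pp t i) (p' i) 0) → rr 0 = r → pp 0 = p →
        HasDerivAt (fun t => G k l (rr t) (pp t))
          (∑ a, ∑ b, Gderiv k l r p a b * r' a b + ∑ s, P s * p' s) 0 := by
  have hn : (1 : ℝ) ≤ n := by exact_mod_cast (by omega : 1 ≤ n)
  have hp1 : ∑ i, p i ^ 2 < 1 := by nlinarith
  obtain ⟨V, x, hV, hx⟩ := exists_frame hp1 hr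
  have hroots := etaEigenvalues_eq hp1 hV hx
  have hsig : ∀ j ≤ k, 0 < sig (coSum x) j := fun j hj => by
    rcases Nat.eq_zero_or_pos j with rfl | h0
    · rw [sig_zero]; exact one_pos
    · have := hcone j h0 hj
      rwa [hroots] at this
  have hA := Gderiv_eq (k := k) hk.le (hl.le.trans hk.le) hr hp1 hV hx (hsig l hl.le)
  have hGval : G k l r p = sig (coSum x) k / sig (coSum x) l := by rw [G, hroots]; rfl
  have hFb := curvWeight_bounds hk hl.le hsig
  have hD0 := dquot_nonneg hk hl.le hsig
  have heul := sum_curvWeight_mul (k := k) (hsig l hl.le)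
  rw [← hGval] at heul
  set Φ := ∑ a, dquot k l (coSum x) a with hΦ
  have hΦ0 : 0 ≤ Φ := Finset.sum_nonneg fun a _ => hD0 a
  have hK := ellConst_pos n
  generalize ellConst n = K at *
  generalize hF : curvWeight k l x = F at *
  have hF0 : ∀ b, 0 ≤ F b := fun b => nonneg_of_mul_nonneg_right (hΦ0.trans (hFb b).1) hK
  set w := lorentzFactor p with hw
  have hw0 : 0 < w := lorentzFactor_pos hp1
  have hw2 : w ^ 2 = 1 - ∑ i, p i ^ 2 := lorentzFactor_sq hp1
  set q := (1 - ∑ i, p i ^ 2)⁻¹ with hq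
  have hqw : q = (w ^ 2)⁻¹ := by rw [hw2]
  have hps : 0 ≤ ∑ i, p i ^ 2 := Finset.sum_nonneg fun i _ => sq_nonneg _
  have hw1 : w ≤ 1 := by nlinarith
  -- `w² ≥ 1 - (1-θ)² = 2θ - θ² ≥ θ`.
  have hθw : θ ≤ w ^ 2 := by nlinarith
  have hq0 : 0 < q := by rw [hqw]; positivity
  have hqθ : q ≤ θ⁻¹ := by rw [hqw]; exact inv_anti₀ hθ hθw
  have hwi1 : 1 ≤ w⁻¹ := (one_le_inv₀ hw0).2 hw1
  have hwiθ : w⁻¹ ≤ θ⁻¹ := inv_anti₀ hθ (by nlinarith)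
  have hθi1 : 1 ≤ θ⁻¹ := (one_le_inv₀ hθ).2 hθ1.le
  have hVV : ∀ a, ∑ b, V a b ^ 2 = 1 + q * p a ^ 2 := fun a => by
    have := congrFun (congrFun hV a) a
    simp only [mul_apply, transpose_apply, invMetric, Matrix.add_apply, one_apply_eq,
      Matrix.smul_apply, vecMulVec_apply, smul_eq_mul] at this
    simp only [sq]; rw [this, hq]
  have hpa : ∀ a, p a ^ 2 ≤ ∑ i, p i ^ 2 := fun a =>
    Finset.single_le_sum (f := fun i => p i ^ 2) (fun i _ => sq_nonneg _) (Finset.mem_univ a)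
  -- `1 + q|p|² = q`, because `q (1 - |p|²) = 1`.
  have hVVq : ∀ a, 1 + q * p a ^ 2 ≤ q := fun a => by
    have : q * (1 - ∑ i, p i ^ 2) = 1 := inv_mul_cancel₀ (by linarith)
    nlinarith [mul_le_mul_of_nonneg_left (hpa a) hq0.le]
  have hV2 : ∀ a b, V a b ^ 2 ≤ θ⁻¹ := fun a b => by
    refine le_trans ?_ ((hVVq a).trans hqθ)
    rw [← hVV a]
    exact Finset.single_le_sum (f := fun b => V a b ^ 2) (fun i _ => sq_nonneg _) (Finset.mem_univ b)
  have hVabs : ∀ a b, |V a b| ≤ θ⁻¹ := fun a b => by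
    apply abs_le_of_sq_le_sq _ (by linarith)
    exact (hV2 a b).trans (by nlinarith)
  have hVprod : ∀ a b c d, |V a b * V c d| ≤ θ⁻¹ := fun a b c d => by
    rw [abs_mul]
    nlinarith [sq_nonneg (|V a b| - |V c d|), hV2 a b, hV2 c d, sq_abs (V a b), sq_abs (V c d)]
  have hpabs : ∀ a, |p a| ≤ 1 := fun a => by
    apply abs_le_of_sq_le_sq _ zero_le_one
    have := hpa a; nlinarith
  -- the quadratic form of `G^{ij}`
  have hquad : ∀ ξ : Fin n → ℝ, ∑ a, ∑ b, Gderiv k l r p a b * ξ a * ξ b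
      = ∑ c, F c * (w⁻¹ * (∑ a, V a c * ξ a) ^ 2) := fun ξ => by
    simp only [hA, sq, Finset.sum_mul, Finset.mul_sum]
    rw [Finset.sum_congr rfl fun a _ => Finset.sum_comm, Finset.sum_comm]
    exact Finset.sum_congr rfl fun c _ => Finset.sum_congr rfl fun a _ =>
      Finset.sum_congr rfl fun b _ => by ring
  have hlin : ∀ M : Matrix (Fin n) (Fin n) ℝ, ∑ a, ∑ b, Gderiv k l r p a b * M a b
      = ∑ c, F c * (w⁻¹ * (Vᵀ * M * V) c c) := fun M => by
    simp only [hA, frame_quadratic, Finset.sum_mul, Finset.mul_sum]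
    rw [Finset.sum_congr rfl fun a _ => Finset.sum_comm, Finset.sum_comm]
    exact Finset.sum_congr rfl fun c _ => Finset.sum_congr rfl fun a _ =>
      Finset.sum_congr rfl fun b _ => by ring
  have hxb : ∀ b, w⁻¹ * (Vᵀ * r * V) b b = x b := fun b => by
    have := congrFun (congrFun hx b) b
    simpa using this
  have hdiag : ∀ a, Gderiv k l r p a a = ∑ c, F c * (w⁻¹ * V a c ^ 2) := fun a => by
    rw [hA]; simp only [sq]
  have hdiag0 : ∀ a, 0 ≤ Gderiv k l r p a a := fun a => by
    rw [hdiag]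
    exact Finset.sum_nonneg fun c _ => mul_nonneg (hF0 c) (by positivity)
  set T := ∑ a, Gderiv k l r p a a with hT
  have hT0 : 0 ≤ T := Finset.sum_nonneg fun a _ => hdiag0 a
  have hTle : T ≤ n * (Φ * w⁻¹ * θ⁻¹) := by
    have : ∀ a ∈ Finset.univ, Gderiv k l r p a a ≤ Φ * w⁻¹ * θ⁻¹ := fun a _ => by
      rw [hdiag]
      calc ∑ c, F c * (w⁻¹ * V a c ^ 2) ≤ ∑ c, Φ * (w⁻¹ * V a c ^ 2) :=
            Finset.sum_le_sum fun c _ => mul_le_mul_of_nonneg_right (hFb c).2 (by positivity)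
        _ = Φ * w⁻¹ * (1 + q * p a ^ 2) := by
            rw [← hVV a, Finset.mul_sum]; exact Finset.sum_congr rfl fun c _ => by ring
        _ ≤ _ := mul_le_mul_of_nonneg_left ((hVVq a).trans hqθ) (by positivity)
    simpa using Finset.sum_le_card_nsmul _ _ _ this
  -- A single diagonal coefficient suffices: every weight is at least `Φ/K`, and `w⁻¹ ∑_c V_ac² ≥
  -- 1`.
  have hTge : Φ ≤ K * T := by
    obtain ⟨a⟩ : Nonempty (Fin n) := ⟨⟨0, by omega⟩⟩
    have h1 : Φ ≤ K * Gderiv k l r p a a := by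
      rw [hdiag]
      have h2 : Φ * (w⁻¹ * ∑ c, V a c ^ 2) ≤ K * ∑ c, F c * (w⁻¹ * V a c ^ 2) := by
        rw [Finset.mul_sum, Finset.mul_sum, Finset.mul_sum]
        refine Finset.sum_le_sum fun c _ => ?_
        rw [← mul_assoc K]
        exact mul_le_mul_of_nonneg_right (hFb c).1 (by positivity)
      refine le_trans ?_ h2
      rw [hVV a]
      have : 1 ≤ w⁻¹ * (1 + q * p a ^ 2) := by
        have : 0 ≤ q * p a ^ 2 := by positivity
        nlinarith
      nlinarith
    exact h1.trans (mul_le_mul_of_nonneg_left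
      (Finset.single_le_sum (fun a _ => hdiag0 a) (Finset.mem_univ a)) hK.le)
  have hxabs : ∀ b, |x b| ≤ θ⁻¹ ^ 2 * ∑ a, ∑ b, |r a b| := fun b => by
    rw [← hxb b, frame_quadratic, abs_mul, abs_of_pos (by positivity : 0 < w⁻¹), sq, mul_assoc]
    refine mul_le_mul hwiθ ?_ (abs_nonneg _) (by linarith)
    rw [Finset.mul_sum]
    refine (Finset.abs_sum_le_sum_abs _ _).trans (Finset.sum_le_sum fun c _ => ?_)
    rw [Finset.mul_sum]
    refine (Finset.abs_sum_le_sum_abs _ _).trans (Finset.sum_le_sum fun d _ => ?_)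
    rw [abs_mul]
    exact mul_le_mul_of_nonneg_right (hVprod _ _ _ _) (abs_nonneg _)
  set R := ∑ a, ∑ b, |r a b| with hR
  have hR0 : 0 ≤ R := Finset.sum_nonneg fun a _ => Finset.sum_nonneg fun b _ => abs_nonneg _
  -- The chain rule with `r' = 0` gives `P_s`. By Euler's relation its first part sums to `(k-l) q
  -- p_s G`, free of second derivatives. The second part is bounded term by term, with `F_b ≤ K T`,
  -- one `θ⁻¹` from `V`, one from `Vᵀp` and two from `|κ_b|`.
  refine ⟨fun s => ∑ b, F b * (q * p s * x b + 2 * V s b * (Vᵀ *ᵥ p) b * x b), fun ξ => ?_, hT0,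
    fun a b => ?_, ?_, fun s => ?_, ?_⟩
  · rw [hquad]
    have h1 : Φ * w⁻¹ * ∑ a, ξ a ^ 2 ≤ K * ∑ c, F c * (w⁻¹ * (∑ a, V a c * ξ a) ^ 2) := by
      calc Φ * w⁻¹ * ∑ a, ξ a ^ 2 ≤ Φ * w⁻¹ * ∑ b, (∑ a, V a b * ξ a) ^ 2 := by
            apply mul_le_mul_of_nonneg_left _ (by positivity)
            rw [sum_frame_sq hV]
            have : 0 ≤ q * (∑ a, p a * ξ a) ^ 2 := by positivity
            linarith
        _ ≤ _ := by
            rw [Finset.mul_sum, Finset.mul_sum]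
            refine Finset.sum_le_sum fun c _ => ?_
            rw [← mul_assoc K, mul_assoc Φ]
            exact mul_le_mul_of_nonneg_right (hFb c).1 (by positivity)
    have hξ : 0 ≤ ∑ a, ξ a ^ 2 := Finset.sum_nonneg fun _ _ => sq_nonneg _
    have h2 : θ * T ≤ n * (Φ * w⁻¹) := by
      have := mul_le_mul_of_nonneg_left hTle hθ.le
      have e : θ * (n * (Φ * w⁻¹ * θ⁻¹)) = n * (Φ * w⁻¹) := by field_simp
      linarith
    rw [div_mul_eq_mul_div, div_mul_eq_mul_div, div_le_iff₀ (by positivity)]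
    calc θ * T * ∑ a, ξ a ^ 2 ≤ n * (Φ * w⁻¹) * ∑ a, ξ a ^ 2 := mul_le_mul_of_nonneg_right h2 hξ
      _ = n * (Φ * w⁻¹ * ∑ a, ξ a ^ 2) := by ring
      _ ≤ n * (K * ∑ c, F c * (w⁻¹ * (∑ a, V a c * ξ a) ^ 2)) :=
          mul_le_mul_of_nonneg_left h1 (by linarith)
      _ = _ := by ring
  · have h1 : |Gderiv k l r p a b| ≤ (Gderiv k l r p a a + Gderiv k l r p b b) / 2 := by
      rw [hdiag, hdiag, hA, ← Finset.sum_add_distrib, Finset.sum_div]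
      refine (Finset.abs_sum_le_sum_abs _ _).trans (Finset.sum_le_sum fun c _ => ?_)
      rw [abs_mul, abs_mul, abs_of_nonneg (hF0 c), abs_of_pos (by positivity : 0 < w⁻¹), abs_mul]
      have := mul_nonneg (mul_nonneg (hF0 c) (by positivity : 0 ≤ w⁻¹))
        (sq_nonneg (|V a c| - |V b c|))
      rw [← sq_abs (V a c), ← sq_abs (V b c)]
      nlinarith
    have h2 := Finset.single_le_sum (fun a _ => hdiag0 a) (Finset.mem_univ a)
    have h3 := Finset.single_le_sum (fun a _ => hdiag0 a) (Finset.mem_univ b)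
    linarith
  · rw [hlin, ← heul]
    exact Finset.sum_congr rfl fun c _ => by rw [hxb]
  · have e : ∑ b, F b * (q * p s * x b + 2 * V s b * (Vᵀ *ᵥ p) b * x b)
        = q * p s * (((k : ℝ) - l) * G k l r p)
          + ∑ b, F b * (2 * V s b * (Vᵀ *ᵥ p) b * x b) := by
      rw [← heul, Finset.mul_sum, ← Finset.sum_add_distrib]
      exact Finset.sum_congr rfl fun c _ => by ring
    beta_reduce
    rw [e]
    have h1 : |q * p s * (((k : ℝ) - l) * G k l r p)| ≤ n * θ⁻¹ * |G k l r p| := by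
      rw [abs_mul, abs_mul, abs_mul, abs_of_pos hq0]
      have hkl : |(k : ℝ) - l| ≤ n := by
        have a1 : (l : ℝ) < k := by exact_mod_cast hl
        have a2 : (k : ℝ) < n := by exact_mod_cast hk
        have a3 : (0 : ℝ) ≤ l := Nat.cast_nonneg _
        rw [abs_of_pos (by linarith)]; linarith
      have : q * |p s| ≤ θ⁻¹ * 1 := mul_le_mul hqθ (hpabs s) (abs_nonneg _) (by linarith)
      calc q * |p s| * (|(k : ℝ) - l| * |G k l r p|) ≤ (θ⁻¹ * 1) * (n * |G k l r p|) := by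
            apply mul_le_mul this _ (by positivity) (by linarith)
            exact mul_le_mul_of_nonneg_right hkl (abs_nonneg _)
        _ = _ := by ring
    have h2 : ∀ b ∈ Finset.univ, |F b * (2 * V s b * (Vᵀ *ᵥ p) b * x b)|
        ≤ 2 * n * K * θ⁻¹ ^ 4 * (T * R) := fun b _ => by
      have a1 : |(Vᵀ *ᵥ p) b| ≤ n * θ⁻¹ := by
        have : ∀ a ∈ Finset.univ, |Vᵀ b a * p a| ≤ θ⁻¹ := fun a _ => by
          rw [abs_mul, transpose_apply]
          calc |V a b| * |p a| ≤ θ⁻¹ * 1 := mul_le_mul (hVabs a b) (hpabs a) (abs_nonneg _) (by linarith)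
            _ = θ⁻¹ := mul_one _
        have h := (Finset.abs_sum_le_sum_abs _ _).trans (Finset.sum_le_card_nsmul _ _ _ this)
        simpa [mulVec, dotProduct] using h
      rw [abs_mul, abs_mul, abs_mul, abs_mul, abs_of_nonneg (hF0 b), abs_two]
      calc F b * (2 * |V s b| * |(Vᵀ *ᵥ p) b| * |x b|)
          ≤ (K * T) * (2 * θ⁻¹ * (n * θ⁻¹) * (θ⁻¹ ^ 2 * R)) := by
            have := hVabs s b
            have := hxabs b
            have := (hFb b).2.trans hTge
            gcongr
        _ = _ := by ring
    have h3 := (Finset.abs_sum_le_sum_abs _ _).trans (Finset.sum_le_card_nsmul _ _ _ h2)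
    simp only [Finset.card_univ, Fintype.card_fin, nsmul_eq_mul] at h3
    refine (abs_add_le _ _).trans ?_
    have h4 : 0 ≤ n * θ⁻¹ * (T * R) := by positivity
    have h5 : 0 ≤ 2 * n ^ 2 * K * θ⁻¹ ^ 4 * |G k l r p| := by positivity
    nlinarith
  · intro rr r' pp p' hsym hrr hpp h0 h0'
    subst h0 h0'
    have h := hasDerivAt_G hk.le (hl.le.trans hk.le) hsym hrr hp1 hpp hV hx (hsig l hl.le)
    refine h.congr_deriv ?_
    rw [hlin, hF]
    simp only [Finset.sum_mul]
    rw [Finset.sum_comm (γ := Fin n), ← Finset.sum_add_distrib]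
    refine Finset.sum_congr rfl fun c _ => ?_
    have e : (Vᵀ *ᵥ p') c = ∑ s, V s c * p' s := rfl
    rw [e, ← hw, ← hq]
    generalize (Vᵀ *ᵥ pp 0) c = y
    have e2 : ∑ s, F c * (q * pp 0 s * x c + 2 * V s c * y * x c) * p' s
        = F c * q * x c * (pp 0 ⬝ᵥ p') + F c * 2 * y * x c * ∑ s, V s c * p' s := by
      rw [dotProduct, Finset.mul_sum, Finset.mul_sum, ← Finset.sum_add_distrib]
      exact Finset.sum_congr rfl fun s _ => by ring
    rw [e2]; ring

end MinkowskiQuotient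

/-! ### Boundary graphs and local defining functions -/

namespace MinkowskiQuotient
open Filter Topology Metric

variable {m : ℕ}

/-- The last basis vector. -/
noncomputable abbrev eLast (m : ℕ) : E (m + 1) := EuclideanSpace.single (Fin.last m) 1

/-- `horiz` as a continuous linear map. -/
noncomputable def horizL (m : ℕ) : E (m + 1) →L[ℝ] E m :=
  LinearMap.toContinuousLinearMap
    { toFun := horiz
      map_add' := fun x y => by ext a; simp [horiz]
      map_smul' := fun c x => by ext a; simp [horiz] }

@[simp] theorem horizL_apply (y : E (m + 1)) : horizL m y = horiz y := rfl

/-- The inclusion `y' ↦ (y', 0)`. -/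
noncomputable def emb (m : ℕ) : E m →L[ℝ] E (m + 1) :=
  LinearMap.toContinuousLinearMap
    { toFun := fun z => WithLp.toLp 2 (Fin.snoc (α := fun _ => ℝ) z 0)
      map_add' := fun x y => by
        ext a; refine Fin.lastCases ?_ (fun i => ?_) a <;> simp
      map_smul' := fun c x => by
        ext a; refine Fin.lastCases ?_ (fun i => ?_) a <;> simp }

@[simp] theorem emb_castSucc (z : E m) (a : Fin m) : emb m z a.castSucc = z a := by
  simp [emb]

@[simp] theorem emb_last (z : E m) : emb m z (Fin.last m) = 0 := by
  simp [emb]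

@[simp] theorem horiz_emb_add (z : E m) (t : ℝ) : horiz (emb m z + t • eLast m) = z := by
  ext a; simp [horiz]

@[simp] theorem emb_add_last (z : E m) (t : ℝ) : (emb m z + t • eLast m) (Fin.last m) = t := by
  simp

theorem emb_horiz_add (y : E (m + 1)) : emb m (horiz y) + y (Fin.last m) • eLast m = y := by
  ext a; refine Fin.lastCases ?_ (fun i => ?_) a <;> simp [horiz]

theorem emb_single (a : Fin m) : emb m (EuclideanSpace.single a 1)
    = EuclideanSpace.single a.castSucc 1 := by
  ext b; refine Fin.lastCases ?_ (fun i => ?_) b <;> simp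

theorem norm_emb (z : E m) : ‖emb m z‖ = ‖z‖ := by
  simp [EuclideanSpace.norm_eq, Fin.sum_univ_castSucc]

theorem norm_eLast : ‖eLast m‖ = 1 := by simp

theorem abs_coord_le {n : ℕ} (y : E n) (i : Fin n) : |y i| ≤ ‖y‖ := by
  simpa using PiLp.norm_apply_le y i

/-- The point of the graph of `ρ` above `z`, in the original coordinates. -/
noncomputable def graphPt (x₁ : E (m + 1)) (R : E (m + 1) ≃ₗᵢ[ℝ] E (m + 1)) (ρ : E m → ℝ) (z : E m) :
    E (m + 1) := x₁ + R (emb m z + ρ z • eLast m)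

/-- A domain with smooth boundary has local defining functions. -/
theorem IsBoundaryGraph.exists_defining {Ω : Set (E (m + 1))} {x₀ : E (m + 1)}
    {R : E (m + 1) ≃ₗᵢ[ℝ] E (m + 1)} {s : ℝ} {ρ : E m → ℝ} (h : IsBoundaryGraph Ω x₀ R s ρ) :
    ∃ (Φ : E (m + 1) → ℝ) (U : Set (E (m + 1))) (v : E (m + 1)), IsOpen U ∧ x₀ ∈ U ∧
      ContDiffOn ℝ ∞ Φ U ∧ (∀ x ∈ U, x ∈ Ω ↔ 0 < Φ x) ∧ ‖v‖ = 1 ∧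
      ∀ x ∈ U, fderiv ℝ Φ x v = 1 := by
  set U : Set (E (m + 1)) := {x | horiz (R.symm (x - x₀)) ∈ ball (0 : E m) s ∧
    |R.symm (x - x₀) (Fin.last m)| < s} with hUdef
  have hc1 : ContDiff ℝ ∞ fun x : E (m + 1) => horizL m (R.symm (x - x₀)) :=
    (horizL m).contDiff.comp (R.symm.contDiff.comp (contDiff_id.sub contDiff_const))
  have hc2 : ContDiff ℝ ∞ fun x : E (m + 1) => R.symm (x - x₀) (Fin.last m) :=
    (EuclideanSpace.proj (Fin.last m) : E (m + 1) →L[ℝ] ℝ).contDiff.comp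
      (R.symm.contDiff.comp (contDiff_id.sub contDiff_const))
  have hUo : IsOpen U :=
    (isOpen_ball.preimage hc1.continuous).inter (isOpen_lt hc2.continuous.abs continuous_const)
  have hΦ : ContDiffOn ℝ ∞ (fun x => R.symm (x - x₀) (Fin.last m) - ρ (horiz (R.symm (x - x₀)))) U :=
    hc2.contDiffOn.sub (h.smooth.comp hc1.contDiffOn fun x hx => hx.1)
  refine ⟨fun x => R.symm (x - x₀) (Fin.last m) - ρ (horiz (R.symm (x - x₀))), U, R (eLast m), hUo,
    ?_, hΦ, ?_, ?_, ?_⟩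
  · have h0 : horiz (0 : E (m + 1)) = 0 := (horizL m).map_zero
    simp [hUdef, h0, h.radius_pos]
  · intro x hx
    have := h.mem_iff (R.symm (x - x₀)) hx.1 hx.2
    rw [R.apply_symm_apply, add_sub_cancel] at this
    rw [this, sub_pos]
  · rw [R.norm_map, norm_eLast]
  · intro x hx
    have hd := ((hΦ.contDiffAt (hUo.mem_nhds hx)).differentiableAt (by simp)).hasFDerivAt
    have hl : HasDerivAt (fun t : ℝ => x + t • R (eLast m)) (R (eLast m)) 0 := by
      simpa using ((hasDerivAt_id (0 : ℝ)).smul_const (R (eLast m))).const_add x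
    have h1 := HasFDerivAt.comp_hasDerivAt (0 : ℝ) (f := fun t : ℝ => x + t • R (eLast m))
      (by rw [zero_smul, add_zero]; exact hd) hl
    refine h1.unique ?_
    have e : ((fun x => R.symm (x - x₀) (Fin.last m) - ρ (horiz (R.symm (x - x₀)))) ∘
        fun t : ℝ => x + t • R (eLast m)) = fun t : ℝ =>
        (R.symm (x - x₀) (Fin.last m) - ρ (horiz (R.symm (x - x₀)))) + t := by
      ext t
      have e1 : R.symm (x + t • R (eLast m) - x₀) = R.symm (x - x₀) + t • eLast m := by
        rw [show x + t • R (eLast m) - x₀ = (x - x₀) + t • R (eLast m) by abel, map_add, map_smul,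
          R.symm_apply_apply]
      have e2 : horiz (R.symm (x - x₀) + t • eLast m) = horiz (R.symm (x - x₀)) := by
        ext a; simp [horiz]
      simp only [Function.comp_apply, e1, e2]
      simp
      ring
    rw [e]
    simpa using (hasDerivAt_id (0 : ℝ)).const_add _

section Local

variable {Ω U : Set (E (m + 1))} {Φ : E (m + 1) → ℝ} {x₁ : E (m + 1)}
  {R : E (m + 1) ≃ₗᵢ[ℝ] E (m + 1)} {s : ℝ} {ρ : E m → ℝ}

/-- A graph point is not in `Ω`, so `Φ ≤ 0` there; points slightly above it are in `Ω`, so `Φ ≥ 0`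
in the limit. The function `Φ` may come from a different chart than `ρ`, which is what allows
comparison of all charts with one `Φ`. -/
theorem IsBoundaryGraph.defining_eq_zero (h : IsBoundaryGraph Ω x₁ R s ρ) (hU : IsOpen U)
    (hΦ : ContinuousOn Φ U) (hmem : ∀ x ∈ U, x ∈ Ω ↔ 0 < Φ x) {z : E m} (hz : ‖z‖ < s)
    (hq : graphPt x₁ R ρ z ∈ U) : Φ (graphPt x₁ R ρ z) = 0 := by
  have hz' : z ∈ ball (0 : E m) s := by simpa using hz
  have hρ := h.abs_lt z hz'
  apply le_antisymm
  · rw [← not_lt, ← hmem _ hq, graphPt, h.mem_iff _ (by simpa using hz') (by simpa using hρ)]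
    simp
  · have hcont : ContinuousAt (fun t : ℝ => graphPt x₁ R ρ z + t • R (eLast m)) 0 := by fun_prop
    have h0 : graphPt x₁ R ρ z + (0 : ℝ) • R (eLast m) = graphPt x₁ R ρ z := by simp
    have hev : ∀ᶠ t in 𝓝 (0 : ℝ), graphPt x₁ R ρ z + t • R (eLast m) ∈ U :=
      hcont.eventually_mem (by rw [h0]; exact hU.mem_nhds hq)
    have hev2 : ∀ᶠ t in 𝓝 (0 : ℝ), |ρ z + t| < s := by
      have : ContinuousAt (fun t : ℝ => |ρ z + t|) 0 := by fun_prop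
      exact this.eventually_lt continuousAt_const (by simpa using hρ)
    have hlim : Tendsto (fun t : ℝ => Φ (graphPt x₁ R ρ z + t • R (eLast m))) (𝓝[>] 0)
        (𝓝 (Φ (graphPt x₁ R ρ z))) := by
      have h1 : ContinuousAt Φ (graphPt x₁ R ρ z + (0 : ℝ) • R (eLast m)) := by
        rw [h0]; exact hΦ.continuousAt (hU.mem_nhds hq)
      have h2 := (ContinuousAt.comp (f := fun t : ℝ => graphPt x₁ R ρ z + t • R (eLast m))
        h1 hcont).tendsto
      simp only [Function.comp_apply, h0] at h2
      exact h2.mono_left nhdsWithin_le_nhds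
    refine ge_of_tendsto hlim ?_
    filter_upwards [nhdsWithin_le_nhds hev, nhdsWithin_le_nhds hev2, self_mem_nhdsWithin]
      with t h1 h2 h3
    have e : graphPt x₁ R ρ z + t • R (eLast m) = x₁ + R (emb m z + (ρ z + t) • eLast m) := by
      rw [graphPt, add_assoc, ← map_smul, ← map_add, add_smul, add_assoc]
    rw [e] at h1 ⊢
    refine ((hmem _ h1).1 ?_).le
    rw [h.mem_iff _ (by simpa using hz') (by simpa using h2)]
    simpa using h3

theorem IsBoundaryGraph.hasFDerivAt_graphPt (h : IsBoundaryGraph Ω x₁ R s ρ) {z : E m}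
    (hz : ‖z‖ < s) : HasFDerivAt (graphPt x₁ R ρ)
      ((R : E (m + 1) →L[ℝ] E (m + 1)).comp (emb m + (fderiv ℝ ρ z).smulRight (eLast m))) z := by
  have hz' : z ∈ ball (0 : E m) s := by simpa using hz
  have hd := ((h.smooth.contDiffAt (isOpen_ball.mem_nhds hz')).differentiableAt (by simp)).hasFDerivAt
  have h1 := (emb m).hasFDerivAt (x := z) |>.add (hd.smul_const (eLast m))
  exact ((R : E (m + 1) →L[ℝ] E (m + 1)).hasFDerivAt.comp z h1).const_add x₁

theorem IsBoundaryGraph.eventually_eq_zero (h : IsBoundaryGraph Ω x₁ R s ρ) (hU : IsOpen U)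
    (hΦ : ContinuousOn Φ U) (hmem : ∀ x ∈ U, x ∈ Ω ↔ 0 < Φ x) {z : E m} (hz : ‖z‖ < s)
    (hq : graphPt x₁ R ρ z ∈ U) : ∀ᶠ z in 𝓝 z, Φ (graphPt x₁ R ρ z) = 0 := by
  have h1 := (h.hasFDerivAt_graphPt hz).continuousAt.eventually_mem (hU.mem_nhds hq)
  have h2 : ∀ᶠ z in 𝓝 z, ‖z‖ < s := continuous_norm.continuousAt.eventually_lt continuousAt_const hz
  filter_upwards [h1, h2] with z' a b
  exact h.defining_eq_zero hU hΦ hmem b a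

theorem IsBoundaryGraph.fderiv_graph (h : IsBoundaryGraph Ω x₁ R s ρ) (hU : IsOpen U)
    (hΦ : ContDiffOn ℝ ∞ Φ U) (hmem : ∀ x ∈ U, x ∈ Ω ↔ 0 < Φ x) {z : E m} (hz : ‖z‖ < s)
    (hq : graphPt x₁ R ρ z ∈ U) (v : E m) : fderiv ℝ Φ (graphPt x₁ R ρ z) (R (emb m v))
      + fderiv ℝ ρ z v * fderiv ℝ Φ (graphPt x₁ R ρ z) (R (eLast m)) = 0 := by
  have hd := ((hΦ.contDiffAt (hU.mem_nhds hq)).differentiableAt (by simp)).hasFDerivAt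
  have h1 := hd.comp z (h.hasFDerivAt_graphPt hz)
  have h2 : HasFDerivAt (Φ ∘ graphPt x₁ R ρ) (0 : E m →L[ℝ] ℝ) z :=
    (hasFDerivAt_const (0 : ℝ) z).congr_of_eventuallyEq
      (h.eventually_eq_zero hU hΦ.continuousOn hmem hz hq)
  have := DFunLike.congr_fun (h1.unique h2) v
  simpa using this

theorem IsBoundaryGraph.graphPt_zero (h : IsBoundaryGraph Ω x₁ R s ρ) : graphPt x₁ R ρ 0 = x₁ := by
  simp [graphPt, h.map_zero]

theorem IsBoundaryGraph.fderiv_tangent (h : IsBoundaryGraph Ω x₁ R s ρ) (hU : IsOpen U)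
    (hΦ : ContDiffOn ℝ ∞ Φ U) (hmem : ∀ x ∈ U, x ∈ Ω ↔ 0 < Φ x) (hx₁ : x₁ ∈ U) (v : E m) :
    fderiv ℝ Φ x₁ (R (emb m v)) = 0 := by
  have := h.fderiv_graph hU hΦ hmem (z := 0) (by simpa using h.radius_pos)
    (by rwa [h.graphPt_zero]) v
  simpa [h.graphPt_zero, h.fderiv_zero] using this

theorem IsBoundaryGraph.defining_center (h : IsBoundaryGraph Ω x₁ R s ρ) (hU : IsOpen U)
    (hΦ : ContDiffOn ℝ ∞ Φ U) (hmem : ∀ x ∈ U, x ∈ Ω ↔ 0 < Φ x) (hx₁ : x₁ ∈ U) : Φ x₁ = 0 := by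
  have := h.defining_eq_zero hU hΦ.continuousOn hmem (z := 0) (by simpa using h.radius_pos)
    (by rwa [h.graphPt_zero])
  rwa [h.graphPt_zero] at this

/-- `Φ` vanishes at `x₁` and is positive just above, so its normal derivative is nonnegative. As
`DΦ` kills tangent vectors, `1 = DΦ(v)` is this derivative times the normal component of `v`, which
is at most `1`. -/
theorem IsBoundaryGraph.one_le_fderiv_normal (h : IsBoundaryGraph Ω x₁ R s ρ) (hU : IsOpen U)
    (hΦ : ContDiffOn ℝ ∞ Φ U) (hmem : ∀ x ∈ U, x ∈ Ω ↔ 0 < Φ x) (hx₁ : x₁ ∈ U) {v : E (m + 1)}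
    (hv : ‖v‖ = 1) (hΦv : fderiv ℝ Φ x₁ v = 1) : 1 ≤ fderiv ℝ Φ x₁ (R (eLast m)) := by
  have hd := ((hΦ.contDiffAt (hU.mem_nhds hx₁)).differentiableAt (by simp)).hasFDerivAt
  have hl : HasDerivAt (fun t : ℝ => x₁ + t • R (eLast m)) (R (eLast m)) 0 := by
    simpa using ((hasDerivAt_id (0 : ℝ)).smul_const (R (eLast m))).const_add x₁
  have h1 := HasFDerivAt.comp_hasDerivAt (0 : ℝ) (f := fun t : ℝ => x₁ + t • R (eLast m))
      (by simpa using hd) hl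
  have hnn : 0 ≤ fderiv ℝ Φ x₁ (R (eLast m)) := by
    refine ge_of_tendsto h1.tendsto_slope_zero_right ?_
    have hev : ∀ᶠ t in 𝓝 (0 : ℝ), x₁ + t • R (eLast m) ∈ U :=
      hl.continuousAt.eventually_mem (by simpa using hU.mem_nhds hx₁)
    have hev2 : ∀ᶠ t in 𝓝 (0 : ℝ), |t| < s :=
      continuous_abs.continuousAt.eventually_lt continuousAt_const (by simpa using h.radius_pos)
    filter_upwards [nhdsWithin_le_nhds hev, nhdsWithin_le_nhds hev2, self_mem_nhdsWithin]
      with t a1 a2 a3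
    have a3 : 0 < t := a3
    simp only [Function.comp_apply, zero_add, zero_smul, add_zero,
      h.defining_center hU hΦ hmem hx₁, sub_zero, smul_eq_mul]
    refine mul_nonneg (by positivity) ((hmem _ a1).1 ?_).le
    have := h.mem_iff (emb m 0 + t • eLast m) 
      (by rw [horiz_emb_add]; simp [h.radius_pos]) (by simpa using a2)
    rw [horiz_emb_add, emb_add_last, h.map_zero, (emb m).map_zero, zero_add, map_smul] at this
    exact this.2 a3
  have hdec : v = R (emb m (horiz (R.symm v))) + R.symm v (Fin.last m) • R (eLast m) := by
    rw [← map_smul, ← map_add, emb_horiz_add, R.apply_symm_apply]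
  rw [hdec, map_add, h.fderiv_tangent hU hΦ hmem hx₁, zero_add, map_smul, smul_eq_mul] at hΦv
  have hc : |R.symm v (Fin.last m)| ≤ 1 := by
    refine (abs_coord_le _ _).trans ?_
    rw [R.symm.norm_map, hv]
  have := (abs_le.1 hc).2
  nlinarith

end Local

end MinkowskiQuotient

/-! ### Uniform bounds for the derivatives of boundary graphs -/

namespace MinkowskiQuotient
open Filter Topology Metric

variable {m : ℕ}

/-- The slope `-Φ_a/Φ_n` of the level set of `Φ` in the frame `P`. -/
noncomputable def slopeFn (Φ : E (m + 1) → ℝ) (a : Fin m)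
    (z : E (m + 1) × (E (m + 1) →L[ℝ] E (m + 1))) : ℝ :=
  -(fderiv ℝ Φ z.1 (z.2 (EuclideanSpace.single a.castSucc 1))) / fderiv ℝ Φ z.1 (z.2 (eLast m))

/-- The derivative along the level set of `Φ` in the frame `P`, in the direction `b`. -/
noncomputable def slopeDeriv (Φ : E (m + 1) → ℝ) (b : Fin m)
    (K : E (m + 1) × (E (m + 1) →L[ℝ] E (m + 1)) → ℝ)
    (z : E (m + 1) × (E (m + 1) →L[ℝ] E (m + 1))) : ℝ :=
  fderiv ℝ K z (z.2 (EuclideanSpace.single b.castSucc 1) + slopeFn Φ b z • z.2 (eLast m), 0)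

/-- The frames for which the level set of `Φ` is a graph. -/
def graphDomain (Φ : E (m + 1) → ℝ) (U : Set (E (m + 1))) :
    Set (E (m + 1) × (E (m + 1) →L[ℝ] E (m + 1))) :=
  {z | z.1 ∈ U ∧ fderiv ℝ Φ z.1 (z.2 (eLast m)) ≠ 0}

section Local

variable {Ω U : Set (E (m + 1))} {Φ : E (m + 1) → ℝ} {x₁ : E (m + 1)}
  {R : E (m + 1) ≃ₗᵢ[ℝ] E (m + 1)} {s : ℝ} {ρ : E m → ℝ}

theorem contDiffOn_fderiv_apply (hU : IsOpen U) (hΦ : ContDiffOn ℝ ∞ Φ U) (e : E (m + 1)) :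
    ContDiffOn ℝ ∞ (fun z : E (m + 1) × (E (m + 1) →L[ℝ] E (m + 1)) => fderiv ℝ Φ z.1 (z.2 e))
      (U ×ˢ Set.univ) := by
  have h1 : ContDiffOn ℝ ∞ (fun z : E (m + 1) × (E (m + 1) →L[ℝ] E (m + 1)) => fderiv ℝ Φ z.1)
      (U ×ˢ Set.univ) :=
    (hΦ.fderiv_of_isOpen hU (by simp)).comp contDiff_fst.contDiffOn fun z hz => hz.1
  exact h1.clm_apply (contDiff_snd.contDiffOn.clm_apply contDiffOn_const)

theorem isOpen_graphDomain (hU : IsOpen U) (hΦ : ContDiffOn ℝ ∞ Φ U) :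
    IsOpen (graphDomain Φ U) := by
  have := (contDiffOn_fderiv_apply hU hΦ (eLast m)).continuousOn.isOpen_inter_preimage
    (hU.prod isOpen_univ) (isOpen_ne (x := (0 : ℝ)))
  have e : graphDomain Φ U = U ×ˢ Set.univ ∩ (fun z : E (m + 1) × (E (m + 1) →L[ℝ] E (m + 1)) =>
      fderiv ℝ Φ z.1 (z.2 (eLast m))) ⁻¹' {y | y ≠ 0} := by
    ext z; simp [graphDomain]
  rw [e]; exact this

theorem contDiffOn_slopeFn (hU : IsOpen U) (hΦ : ContDiffOn ℝ ∞ Φ U) (a : Fin m) :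
    ContDiffOn ℝ ∞ (slopeFn Φ a) (graphDomain Φ U) := by
  have hsub : graphDomain Φ U ⊆ U ×ˢ Set.univ := fun z hz => ⟨hz.1, trivial⟩
  exact ((contDiffOn_fderiv_apply hU hΦ _).mono hsub).neg.div
    ((contDiffOn_fderiv_apply hU hΦ _).mono hsub) fun z hz => hz.2

theorem contDiffOn_slopeDeriv (hU : IsOpen U) (hΦ : ContDiffOn ℝ ∞ Φ U) (b : Fin m)
    {K : E (m + 1) × (E (m + 1) →L[ℝ] E (m + 1)) → ℝ} (hK : ContDiffOn ℝ ∞ K (graphDomain Φ U)) :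
    ContDiffOn ℝ ∞ (slopeDeriv Φ b K) (graphDomain Φ U) := by
  refine (hK.fderiv_of_isOpen (isOpen_graphDomain hU hΦ) (by simp)).clm_apply ?_
  refine ContDiffOn.prodMk ?_ contDiffOn_const
  exact (contDiff_snd.contDiffOn.clm_apply contDiffOn_const).add
    ((contDiffOn_slopeFn hU hΦ b).smul (contDiff_snd.contDiffOn.clm_apply contDiffOn_const))

theorem IsBoundaryGraph.pd_eq_slopeFn (h : IsBoundaryGraph Ω x₁ R s ρ) (hU : IsOpen U)
    (hΦ : ContDiffOn ℝ ∞ Φ U) (hmem : ∀ x ∈ U, x ∈ Ω ↔ 0 < Φ x) {z : E m} (hz : ‖z‖ < s)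
    (hq : (graphPt x₁ R ρ z, (R : E (m + 1) →L[ℝ] E (m + 1))) ∈ graphDomain Φ U) (a : Fin m) :
    pd a ρ z = slopeFn Φ a (graphPt x₁ R ρ z, (R : E (m + 1) →L[ℝ] E (m + 1))) := by
  have := h.fderiv_graph hU hΦ hmem hz hq.1 (EuclideanSpace.single a 1)
  rw [emb_single] at this
  have h0 := hq.2
  rw [slopeFn, eq_div_iff h0]
  simp only [pd]
  exact eq_neg_of_add_eq_zero_right this

/-- The graph point moves with velocity `R(e_b + ρ_b e_n)`, and `ρ_b` is itself a slope function.
Iteration expresses every derivative of `ρ` as a fixed smooth function of the point and the frame.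
-/
theorem IsBoundaryGraph.pd_eq_slopeDeriv (h : IsBoundaryGraph Ω x₁ R s ρ) (hU : IsOpen U)
    (hΦ : ContDiffOn ℝ ∞ Φ U) (hmem : ∀ x ∈ U, x ∈ Ω ↔ 0 < Φ x) {z : E m} (hz : ‖z‖ < s)
    (hq : (graphPt x₁ R ρ z, (R : E (m + 1) →L[ℝ] E (m + 1))) ∈ graphDomain Φ U)
    {K : E (m + 1) × (E (m + 1) →L[ℝ] E (m + 1)) → ℝ} (hK : ContDiffOn ℝ ∞ K (graphDomain Φ U))
    {f : E m → ℝ} (hf : ∀ᶠ z in 𝓝 z, f z = K (graphPt x₁ R ρ z, (R : E (m + 1) →L[ℝ] E (m + 1))))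
    (b : Fin m) :
    pd b f z = slopeDeriv Φ b K (graphPt x₁ R ρ z, (R : E (m + 1) →L[ℝ] E (m + 1))) := by
  have hd := ((hK.contDiffAt ((isOpen_graphDomain hU hΦ).mem_nhds hq)).differentiableAt
    (by simp)).hasFDerivAt
  have hg := (h.hasFDerivAt_graphPt hz).prodMk
    (hasFDerivAt_const (R : E (m + 1) →L[ℝ] E (m + 1)) z)
  have h1 := HasFDerivAt.comp z hd hg
  have h2 := h1.congr_of_eventuallyEq hf
  rw [pd, h2.fderiv, slopeDeriv, ← h.pd_eq_slopeFn hU hΦ hmem hz hq b]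
  simp [emb_single, pd]

end Local

/-- The first three orders of derivatives of `ρ` at `z` are bounded by `K`. -/
def DerivBounds (ρ : E m → ℝ) (K : ℝ) (z : E m) : Prop :=
  (∀ a, |pd a ρ z| ≤ K) ∧ (∀ a b, |pd b (pd a ρ) z| ≤ K) ∧
    ∀ a b c, |pd c (pd b (pd a ρ)) z| ≤ K

/-- One `Φ` near `x₀` serves all charts centred nearby. The pairs (graph point, `R`) stay in a
compact set on which the normal derivative of `Φ` is at least `1/2`, so the slope functions are
bounded there independently of the chart. -/
theorem exists_local_bounds {Ω : Set (E (m + 1))} (hΩ : HasSmoothBoundary Ω) {x₀ : E (m + 1)}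
    (hx₀ : x₀ ∈ frontier Ω) : ∃ ε > 0, ∃ δ₀ > 0, ∃ K, ∀ x₁ ∈ ball x₀ ε,
      ∀ (R : E (m + 1) ≃ₗᵢ[ℝ] E (m + 1)) (s : ℝ) (ρ : E m → ℝ), IsBoundaryGraph Ω x₁ R s ρ →
      ∀ z : E m, ‖z‖ < δ₀ → ‖z‖ < s → DerivBounds ρ K z := by
  obtain ⟨R₀, s₀, ρ₀, h₀⟩ := hΩ x₀ hx₀
  obtain ⟨Φ, U, v, hU, hx₀U, hΦ, hmem, hv, hΦv⟩ := h₀.exists_defining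
  have hcf : ContinuousAt (fderiv ℝ Φ) x₀ :=
    (hΦ.continuousOn_fderiv_of_isOpen hU (by simp)).continuousAt (hU.mem_nhds hx₀U)
  have hev : ∀ᶠ x in 𝓝 x₀, x ∈ U ∧ dist (fderiv ℝ Φ x) (fderiv ℝ Φ x₀) ≤ 1 / 4 :=
    (hU.eventually_mem hx₀U).and (hcf.eventually (closedBall_mem_nhds _ (by norm_num)))
  obtain ⟨r, hr, hrU⟩ := nhds_basis_closedBall.eventually_iff.1 hev
  -- Halving leaves room: the ball of radius `r₀` about any centre within `r₀` of `x₀` stays where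
  -- `DΦ` varies by at most `1/4` from its value at `x₀`.
  set r₀ := r / 2 with hr₀
  have hr₀pos : 0 < r₀ := by positivity
  set C : Set (E (m + 1) × (E (m + 1) →L[ℝ] E (m + 1))) := closedBall x₀ r ×ˢ closedBall 0 1
  have hCc : IsCompact C :=
    haveI : ProperSpace (E (m + 1) →L[ℝ] E (m + 1)) := FiniteDimensional.proper ℝ _
    (isCompact_closedBall x₀ r).prod (isCompact_closedBall _ _)
  have hCcont : ContinuousOn (fun z : E (m + 1) × (E (m + 1) →L[ℝ] E (m + 1)) =>
      fderiv ℝ Φ z.1 (z.2 (eLast m))) C :=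
    (contDiffOn_fderiv_apply hU hΦ (eLast m)).continuousOn.mono
      fun z hz => ⟨(hrU hz.1).1, trivial⟩
  set Q := C ∩ (fun z : E (m + 1) × (E (m + 1) →L[ℝ] E (m + 1)) =>
      fderiv ℝ Φ z.1 (z.2 (eLast m))) ⁻¹' Set.Ici (1 / 2) with hQ
  have hQc : IsCompact Q :=
    hCc.of_isClosed_subset (hCcont.preimage_isClosed_of_isClosed hCc.isClosed isClosed_Ici)
      Set.inter_subset_left
  have hQdom : Q ⊆ graphDomain Φ U := fun z hz =>
    ⟨(hrU hz.1.1).1, by have : (1 / 2 : ℝ) ≤ fderiv ℝ Φ z.1 (z.2 (eLast m)) := hz.2; linarith⟩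
  have hS1 := fun a => contDiffOn_slopeFn hU hΦ a
  have hS2 := fun a b => contDiffOn_slopeDeriv hU hΦ b (hS1 a)
  have hS3 := fun a b c => contDiffOn_slopeDeriv hU hΦ c (hS2 a b)
  have hbd : ∀ {ι : Type} [Fintype ι] (f : ι → E (m + 1) × (E (m + 1) →L[ℝ] E (m + 1)) → ℝ),
      (∀ i, ContDiffOn ℝ ∞ (f i) (graphDomain Φ U)) → ∃ K, ∀ i, ∀ z ∈ Q, |f i z| ≤ K := by
    intro ι _ f hf
    obtain ⟨K, hK⟩ := hQc.exists_bound_of_continuousOn (f := fun z => ∑ i, |f i z|)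
      (continuousOn_finsetSum _ fun i _ => ((hf i).continuousOn.mono hQdom).abs)
    refine ⟨K, fun i z hz => ?_⟩
    refine le_trans ?_ ((le_abs_self _).trans (hK z hz))
    exact Finset.single_le_sum (f := fun i => |f i z|) (fun i _ => abs_nonneg _) (Finset.mem_univ i)
  obtain ⟨K1, hK1⟩ := hbd (fun a => slopeFn Φ a) hS1
  obtain ⟨K2, hK2⟩ := hbd (fun ab : Fin m × Fin m => slopeDeriv Φ ab.2 (slopeFn Φ ab.1))
    fun ab => hS2 _ _
  obtain ⟨K3, hK3⟩ := hbd (fun ab : Fin m × Fin m × Fin m =>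
    slopeDeriv Φ ab.2.2 (slopeDeriv Φ ab.2.1 (slopeFn Φ ab.1))) fun ab => hS3 _ _ _
  refine ⟨r₀, hr₀pos, r₀ / 4, by positivity, max K1 (max K2 K3), ?_⟩
  intro x₁ hx₁ R s ρ h
  have hx₁r : x₁ ∈ closedBall x₀ r := by
    rw [mem_ball] at hx₁; rw [mem_closedBall]; linarith
  have hx₁U : x₁ ∈ U := (hrU hx₁r).1
  have hnorm : ‖R (eLast m)‖ = 1 := by rw [R.norm_map, norm_eLast]
  have hclose : ∀ x ∈ closedBall x₀ r, ‖fderiv ℝ Φ x - fderiv ℝ Φ x₁‖ ≤ 1 / 2 := fun x hx => by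
    have h1 := (hrU hx).2
    have h2 := (hrU hx₁r).2
    rw [dist_comm] at h2
    have := dist_triangle (fderiv ℝ Φ x) (fderiv ℝ Φ x₀) (fderiv ℝ Φ x₁)
    rw [← dist_eq_norm]; linarith
  have hn : ∀ x ∈ closedBall x₀ r, 1 / 2 ≤ fderiv ℝ Φ x (R (eLast m)) := fun x hx => by
    have h1 := h.one_le_fderiv_normal hU hΦ hmem hx₁U hv (hΦv x₁ hx₁U)
    have h2 := (fderiv ℝ Φ x - fderiv ℝ Φ x₁).le_of_opNorm_le (hclose x hx) (R (eLast m))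
    rw [hnorm, _root_.sub_apply, Real.norm_eq_abs] at h2
    have := (abs_le.1 h2).1
    linarith
  have ht : ∀ x ∈ closedBall x₀ r, ∀ z, |fderiv ℝ Φ x (R (emb m z))| ≤ 1 / 2 * ‖z‖ := fun x hx z => by
    have h2 := (fderiv ℝ Φ x - fderiv ℝ Φ x₁).le_of_opNorm_le (hclose x hx) (R (emb m z))
    rwa [R.norm_map, norm_emb, _root_.sub_apply, h.fderiv_tangent hU hΦ hmem hx₁U,
      sub_zero, Real.norm_eq_abs] at h2
  have hball : ∀ y : E (m + 1), ‖y‖ ≤ r₀ → x₁ + R y ∈ closedBall x₀ r := fun y hy => by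
    rw [mem_ball] at hx₁
    rw [mem_closedBall]
    have h1 := dist_triangle (x₁ + R y) x₁ x₀
    have h2 : dist (x₁ + R y) x₁ = ‖y‖ := by rw [dist_eq_norm, add_sub_cancel_left, R.norm_map]
    linarith
  have hup : ∀ (z : E m) (t : ℝ), ‖emb m z + t • eLast m‖ ≤ ‖z‖ + |t| := fun z t => by
    refine (norm_add_le _ _).trans ?_
    rw [norm_emb, norm_smul, norm_eLast, mul_one, Real.norm_eq_abs]
  -- values of the defining function above and below the graph
  have hmv : ∀ y : E (m + 1), ‖y‖ ≤ r₀ → ∃ x ∈ closedBall x₀ r, Φ (x₁ + R y) = fderiv ℝ Φ x (R y) := by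
    intro y hy
    have hd : ∀ x ∈ closedBall x₀ r, HasFDerivWithinAt Φ (fderiv ℝ Φ x) (closedBall x₀ r) x :=
      fun x hx => ((hΦ.contDiffAt (hU.mem_nhds (hrU hx).1)).differentiableAt
        (by simp)).hasFDerivAt.hasFDerivWithinAt
    obtain ⟨x, hx, hxe⟩ := domain_mvt hd (convex_closedBall x₀ r) hx₁r (hball y hy)
    refine ⟨x, (convex_closedBall x₀ r).segment_subset hx₁r (hball y hy) hx, ?_⟩
    rwa [h.defining_center hU hΦ hmem hx₁U, sub_zero, add_sub_cancel_left] at hxe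
  -- A chart gives only `|ρ| < s`, so for large `s` the graph must be kept near `x₁`. At height
  -- `±r₀/2` the normal contribution to `Φ` is at least `r₀/4` in size and the tangential one at
  -- most `r₀/8`. The sign of `Φ` thus places the graph between the two heights.
  have hρ : ∀ z : E m, ‖z‖ < r₀ / 4 → ‖z‖ < s → |ρ z| ≤ r₀ / 2 := by
    intro z hz hzs
    have hz' : z ∈ ball (0 : E m) s := by simpa using hzs
    have hρs := h.abs_lt z hz'
    by_cases hs : s ≤ r₀ / 2
    · linarith
    · have hs := not_le.1 hs
      rw [abs_le]
      constructor
      · by_contra hc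
        have hc := not_le.1 hc
        have hin : x₁ + R (emb m z + (-(r₀ / 2)) • eLast m) ∈ Ω := by
          rw [h.mem_iff _ (by rwa [horiz_emb_add])
            (by rw [emb_add_last, abs_neg, abs_of_pos (by positivity)]; exact hs)]
          rw [horiz_emb_add, emb_add_last]; exact hc
        have hy : ‖emb m z + (-(r₀ / 2)) • eLast m‖ ≤ r₀ := by
          refine (hup _ _).trans ?_
          rw [abs_neg, abs_of_pos (by positivity)]; linarith
        obtain ⟨x, hx, hxe⟩ := hmv _ hy
        rw [hmem _ (hrU (hball _ hy)).1, hxe, map_add, map_smul, map_add, map_smul, smul_eq_mul] at hin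
        have h1 := (abs_le.1 (ht x hx z)).2
        have h2 := hn x hx
        nlinarith
      · have hy : ‖emb m z + (r₀ / 2) • eLast m‖ ≤ r₀ := by
          refine (hup _ _).trans ?_
          rw [abs_of_pos (by positivity)]; linarith
        obtain ⟨x, hx, hxe⟩ := hmv _ hy
        have hin : x₁ + R (emb m z + (r₀ / 2) • eLast m) ∈ Ω := by
          rw [hmem _ (hrU (hball _ hy)).1, hxe, map_add, map_smul, map_add, map_smul, smul_eq_mul]
          have h1 := (abs_le.1 (ht x hx z)).1
          have h2 := hn x hx
          nlinarith
        rw [h.mem_iff _ (by rwa [horiz_emb_add])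
            (by rw [emb_add_last, abs_of_pos (by positivity)]; exact hs)] at hin
        rw [horiz_emb_add, emb_add_last] at hin
        exact hin.le
  have hgQ : ∀ z : E m, ‖z‖ < r₀ / 4 → ‖z‖ < s →
      (graphPt x₁ R ρ z, (R : E (m + 1) →L[ℝ] E (m + 1))) ∈ Q := by
    intro z hz hzs
    have hb : graphPt x₁ R ρ z ∈ closedBall x₀ r := by
      refine hball _ ((hup _ _).trans ?_)
      have := hρ z hz hzs
      linarith
    refine ⟨⟨hb, ?_⟩, hn _ hb⟩
    rw [mem_closedBall_zero_iff]
    refine ContinuousLinearMap.opNorm_le_bound _ zero_le_one fun y => ?_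
    rw [one_mul]
    exact (R.norm_map y).le
  have hnear : ∀ z : E m, ‖z‖ < r₀ / 4 → ‖z‖ < s → ∀ᶠ z in 𝓝 z, ‖z‖ < r₀ / 4 ∧ ‖z‖ < s :=
    fun z h1 h2 => (continuous_norm.continuousAt.eventually_lt continuousAt_const h1).and
      (continuous_norm.continuousAt.eventually_lt continuousAt_const h2)
  have e1 : ∀ a, ∀ z : E m, ‖z‖ < r₀ / 4 → ‖z‖ < s → pd a ρ z
      = slopeFn Φ a (graphPt x₁ R ρ z, (R : E (m + 1) →L[ℝ] E (m + 1))) := fun a z hz hzs =>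
    h.pd_eq_slopeFn hU hΦ hmem hzs (hQdom (hgQ z hz hzs)) a
  have e2 : ∀ a b, ∀ z : E m, ‖z‖ < r₀ / 4 → ‖z‖ < s → pd b (pd a ρ) z
      = slopeDeriv Φ b (slopeFn Φ a) (graphPt x₁ R ρ z, (R : E (m + 1) →L[ℝ] E (m + 1))) :=
    fun a b z hz hzs => h.pd_eq_slopeDeriv hU hΦ hmem hzs (hQdom (hgQ z hz hzs)) (hS1 a)
      (by filter_upwards [hnear z hz hzs] with z' hz'; exact e1 a z' hz'.1 hz'.2) b
  have e3 : ∀ a b c, ∀ z : E m, ‖z‖ < r₀ / 4 → ‖z‖ < s → pd c (pd b (pd a ρ)) z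
      = slopeDeriv Φ c (slopeDeriv Φ b (slopeFn Φ a))
          (graphPt x₁ R ρ z, (R : E (m + 1) →L[ℝ] E (m + 1))) :=
    fun a b c z hz hzs => h.pd_eq_slopeDeriv hU hΦ hmem hzs (hQdom (hgQ z hz hzs)) (hS2 a b)
      (by filter_upwards [hnear z hz hzs] with z' hz'; exact e2 a b z' hz'.1 hz'.2) c
  intro z hz hzs
  have hzQ := hgQ z hz hzs
  refine ⟨fun a => ?_, fun a b => ?_, fun a b c => ?_⟩
  · rw [e1 a z hz hzs]
    exact (hK1 a _ hzQ).trans (le_max_left _ _)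
  · rw [e2 a b z hz hzs]
    exact (hK2 (a, b) _ hzQ).trans ((le_max_left _ _).trans (le_max_right _ _))
  · rw [e3 a b c z hz hzs]
    exact (hK3 (a, b, c) _ hzQ).trans ((le_max_right _ _).trans (le_max_right _ _))

theorem DerivBounds.mono {ρ : E m → ℝ} {K K' : ℝ} {z : E m} (h : DerivBounds ρ K z) (hK : K ≤ K') :
    DerivBounds ρ K' z :=
  ⟨fun a => (h.1 a).trans hK, fun a b => (h.2.1 a b).trans hK, fun a b c => (h.2.2 a b c).trans hK⟩

/-- The derivatives of the boundary graphs are bounded uniformly in the base point and the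
coordinates. -/
theorem exists_uniform_bounds {Ω : Set (E (m + 1))} (hb : Bornology.IsBounded Ω)
    (hΩ : HasSmoothBoundary Ω) : ∃ δ₀ > 0, ∃ K, 0 ≤ K ∧ ∀ x₁ ∈ frontier Ω,
      ∀ (R : E (m + 1) ≃ₗᵢ[ℝ] E (m + 1)) (s : ℝ) (ρ : E m → ℝ), IsBoundaryGraph Ω x₁ R s ρ →
      ∀ z : E m, ‖z‖ < δ₀ → ‖z‖ < s → DerivBounds ρ K z := by
  have hc : IsCompact (frontier Ω) :=
    hb.isCompact_closure.of_isClosed_subset isClosed_frontier frontier_subset_closure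
  refine hc.induction_on (p := fun S => ∃ δ₀ > 0, ∃ K, 0 ≤ K ∧ ∀ x₁ ∈ S,
      ∀ (R : E (m + 1) ≃ₗᵢ[ℝ] E (m + 1)) (s : ℝ) (ρ : E m → ℝ), IsBoundaryGraph Ω x₁ R s ρ →
      ∀ z : E m, ‖z‖ < δ₀ → ‖z‖ < s → DerivBounds ρ K z) ?_ ?_ ?_ ?_
  · exact ⟨1, one_pos, 0, le_rfl, fun x hx => absurd hx (Set.notMem_empty x)⟩
  · rintro S S' hSS ⟨δ, hδ, K, hK0, hK⟩
    exact ⟨δ, hδ, K, hK0, fun x hx => hK x (hSS hx)⟩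
  · rintro S S' ⟨δ, hδ, K, hK0, hK⟩ ⟨δ', hδ', K', hK0', hK'⟩
    refine ⟨min δ δ', lt_min hδ hδ', max K K', hK0.trans (le_max_left _ _), ?_⟩
    rintro x (hx | hx) R s ρ h z hz hzs
    · exact (hK x hx R s ρ h z (hz.trans_le (min_le_left _ _)) hzs).mono (le_max_left _ _)
    · exact (hK' x hx R s ρ h z (hz.trans_le (min_le_right _ _)) hzs).mono (le_max_right _ _)
  · intro x₀ hx₀
    obtain ⟨ε, hε, δ, hδ, K, hK⟩ := exists_local_bounds hΩ hx₀
    refine ⟨ball x₀ ε, mem_nhdsWithin_of_mem_nhds (ball_mem_nhds _ hε), δ, hδ, max K 0,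
      le_max_right _ _, fun x hx R s ρ h z hz hzs => ?_⟩
    exact (hK x hx R s ρ h z hz hzs).mono (le_max_left _ _)

end MinkowskiQuotient

/-! ### Absorption of the bad terms -/

namespace MinkowskiQuotient

set_option maxHeartbeats 2000000 in
/-- The algebraic core: the terms of `LW` are absorbed using uniform ellipticity and Euler's
relation. -/
theorem exists_absorption_constant (m : ℕ) {c₀ C₁ K M : ℝ} (hc₀ : 0 < c₀) (hC₁ : 0 ≤ C₁)
    (hK : 0 ≤ K) (hM : 0 ≤ M) : ∃ C > 0, ∀ (A r ζ HW : Fin (m + 1) → Fin (m + 1) → ℝ)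
      (P p τ D κ ψ : Fin (m + 1) → ℝ) (t : Fin (m + 1) → Fin (m + 1) → Fin (m + 1) → ℝ) (DW : ℝ),
      (∀ ξ : Fin (m + 1) → ℝ, c₀ * (∑ a, A a a) * ∑ a, ξ a ^ 2 ≤ ∑ a, ∑ b, A a b * ξ a * ξ b) →
      0 ≤ ∑ a, A a a → (∀ a b, |A a b| ≤ ∑ a, A a a) →
      |∑ a, ∑ b, A a b * r a b| ≤ (m + 1) * M → (∀ a b, r a b = r b a) →
      (∀ s, |P s| ≤ C₁ * (M + (∑ a, A a a) * ∑ a, ∑ b, |r a b|)) → (∀ a, |p a| ≤ 1) →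
      (∀ c, |τ c| ≤ K + 2) → (∀ s, D s = ∑ c, τ c * r c s + κ s * p (Fin.last m)) →
      (∀ s, |κ s| ≤ K) → (∀ c, ∑ a, ∑ b, A a b * t c a b + ∑ s, P s * r c s = ψ c) →
      (∀ c, |ψ c| ≤ M) → (∀ a b, |ζ a b| ≤ K) →
      (∀ a b, HW a b = ∑ c, τ c * t c a b + ζ a b * p (Fin.last m) + κ a * r (Fin.last m) b
        + κ b * r (Fin.last m) a - ∑ β : Fin m, r β.castSucc a * r β.castSucc b) →
      (∀ s, |D s| ≤ DW) →
      ∑ a, ∑ b, A a b * HW a b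
        ≤ C * (1 + DW + ∑ a, A a a + ∑ a, ∑ b, A a b * D a * D b) := by
  set N : ℝ := m + 1 with hN
  have hN1 : 1 ≤ N := by rw [hN]; linarith [(Nat.cast_nonneg m : (0 : ℝ) ≤ m)]
  -- `C₂` is the constant in `T R ≤ C₂ (1 + T X)`. Below, `α` and `β` are the coefficients of `T X
  -- |DW|` and `T X` that remain to be absorbed.
  set C₂ := 2 + 2 / c₀ + N * M / c₀ with hC₂
  have hC₂0 : 0 < C₂ := by positivity
  set α := N * C₁ * C₂ with hα
  set β := α * K + 2 * (N * K) * C₂ with hβ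
  have hα0 : 0 ≤ α := by positivity
  have hβ0 : 0 ≤ β := by positivity
  refine ⟨1 + N * (K + 2) * M + N * C₁ * (M + C₂) * (N + K) + α ^ 2 * N ^ 2 / (2 * c₀) * (N / c₀)
    + β ^ 2 * N ^ 2 / (2 * c₀) + N ^ 2 * K + 2 * (N * K) * C₂, by positivity, ?_⟩
  intro A r ζ HW P p τ D κ ψ t DW hell hT0 hA heul hr hP hp hτ hD hκ hψ hψM hζ hHW hDW
  set T := ∑ a, A a a with hT
  set n := Fin.last m with hn
  set X := ∑ β : Fin m, ∑ j, |r β.castSucc j| with hX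
  set X2 := ∑ β : Fin m, ∑ j, r β.castSucc j ^ 2 with hX2
  set R := ∑ a, ∑ b, |r a b| with hR
  set Dm := ∑ s, |D s| with hDm
  have hX0 : 0 ≤ X := Finset.sum_nonneg fun _ _ => Finset.sum_nonneg fun _ _ => abs_nonneg _
  have hR0 : 0 ≤ R := Finset.sum_nonneg fun _ _ => Finset.sum_nonneg fun _ _ => abs_nonneg _
  have hDm0 : 0 ≤ Dm := Finset.sum_nonneg fun _ _ => abs_nonneg _
  have hDW0 : 0 ≤ DW := (abs_nonneg _).trans (hDW n)
  have hcard : ∀ (f : Fin (m + 1) → ℝ) (B : ℝ), (∀ i, |f i| ≤ B) → |∑ i, f i| ≤ N * B := fun f B h => by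
    have := (Finset.abs_sum_le_sum_abs f Finset.univ).trans
      (Finset.sum_le_card_nsmul _ _ B fun i _ => h i)
    simpa [hN] using this
  -- Cauchy–Schwarz for the two sums
  have hXX : X ^ 2 ≤ N ^ 2 * X2 := by
    have h1 := sq_sum_le_card_mul_sum_sq (s := (Finset.univ : Finset (Fin m × Fin (m + 1))))
      (f := fun z => |r z.1.castSucc z.2|)
    simp only [Fintype.sum_prod_type, sq_abs, Finset.card_univ, Fintype.card_prod,
      Fintype.card_fin] at h1
    refine h1.trans (mul_le_mul_of_nonneg_right ?_
      (Finset.sum_nonneg fun _ _ => Finset.sum_nonneg fun _ _ => sq_nonneg _))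
    push_cast
    rw [hN]; nlinarith [(Nat.cast_nonneg m : (0 : ℝ) ≤ m)]
  have hDD : Dm ^ 2 ≤ N * ∑ s, D s ^ 2 := by
    have h1 := sq_sum_le_card_mul_sum_sq (s := (Finset.univ : Finset (Fin (m + 1))))
      (f := fun z => |D z|)
    simpa [hN, sq_abs] using h1
  have hDmDW : Dm ≤ N * DW := by
    refine (le_abs_self _).trans (hcard _ _ fun i => ?_)
    rw [abs_abs]; exact hDW i
  have hTD : c₀ * (T * Dm ^ 2) ≤ N * ∑ a, ∑ b, A a b * D a * D b := by
    have h1 := hell D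
    have h2 := mul_le_mul_of_nonneg_left hDD (mul_nonneg hc₀.le hT0)
    nlinarith
  have hADD : 0 ≤ ∑ a, ∑ b, A a b * D a * D b :=
    le_trans (mul_nonneg (mul_nonneg hc₀.le hT0) (Finset.sum_nonneg fun _ _ => sq_nonneg _)) (hell D)
  -- the good term
  have hgood : c₀ * T * X2 ≤ ∑ β : Fin m, ∑ a, ∑ b, A a b * (r β.castSucc a * r β.castSucc b) := by
    rw [hX2, Finset.mul_sum]
    refine Finset.sum_le_sum fun β _ => (hell (r β.castSucc)).trans (le_of_eq ?_)
    exact Finset.sum_congr rfl fun a _ => Finset.sum_congr rfl fun b _ => by ring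
  -- the double normal derivative
  have hnX : ∑ β : Fin m, |r n β.castSucc| ≤ X := by
    refine Finset.sum_le_sum fun β _ => ?_
    rw [hr]
    exact Finset.single_le_sum (f := fun j => |r β.castSucc j|) (fun _ _ => abs_nonneg _)
      (Finset.mem_univ n)
  have hRle : R ≤ 2 * X + |r n n| := by
    rw [hR, Fin.sum_univ_castSucc, Fin.sum_univ_castSucc (f := fun b => |r (Fin.last m) b|)]
    linarith
  have hAnn : c₀ * T ≤ A n n := by
    have := hell (Pi.single n 1)
    simpa [Pi.single_apply] using this
  -- Euler's relation is solved for `A_nn r_nn`: every other entry of `r` lies in a tangential row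
  -- or, by symmetry, equals one that does. Ellipticity gives `A_nn ≥ c₀ T`.
  have hnn : c₀ * (T * |r n n|) ≤ N * M + 2 * (T * X) := by
    have e : ∑ a, ∑ b, A a b * r a b = ∑ β : Fin m, ∑ j, A β.castSucc j * r β.castSucc j
        + (∑ β : Fin m, A n β.castSucc * r n β.castSucc + A n n * r n n) := by
      rw [Fin.sum_univ_castSucc, Fin.sum_univ_castSucc (f := fun b => A (Fin.last m) b * _)]
    have h1 : |∑ β : Fin m, ∑ j, A β.castSucc j * r β.castSucc j| ≤ T * X := by
      rw [hX, Finset.mul_sum]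
      refine (Finset.abs_sum_le_sum_abs _ _).trans (Finset.sum_le_sum fun β _ => ?_)
      rw [Finset.mul_sum]
      refine (Finset.abs_sum_le_sum_abs _ _).trans (Finset.sum_le_sum fun j _ => ?_)
      rw [abs_mul]; exact mul_le_mul_of_nonneg_right (hA _ _) (abs_nonneg _)
    have h2 : |∑ β : Fin m, A n β.castSucc * r n β.castSucc| ≤ T * X := by
      refine le_trans ?_ (mul_le_mul_of_nonneg_left hnX hT0)
      rw [Finset.mul_sum]
      refine (Finset.abs_sum_le_sum_abs _ _).trans (Finset.sum_le_sum fun β _ => ?_)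
      rw [abs_mul]; exact mul_le_mul_of_nonneg_right (hA _ _) (abs_nonneg _)
    have h3 : c₀ * T * |r n n| ≤ |A n n * r n n| := by
      rw [abs_mul]
      exact mul_le_mul_of_nonneg_right (hAnn.trans (le_abs_self _)) (abs_nonneg _)
    rw [e] at heul
    have h4 : |A n n * r n n| ≤ N * M + T * X + T * X := by
      rw [abs_le] at *
      constructor <;> linarith [h1.1, h1.2, h2.1, h2.2, heul.1, heul.2]
    linarith
  have hTR : T * R ≤ C₂ * (1 + T * X) := by
    have h1 := mul_le_mul_of_nonneg_left hRle hT0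
    have h2 : T * |r n n| ≤ (N * M + 2 * (T * X)) / c₀ := by
      rw [le_div_iff₀ hc₀]; linarith
    have hTX : 0 ≤ T * X := mul_nonneg hT0 hX0
    have e : C₂ * (1 + T * X) = 2 * (T * X) + (N * M + 2 * (T * X)) / c₀
        + (2 + 2 / c₀ + N * M / c₀ * (T * X)) := by rw [hC₂]; field_simp; ring
    have : 0 ≤ 2 + 2 / c₀ + N * M / c₀ * (T * X) := by positivity
    linarith
  -- expand the left-hand side
  have hexp : ∑ a, ∑ b, A a b * HW a b = (∑ c, τ c * ψ c - ∑ s, P s * (D s - κ s * p n))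
      + ∑ a, ∑ b, A a b * (ζ a b * p n) + ∑ a, ∑ b, A a b * (κ a * r n b)
      + ∑ a, ∑ b, A a b * (κ b * r n a)
      - ∑ β : Fin m, ∑ a, ∑ b, A a b * (r β.castSucc a * r β.castSucc b) := by
    -- The differentiated equation is contracted with `τ`. The same contraction of second
    -- derivatives is `D_s - κ_s p_n`, so the first-order coefficients `P` meet `DW` instead of the
    -- full Hessian.
    have e1 : ∑ c, τ c * ψ c - ∑ s, P s * (D s - κ s * p n)
        = ∑ a, ∑ b, A a b * ∑ c, τ c * t c a b := by
      have f1 : ∑ s, P s * (D s - κ s * p n) = ∑ c, τ c * ∑ s, P s * r c s := by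
        have : ∀ s, D s - κ s * p n = ∑ c, τ c * r c s := fun s => by rw [hD]; ring
        simp only [this, Finset.mul_sum]
        rw [Finset.sum_comm]
        exact Finset.sum_congr rfl fun c _ => Finset.sum_congr rfl fun s _ => by ring
      have f2 : ∑ a, ∑ b, A a b * ∑ c, τ c * t c a b = ∑ c, τ c * ∑ a, ∑ b, A a b * t c a b := by
        simp only [Finset.mul_sum]
        rw [Finset.sum_congr rfl fun a _ => Finset.sum_comm, Finset.sum_comm]
        exact Finset.sum_congr rfl fun c _ => Finset.sum_congr rfl fun a _ =>
          Finset.sum_congr rfl fun b _ => by ring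
      rw [f1, f2, ← Finset.sum_sub_distrib]
      exact Finset.sum_congr rfl fun c _ => by rw [← hψ c]; ring
    have e2 : ∑ β : Fin m, ∑ a, ∑ b, A a b * (r β.castSucc a * r β.castSucc b)
        = ∑ a, ∑ b, A a b * ∑ β : Fin m, r β.castSucc a * r β.castSucc b := by
      simp only [Finset.mul_sum]
      rw [Finset.sum_comm]
      exact Finset.sum_congr rfl fun a _ => Finset.sum_comm
    rw [e1, e2]
    simp only [← Finset.sum_add_distrib, ← Finset.sum_sub_distrib]
    exact Finset.sum_congr rfl fun a _ => Finset.sum_congr rfl fun b _ => by rw [hHW]; ring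
  have b1 : |∑ c, τ c * ψ c| ≤ N * ((K + 2) * M) := hcard _ _ fun c => by
    rw [abs_mul]; exact mul_le_mul (hτ c) (hψM c) (abs_nonneg _) (by linarith)
  have b2 : |∑ s, P s * (D s - κ s * p n)| ≤ N * (C₁ * (M + T * R) * (Dm + K)) :=
    hcard _ _ fun s => by
      rw [abs_mul]
      refine mul_le_mul (hP s) ?_ (abs_nonneg _) (by positivity)
      refine (abs_sub _ _).trans (add_le_add ?_ ?_)
      · exact Finset.single_le_sum (f := fun s => |D s|) (fun _ _ => abs_nonneg _) (Finset.mem_univ s)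
      · rw [abs_mul]
        calc |κ s| * |p n| ≤ K * 1 := mul_le_mul (hκ s) (hp n) (abs_nonneg _) hK
          _ = K := mul_one K
  have b3 : |∑ a, ∑ b, A a b * (ζ a b * p n)| ≤ N * (N * (T * K)) :=
    hcard _ _ fun a => hcard _ _ fun b => by
      rw [abs_mul, abs_mul]
      refine mul_le_mul (hA a b) ?_ (by positivity) hT0
      calc |ζ a b| * |p n| ≤ K * 1 := mul_le_mul (hζ a b) (hp n) (abs_nonneg _) hK
        _ = K := mul_one K
  have hrow : ∑ b, |r n b| ≤ R :=
    Finset.single_le_sum (f := fun a => ∑ b, |r a b|)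
      (fun _ _ => Finset.sum_nonneg fun _ _ => abs_nonneg _) (Finset.mem_univ n)
  have b4 : |∑ a, ∑ b, A a b * (κ a * r n b)| ≤ N * (T * (K * R)) :=
    hcard _ _ fun a => by
      refine (Finset.abs_sum_le_sum_abs _ _).trans ?_
      calc ∑ b, |A a b * (κ a * r n b)| ≤ ∑ b, T * (K * |r n b|) :=
            Finset.sum_le_sum fun b _ => by
              rw [abs_mul, abs_mul]
              exact mul_le_mul (hA a b) (mul_le_mul_of_nonneg_right (hκ a) (abs_nonneg _))
                (by positivity) hT0
        _ = T * (K * ∑ b, |r n b|) := by rw [Finset.mul_sum, Finset.mul_sum]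
        _ ≤ _ := by gcongr
  have b5 : |∑ a, ∑ b, A a b * (κ b * r n a)| ≤ N * (T * (K * R)) := by
    rw [Finset.sum_comm]
    refine hcard _ _ fun b => ?_
    refine (Finset.abs_sum_le_sum_abs _ _).trans ?_
    calc ∑ a, |A a b * (κ b * r n a)| ≤ ∑ a, T * (K * |r n a|) :=
          Finset.sum_le_sum fun a _ => by
            rw [abs_mul, abs_mul]
            exact mul_le_mul (hA a b) (mul_le_mul_of_nonneg_right (hκ b) (abs_nonneg _))
              (by positivity) hT0
      _ = T * (K * ∑ b, |r n b|) := by rw [Finset.mul_sum, Finset.mul_sum]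
      _ ≤ _ := by gcongr
  have c2 : N * (C₁ * (M + T * R) * (Dm + K))
      ≤ N * C₁ * (M + C₂) * (Dm + K) + α * (T * X * Dm) + α * K * (T * X) := by
    have h1 : C₁ * (M + T * R) * (Dm + K) ≤ C₁ * (M + C₂ * (1 + T * X)) * (Dm + K) := by gcongr
    have h2 := mul_le_mul_of_nonneg_left h1 (by linarith : 0 ≤ N)
    refine h2.trans (le_of_eq ?_)
    rw [hα]; ring
  have c4 : N * (T * (K * R)) ≤ N * K * C₂ + N * K * C₂ * (T * X) := by
    have := mul_le_mul_of_nonneg_left hTR (by positivity : 0 ≤ N * K)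
    linarith
  -- absorption
  have d0 : c₀ / N ^ 2 * (T * X ^ 2) ≤ c₀ * T * X2 := by
    have := mul_le_mul_of_nonneg_left hXX (by positivity : 0 ≤ c₀ / N ^ 2 * T)
    refine le_trans (le_of_eq (by ring)) (this.trans (le_of_eq ?_))
    field_simp
  -- Each use costs half of the `c₀/N²` available in `d0`. There are exactly two uses, with `Y =
  -- |DW|` and with `Y = 1`.
  have young : ∀ γ Y : ℝ, γ * (X * Y) ≤ c₀ / (2 * N ^ 2) * X ^ 2 + γ ^ 2 * N ^ 2 / (2 * c₀) * Y ^ 2 := by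
    intro γ Y
    have h1 : 0 ≤ (c₀ * X - γ * N ^ 2 * Y) ^ 2 / (2 * c₀ * N ^ 2) := by positivity
    have e : (c₀ * X - γ * N ^ 2 * Y) ^ 2 / (2 * c₀ * N ^ 2) = c₀ / (2 * N ^ 2) * X ^ 2
        + γ ^ 2 * N ^ 2 / (2 * c₀) * Y ^ 2 - γ * (X * Y) := by field_simp; ring
    linarith
  have d1 : α * (T * X * Dm) ≤ c₀ / (2 * N ^ 2) * (T * X ^ 2)
      + α ^ 2 * N ^ 2 / (2 * c₀) * (T * Dm ^ 2) := by
    have := mul_le_mul_of_nonneg_left (young α Dm) hT0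
    linarith
  have d2 : β * (T * X) ≤ c₀ / (2 * N ^ 2) * (T * X ^ 2) + β ^ 2 * N ^ 2 / (2 * c₀) * T := by
    have := mul_le_mul_of_nonneg_left (young β 1) hT0
    linarith
  -- Ellipticity applied to `DW` itself: this is where the quadratic gradient term on the right-hand
  -- side is needed.
  have d3 : α ^ 2 * N ^ 2 / (2 * c₀) * (T * Dm ^ 2) ≤ α ^ 2 * N ^ 2 / (2 * c₀) * (N / c₀) *
      ∑ a, ∑ b, A a b * D a * D b := by
    rw [mul_assoc (α ^ 2 * N ^ 2 / (2 * c₀))]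
    apply mul_le_mul_of_nonneg_left _ (by positivity)
    rw [div_mul_eq_mul_div, le_div_iff₀ hc₀]; linarith
  have d4 : c₀ / (2 * N ^ 2) * (T * X ^ 2) + c₀ / (2 * N ^ 2) * (T * X ^ 2)
      = c₀ / N ^ 2 * (T * X ^ 2) := by field_simp; ring
  have d5 : N * C₁ * (M + C₂) * (Dm + K) ≤ N * C₁ * (M + C₂) * (N * DW + K) := by gcongr
  rw [hexp]
  have hβe : β * (T * X) = α * K * (T * X) + 2 * (N * K * C₂ * (T * X)) := by rw [hβ]; ring
  have main : ∑ c, τ c * ψ c - ∑ s, P s * (D s - κ s * p n)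
      + ∑ a, ∑ b, A a b * (ζ a b * p n) + ∑ a, ∑ b, A a b * (κ a * r n b)
      + ∑ a, ∑ b, A a b * (κ b * r n a)
      - ∑ β : Fin m, ∑ a, ∑ b, A a b * (r β.castSucc a * r β.castSucc b)
      ≤ N * ((K + 2) * M) + N * C₁ * (M + C₂) * (N * DW + K)
        + α ^ 2 * N ^ 2 / (2 * c₀) * (N / c₀) * (∑ a, ∑ b, A a b * D a * D b)
        + β ^ 2 * N ^ 2 / (2 * c₀) * T + N * (N * (T * K)) + 2 * (N * K * C₂) := by
    have := (abs_le.1 b1).2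
    have := (abs_le.1 b2).1
    have := (abs_le.1 b3).2
    have := (abs_le.1 b4).2
    have := (abs_le.1 b5).2
    linarith
  refine main.trans ?_
  set Z := ∑ a, ∑ b, A a b * D a * D b with hZ
  set c1 := N * (K + 2) * M with hc1
  set c3 := N * C₁ * (M + C₂) with hc3
  set c5 := α ^ 2 * N ^ 2 / (2 * c₀) * (N / c₀) with hc5
  set c6 := β ^ 2 * N ^ 2 / (2 * c₀) with hc6
  set c7 := N ^ 2 * K with hc7
  set c8 := 2 * (N * K) * C₂ with hc8
  have hS : 0 ≤ 1 + DW + T + Z := by linarith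
  have q1 : c1 * 1 ≤ c1 * (1 + DW + T + Z) :=
    mul_le_mul_of_nonneg_left (by linarith) (by positivity)
  have q2 : c3 * (N * DW + K) ≤ c3 * (N + K) * (1 + DW + T + Z) := by
    rw [mul_assoc c3]
    apply mul_le_mul_of_nonneg_left _ (by positivity)
    have f1 := mul_le_mul_of_nonneg_left (by linarith : DW ≤ 1 + DW + T + Z) (by linarith : 0 ≤ N)
    have f2 := mul_le_mul_of_nonneg_left (by linarith : 1 ≤ 1 + DW + T + Z) hK
    linarith
  have q3 : c5 * Z ≤ c5 * (1 + DW + T + Z) :=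
    mul_le_mul_of_nonneg_left (by linarith) (by positivity)
  have q4 : c6 * T ≤ c6 * (1 + DW + T + Z) :=
    mul_le_mul_of_nonneg_left (by linarith) (by positivity)
  have q5 : c7 * T ≤ c7 * (1 + DW + T + Z) :=
    mul_le_mul_of_nonneg_left (by linarith) (by positivity)
  have q6 : c8 * 1 ≤ c8 * (1 + DW + T + Z) :=
    mul_le_mul_of_nonneg_left (by linarith) (by positivity)
  have g1 : N * ((K + 2) * M) = c1 * 1 := by rw [hc1]; ring
  have g2 : N * (N * (T * K)) = c7 * T := by rw [hc7]; ring
  have g3 : 2 * (N * K * C₂) = c8 * 1 := by rw [hc8]; ring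
  rw [g1, g2, g3]
  have e : (1 + c1 + c3 * (N + K) + c5 + c6 + c7 + c8) * (1 + DW + T + Z)
      = (1 + DW + T + Z) + c1 * (1 + DW + T + Z) + c3 * (N + K) * (1 + DW + T + Z)
        + c5 * (1 + DW + T + Z) + c6 * (1 + DW + T + Z) + c7 * (1 + DW + T + Z)
        + c8 * (1 + DW + T + Z) := by ring
  rw [e]
  linarith

end MinkowskiQuotient

/-! ### Partial derivatives, rotations and the derivatives of `W` -/

namespace MinkowskiQuotient
open Filter Topology Metric

section PD

variable {n : ℕ} {f g : E n → ℝ} {x : E n}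

theorem pd_congr (h : f =ᶠ[𝓝 x] g) (i : Fin n) : pd i f x = pd i g x := by
  rw [pd, pd, h.fderiv_eq]

theorem pd_add (hf : DifferentiableAt ℝ f x) (hg : DifferentiableAt ℝ g x) (i : Fin n) :
    pd i (fun y => f y + g y) x = pd i f x + pd i g x := by
  simp [pd, fderiv_fun_add hf hg]

theorem pd_sub (hf : DifferentiableAt ℝ f x) (hg : DifferentiableAt ℝ g x) (i : Fin n) :
    pd i (fun y => f y - g y) x = pd i f x - pd i g x := by
  simp [pd, fderiv_fun_sub hf hg]

theorem pd_mul (hf : DifferentiableAt ℝ f x) (hg : DifferentiableAt ℝ g x) (i : Fin n) :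
    pd i (fun y => f y * g y) x = pd i f x * g x + f x * pd i g x := by
  simp [pd, fderiv_fun_mul hf hg]; ring

theorem pd_const_mul (hf : DifferentiableAt ℝ f x) (c : ℝ) (i : Fin n) :
    pd i (fun y => c * f y) x = c * pd i f x := by
  simp [pd, fderiv_const_mul hf]

theorem pd_sum {ι : Type*} {s : Finset ι} {F : ι → E n → ℝ}
    (hF : ∀ a ∈ s, DifferentiableAt ℝ (F a) x) (i : Fin n) :
    pd i (fun y => ∑ a ∈ s, F a y) x = ∑ a ∈ s, pd i (F a) x := by
  simp [pd, fderiv_fun_sum hF]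

theorem contDiffAt_pd {k : ℕ∞ω} {k' : ℕ∞ω} (hf : ContDiffAt ℝ k f x) (hk : k' + 1 ≤ k) (i : Fin n) :
    ContDiffAt ℝ k' (pd i f) x :=
  (hf.fderiv_right hk).clm_apply contDiffAt_const

theorem hasDerivAt_line (hf : DifferentiableAt ℝ f x) (c : Fin n) :
    HasDerivAt (fun t : ℝ => f (x + t • EuclideanSpace.single c (1 : ℝ))) (pd c f x) 0 := by
  have hl : HasDerivAt (fun t : ℝ => x + t • EuclideanSpace.single c (1 : ℝ))
      (EuclideanSpace.single c (1 : ℝ)) 0 := by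
    simpa using ((hasDerivAt_id (0 : ℝ)).smul_const (EuclideanSpace.single c (1 : ℝ))).const_add x
  exact HasFDerivAt.comp_hasDerivAt (0 : ℝ)
    (f := fun t : ℝ => x + t • EuclideanSpace.single c (1 : ℝ))
    (by rw [zero_smul, add_zero]; exact hf.hasFDerivAt) hl

theorem pd_comm (hf : ContDiffAt ℝ 2 f x) (i j : Fin n) : pd j (pd i f) x = pd i (pd j f) x := by
  have hd : DifferentiableAt ℝ (fderiv ℝ f) x :=
    (hf.fderiv_right (m := 1) (by norm_num)).differentiableAt (by norm_num)
  have h : ∀ i j : Fin n, pd j (pd i f) x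
      = fderiv ℝ (fderiv ℝ f) x (EuclideanSpace.single j 1) (EuclideanSpace.single i 1) := by
    intro i j
    have : pd i f = fun y => fderiv ℝ f y (EuclideanSpace.single i 1) := rfl
    rw [pd, this, fderiv_clm_apply hd (differentiableAt_const _)]
    simp
  rw [h, h]
  exact (hf.isSymmSndFDerivAt (by simp)).eq _ _

theorem sum_single_smul (y : E n) : ∑ i, y i • EuclideanSpace.single i (1 : ℝ) = y := by
  ext a
  simp [Pi.single_apply]

theorem fderiv_eq_sum_pd (y : E n) : fderiv ℝ f x y = ∑ i, y i * pd i f x := by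
  conv_lhs => rw [← sum_single_smul y]
  simp [pd]

theorem abs_pd_le (i : Fin n) : |pd i f x| ≤ ‖fderiv ℝ f x‖ := by
  simpa [pd] using (fderiv ℝ f x).le_opNorm (EuclideanSpace.single i 1)

/-- The operator norm is tested on the gradient vector. -/
theorem sum_sq_pd_le : ∑ i, pd i f x ^ 2 ≤ ‖fderiv ℝ f x‖ ^ 2 := by
  set v : E n := WithLp.toLp 2 fun i => pd i f x with hv
  have h1 : fderiv ℝ f x v = ∑ i, pd i f x ^ 2 := by
    rw [fderiv_eq_sum_pd]; simp [hv, sq]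
  have h2 : ‖v‖ ^ 2 = ∑ i, pd i f x ^ 2 := by
    rw [EuclideanSpace.norm_sq_eq]; simp [hv]
  have h3 := (fderiv ℝ f x).le_opNorm v
  rw [h1, ← h2, Real.norm_eq_abs, abs_of_nonneg (sq_nonneg _), sq] at h3
  rw [← h2]
  rcases (norm_nonneg v).eq_or_lt with h | h
  · rw [← h]; simp
  · exact pow_le_pow_left₀ h.le (le_of_mul_le_mul_right h3 h) 2

end PD

section Rotation

open Matrix

variable {n : ℕ}

/-- The matrix of a linear isometry. -/
noncomputable def isoMatrix (R : E n ≃ₗᵢ[ℝ] E n) : Matrix (Fin n) (Fin n) ℝ :=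
  Matrix.of fun a i => R (EuclideanSpace.single i 1) a

theorem isoMatrix_transpose_mul (R : E n ≃ₗᵢ[ℝ] E n) : (isoMatrix R)ᵀ * isoMatrix R = 1 := by
  ext i j
  have h := R.inner_map_map (EuclideanSpace.single i (1 : ℝ)) (EuclideanSpace.single j 1)
  rw [PiLp.inner_apply, EuclideanSpace.inner_single_left] at h
  simp only [mul_apply, transpose_apply, isoMatrix, of_apply, one_apply]
  simpa [mul_comm, Pi.single_apply, eq_comm] using h

theorem hasFDerivAt_rotate {u : E n → ℝ} {x₀ : E n} {R : E n ≃ₗᵢ[ℝ] E n} {y : E n}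
    (hu : DifferentiableAt ℝ u (x₀ + R y)) :
    HasFDerivAt (fun y => u (x₀ + R y)) ((fderiv ℝ u (x₀ + R y)).comp (R : E n →L[ℝ] E n)) y :=
  HasFDerivAt.comp y (f := fun y => x₀ + R y) hu.hasFDerivAt
    ((R : E n →L[ℝ] E n).hasFDerivAt.const_add x₀)

theorem pd_rotate {u : E n → ℝ} {x₀ : E n} {R : E n ≃ₗᵢ[ℝ] E n} {y : E n}
    (hu : DifferentiableAt ℝ u (x₀ + R y)) (i : Fin n) :
    pd i (fun y => u (x₀ + R y)) y = ∑ a, isoMatrix R a i * pd a u (x₀ + R y) := by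
  rw [pd, (hasFDerivAt_rotate hu).fderiv]
  simp only [ContinuousLinearMap.comp_apply]
  exact fderiv_eq_sum_pd _

theorem grad_rotate {u : E n → ℝ} {x₀ : E n} {R : E n ≃ₗᵢ[ℝ] E n} {y : E n}
    (hu : DifferentiableAt ℝ u (x₀ + R y)) :
    grad (fun y => u (x₀ + R y)) y = (isoMatrix R)ᵀ *ᵥ grad u (x₀ + R y) := by
  ext i
  rw [grad, pd_rotate hu]; rfl

theorem hess_rotate {u : E n → ℝ} {x₀ : E n} {R : E n ≃ₗᵢ[ℝ] E n} {y : E n}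
    (hu : ContDiffAt ℝ 2 u (x₀ + R y)) :
    hess (fun y => u (x₀ + R y)) y = (isoMatrix R)ᵀ * hess u (x₀ + R y) * isoMatrix R := by
  have hcont : ContinuousAt (fun y => x₀ + R y) y := by fun_prop
  have hev : ∀ᶠ z in 𝓝 y, DifferentiableAt ℝ u (x₀ + R z) :=
    hcont.eventually ((hu.eventually (by simp)).mono fun z hz => hz.differentiableAt (by simp))
  ext i j
  have e : pd i (fun y => u (x₀ + R y)) =ᶠ[𝓝 y]
      fun z => ∑ a, isoMatrix R a i * pd a u (x₀ + R z) := by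
    filter_upwards [hev] with z hz using pd_rotate hz i
  have hd : ∀ a, DifferentiableAt ℝ (pd a u) (x₀ + R y) := fun a =>
    (contDiffAt_pd hu (k' := 1) (by norm_num) a).differentiableAt (by simp)
  have hd' : ∀ a, DifferentiableAt ℝ (fun z => pd a u (x₀ + R z)) y := fun a =>
    (hasFDerivAt_rotate (hd a)).differentiableAt
  simp only [hess, of_apply]
  rw [pd_congr e, pd_sum fun a _ => (hd' a).const_mul _]
  simp only [mul_apply, transpose_apply, of_apply, Finset.sum_mul]
  rw [Finset.sum_comm]
  refine Finset.sum_congr rfl fun a _ => ?_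
  rw [pd_const_mul (hd' a), pd_rotate (hd a), Finset.mul_sum]
  exact Finset.sum_congr rfl fun b _ => by ring

/-- Every tensor involved is conjugated by the orthogonal `Q`, and `w` and `H` are invariant. Hence
the equation and the cone condition hold in any orthonormal coordinates. -/
theorem etaEigenvalues_rotate {Q r : Matrix (Fin n) (Fin n) ℝ} {p : Fin n → ℝ} (hQ : Qᵀ * Q = 1) :
    etaEigenvalues (Qᵀ * r * Q) (Qᵀ *ᵥ p) = etaEigenvalues r p := by
  have hQ' : Q * Qᵀ = 1 := mul_eq_one_comm.1 hQ
  have hpp : ∑ i, (Qᵀ *ᵥ p) i ^ 2 = ∑ i, p i ^ 2 := by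
    rw [← dotProduct_self_eq, ← dotProduct_self_eq, dotProduct_mulVec, vecMul_transpose,
      mulVec_mulVec, hQ', one_mulVec]
  have hw : lorentzFactor (Qᵀ *ᵥ p) = lorentzFactor p := by rw [lorentzFactor, hpp, lorentzFactor]
  have hg : metric (Qᵀ *ᵥ p) = Qᵀ * metric p * Q := by
    rw [metric, metric, mul_sub, sub_mul, mul_one, hQ, mul_vecMulVec, vecMulVec_mul,
      ← mulVec_transpose]
  have hgi : (metric (Qᵀ *ᵥ p))⁻¹ = Qᵀ * (metric p)⁻¹ * Q := by
    rw [hg, Matrix.mul_inv_rev, Matrix.mul_inv_rev, inv_eq_right_inv hQ', inv_eq_right_inv hQ, mul_assoc]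
  have hcancel : ∀ M N : Matrix (Fin n) (Fin n) ℝ, Qᵀ * M * Q * (Qᵀ * N * Q) = Qᵀ * (M * N) * Q := by
    intro M N
    have : ∀ L : Matrix (Fin n) (Fin n) ℝ, Q * (Qᵀ * L) = L := fun L => by
      rw [← mul_assoc, hQ', one_mul]
    simp only [mul_assoc, this]
  have hs : secondForm (Qᵀ * r * Q) (Qᵀ *ᵥ p) = Qᵀ * secondForm r p * Q := by
    rw [secondForm, secondForm, hw, mul_smul_comm, smul_mul_assoc]
  have hH : meanCurvature (Qᵀ * r * Q) (Qᵀ *ᵥ p) = meanCurvature r p := by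
    rw [meanCurvature, hgi, hs, hcancel, trace_mul_comm, ← mul_assoc, hQ', one_mul, meanCurvature]
  have he : etaTensor (Qᵀ * r * Q) (Qᵀ *ᵥ p) = Qᵀ * etaTensor r p * Q := by
    rw [etaTensor, hH, hg, hs, etaTensor, mul_sub, sub_mul, mul_smul_comm, smul_mul_assoc]
  rw [etaEigenvalues, hgi, he, hcancel, charpoly_conj_of_mul_eq_one hQ, etaEigenvalues]

end Rotation

section AuxW

variable {m : ℕ}

theorem hasFDerivAt_comp_horiz {f : E m → ℝ} {y : E (m + 1)} (hf : DifferentiableAt ℝ f (horiz y)) :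
    HasFDerivAt (fun y => f (horiz y)) ((fderiv ℝ f (horiz y)).comp (horizL m)) y :=
  HasFDerivAt.comp y (f := fun y => horizL m y) hf.hasFDerivAt (horizL m).hasFDerivAt

theorem pd_comp_horiz_castSucc {f : E m → ℝ} {y : E (m + 1)} (hf : DifferentiableAt ℝ f (horiz y))
    (b : Fin m) : pd b.castSucc (fun y => f (horiz y)) y = pd b f (horiz y) := by
  rw [pd, (hasFDerivAt_comp_horiz hf).fderiv, ContinuousLinearMap.comp_apply, horizL_apply,
    ← emb_single, pd]
  congr 1
  ext a; simp [horiz]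

theorem pd_comp_horiz_last {f : E m → ℝ} {y : E (m + 1)} (hf : DifferentiableAt ℝ f (horiz y)) :
    pd (Fin.last m) (fun y => f (horiz y)) y = 0 := by
  rw [pd, (hasFDerivAt_comp_horiz hf).fderiv, ContinuousLinearMap.comp_apply, horizL_apply]
  have : horiz (EuclideanSpace.single (Fin.last m) (1 : ℝ)) = 0 := by ext a; simp [horiz]
  rw [this, map_zero]

/-- The gradient of `W = v_α + a v_n - ½ ∑ v_β²` for a general coefficient `a`. -/
theorem pd_auxForm {v a : E (m + 1) → ℝ} {y : E (m + 1)} (hv : ∀ c, DifferentiableAt ℝ (pd c v) y)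
    (ha : DifferentiableAt ℝ a y) (α : Fin m) (i : Fin (m + 1)) :
    pd i (fun y => pd α.castSucc v y + a y * pd (Fin.last m) v y
      - (1 / 2) * ∑ β : Fin m, pd β.castSucc v y ^ 2) y
    = pd i (pd α.castSucc v) y + (pd i a y * pd (Fin.last m) v y + a y * pd i (pd (Fin.last m) v) y)
      - ∑ β : Fin m, pd β.castSucc v y * pd i (pd β.castSucc v) y := by
  have h1 : DifferentiableAt ℝ (fun y => a y * pd (Fin.last m) v y) y := ha.fun_mul (hv _)
  have h2 : ∀ β ∈ (Finset.univ : Finset (Fin m)),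
      DifferentiableAt ℝ (fun y => pd β.castSucc v y * pd β.castSucc v y) y := fun β _ =>
    (hv _).fun_mul (hv _)
  simp only [sq]
  rw [pd_sub ((hv _).fun_add h1) ((DifferentiableAt.fun_sum h2).const_mul _), pd_add (hv _) h1,
    pd_mul ha (hv _), pd_const_mul (DifferentiableAt.fun_sum h2), pd_sum h2]
  congr 1
  rw [Finset.mul_sum]
  refine Finset.sum_congr rfl fun β _ => ?_
  rw [pd_mul (hv _) (hv _)]; ring

theorem pd_pd_auxForm {v a : E (m + 1) → ℝ} {y : E (m + 1)} (hv : ContDiffAt ℝ 3 v y)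
    (ha : ContDiffAt ℝ 2 a y) (α : Fin m) (i j : Fin (m + 1)) :
    pd j (pd i (fun y => pd α.castSucc v y + a y * pd (Fin.last m) v y
      - (1 / 2) * ∑ β : Fin m, pd β.castSucc v y ^ 2)) y
    = pd j (pd i (pd α.castSucc v)) y
      + ((pd j (pd i a) y * pd (Fin.last m) v y + pd i a y * pd j (pd (Fin.last m) v) y)
        + (pd j a y * pd i (pd (Fin.last m) v) y + a y * pd j (pd i (pd (Fin.last m) v)) y))
      - ∑ β : Fin m, (pd j (pd β.castSucc v) y * pd i (pd β.castSucc v) y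
        + pd β.castSucc v y * pd j (pd i (pd β.castSucc v)) y) := by
  have hv1 : ∀ c, ContDiffAt ℝ 2 (pd c v) y := fun c => contDiffAt_pd hv (by norm_num) c
  have hv2 : ∀ c, ContDiffAt ℝ 1 (pd i (pd c v)) y := fun c => contDiffAt_pd (hv1 c) (by norm_num) i
  have ha1 : ContDiffAt ℝ 1 (pd i a) y := contDiffAt_pd ha (by norm_num) i
  have d0 : DifferentiableAt ℝ a y := ha.differentiableAt (by simp)
  have d1 : ∀ c, DifferentiableAt ℝ (pd c v) y := fun c => (hv1 c).differentiableAt (by simp)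
  have d2 : ∀ c, DifferentiableAt ℝ (pd i (pd c v)) y := fun c => (hv2 c).differentiableAt (by simp)
  have d3 : DifferentiableAt ℝ (pd i a) y := ha1.differentiableAt (by simp)
  have hev : ∀ᶠ z in 𝓝 y, ContDiffAt ℝ 3 v z ∧ ContDiffAt ℝ 2 a z :=
    (hv.eventually (by simp)).and (ha.eventually (by simp))
  have e : pd i (fun y => pd α.castSucc v y + a y * pd (Fin.last m) v y
      - (1 / 2) * ∑ β : Fin m, pd β.castSucc v y ^ 2) =ᶠ[𝓝 y] fun y =>
      pd i (pd α.castSucc v) y + (pd i a y * pd (Fin.last m) v y + a y * pd i (pd (Fin.last m) v) y)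
      - ∑ β : Fin m, pd β.castSucc v y * pd i (pd β.castSucc v) y := by
    filter_upwards [hev] with z hz
    exact pd_auxForm (fun c => (contDiffAt_pd hz.1 (k' := 2) (by norm_num) c).differentiableAt (by simp))
      (hz.2.differentiableAt (by simp)) α i
  have h1 : DifferentiableAt ℝ (fun y => pd i a y * pd (Fin.last m) v y) y := d3.fun_mul (d1 _)
  have h2 : DifferentiableAt ℝ (fun y => a y * pd i (pd (Fin.last m) v) y) y := d0.fun_mul (d2 _)
  have h3 : ∀ β ∈ (Finset.univ : Finset (Fin m)),
      DifferentiableAt ℝ (fun y => pd β.castSucc v y * pd i (pd β.castSucc v) y) y := fun β _ =>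
    (d1 _).fun_mul (d2 _)
  rw [pd_congr e, pd_sub ((d2 _).fun_add (h1.fun_add h2)) (DifferentiableAt.fun_sum h3),
    pd_add (d2 _) (h1.fun_add h2), pd_add h1 h2, pd_mul d3 (d1 _), pd_mul d0 (d2 _), pd_sum h3]
  congr 1
  exact Finset.sum_congr rfl fun β _ => by rw [pd_mul (d1 _) (d2 _)]

/-- Needed to match the derivative of the Hessian along a line with the Hessian of `v_c`.
Third-order regularity suffices: one swap is applied to the `C²` function `v_a`, the other to `v` on
a neighbourhood. -/
theorem pd_third_comm {n : ℕ} {v : E n → ℝ} {y : E n} (hv : ContDiffAt ℝ 3 v y) (a b c : Fin n) :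
    pd c (pd b (pd a v)) y = pd b (pd a (pd c v)) y := by
  rw [pd_comm (contDiffAt_pd hv (k' := 2) (by norm_num) a)]
  refine pd_congr ?_ b
  filter_upwards [hv.eventually (by simp)] with z hz
  exact pd_comm (hz.of_le (by norm_num)) a c

end AuxW

end MinkowskiQuotient

/-! ### The estimate at a point and the theorem -/

namespace MinkowskiQuotient
open Filter Topology Metric

/-- The estimate for a single configuration of domain, coordinates and solution. -/
theorem linearized_auxW_le {m : ℕ} {Ω : Set (E (m + 1))} (hΩ : IsOpen Ω) {θ M K C : ℝ}
    (hθ : 0 < θ) (hθ1 : θ < 1) {k l : ℕ} (hk : k < m + 1) (hl : l < k) {ψ : E (m + 1) × ℝ → ℝ}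
    (hψ : ContDiffOn ℝ ∞ ψ (closure Ω ×ˢ Set.univ)) {u : E (m + 1) → ℝ}
    (hu : ContDiffOn ℝ 3 u (closure Ω)) (hDu : ∀ x ∈ Ω, ‖fderiv ℝ u x‖ ≤ 1 - θ)
    (hcone : IsEtaConvex k Ω u) (hsol : ∀ x ∈ Ω, G k l (hess u x) (grad u x) = ψ (x, u x))
    (hM : 0 ≤ M) (hψM : ∀ x ∈ Ω, |ψ (x, u x)| ≤ M ∧ ‖fderiv ℝ ψ (x, u x)‖ ≤ M)
    {x₀ : E (m + 1)} (R : E (m + 1) ≃ₗᵢ[ℝ] E (m + 1)) {ρ : E m → ℝ} {y : E (m + 1)}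
    (hy : x₀ + R y ∈ Ω) (hρ : ContDiffAt ℝ ∞ ρ (horiz y)) (hK : 0 ≤ K)
    (hρK : DerivBounds ρ K (horiz y)) (α : Fin m)
    (hC : ∀ (A r ζ HW : Fin (m + 1) → Fin (m + 1) → ℝ)
      (P p τ D κ ψ : Fin (m + 1) → ℝ) (t : Fin (m + 1) → Fin (m + 1) → Fin (m + 1) → ℝ) (DW : ℝ),
      (∀ ξ : Fin (m + 1) → ℝ, θ / ((m + 1 : ℕ) * ellConst (m + 1)) * (∑ a, A a a) * ∑ a, ξ a ^ 2
        ≤ ∑ a, ∑ b, A a b * ξ a * ξ b) →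
      0 ≤ ∑ a, A a a → (∀ a b, |A a b| ≤ ∑ a, A a a) →
      |∑ a, ∑ b, A a b * r a b| ≤ (m + 1) * M → (∀ a b, r a b = r b a) →
      (∀ s, |P s| ≤ ((m + 1 : ℕ) * θ⁻¹ + 2 * (m + 1 : ℕ) ^ 2 * ellConst (m + 1) * θ⁻¹ ^ 4)
        * (M + (∑ a, A a a) * ∑ a, ∑ b, |r a b|)) → (∀ a, |p a| ≤ 1) →
      (∀ c, |τ c| ≤ K + 2) → (∀ s, D s = ∑ c, τ c * r c s + κ s * p (Fin.last m)) →
      (∀ s, |κ s| ≤ K) → (∀ c, ∑ a, ∑ b, A a b * t c a b + ∑ s, P s * r c s = ψ c) →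
      (∀ c, |ψ c| ≤ M) → (∀ a b, |ζ a b| ≤ K) →
      (∀ a b, HW a b = ∑ c, τ c * t c a b + ζ a b * p (Fin.last m) + κ a * r (Fin.last m) b
        + κ b * r (Fin.last m) a - ∑ β : Fin m, r β.castSucc a * r β.castSucc b) →
      (∀ s, |D s| ≤ DW) →
      ∑ a, ∑ b, A a b * HW a b
        ≤ C * (1 + DW + ∑ a, A a a + ∑ a, ∑ b, A a b * D a * D b))
    {v : E (m + 1) → ℝ} (hv : v = fun y => u (x₀ + R y)) {W : E (m + 1) → ℝ}
    (hW : W = auxW ρ v α) :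
    linearized k l v W y ≤ C * (1 + ‖fderiv ℝ W y‖ + ∑ i, coeff k l v y i i
      + ∑ i, ∑ j, coeff k l v y i j * pd i W y * pd j W y) := by
  -- regularity
  have huC : ∀ x ∈ Ω, ContDiffAt ℝ 3 u x := fun x hx =>
    hu.contDiffAt (mem_of_superset (hΩ.mem_nhds hx) subset_closure)
  have hcont : ContinuousAt (fun z => x₀ + R z) y := by fun_prop
  have hevΩ : ∀ᶠ z in 𝓝 y, x₀ + R z ∈ Ω := hcont.eventually_mem (hΩ.mem_nhds hy)
  have hvC : ContDiffAt ℝ 3 v y := by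
    rw [hv]
    exact (huC _ hy).comp y (f := fun z => x₀ + R z)
      (contDiffAt_const.add (R : E (m + 1) →L[ℝ] E (m + 1)).contDiff.contDiffAt)
  have hvC1 : ∀ c, ContDiffAt ℝ 2 (pd c v) y := fun c => contDiffAt_pd hvC (by norm_num) c
  have hvC2 : ∀ c b, ContDiffAt ℝ 1 (pd b (pd c v)) y := fun c b =>
    contDiffAt_pd (hvC1 c) (by norm_num) b
  have hvd : DifferentiableAt ℝ v y := hvC.differentiableAt (by simp)
  -- the equation and the cone condition in the rotated coordinates
  have heig : ∀ z, x₀ + R z ∈ Ω → etaEigenvalues (hess v z) (grad v z)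
      = etaEigenvalues (hess u (x₀ + R z)) (grad u (x₀ + R z)) := fun z hz => by
    rw [hv, hess_rotate ((huC _ hz).of_le (by norm_num)),
      grad_rotate ((huC _ hz).differentiableAt (by simp)),
      etaEigenvalues_rotate (isoMatrix_transpose_mul R)]
  have hGv : ∀ z, x₀ + R z ∈ Ω → G k l (hess v z) (grad v z) = ψ (x₀ + R z, v z) := fun z hz => by
    have := hsol _ hz
    rw [G, heig z hz, hv]
    exact this
  have hsymm : ∀ᶠ z in 𝓝 y, (hess v z).transpose = hess v z := by
    filter_upwards [hvC.eventually (by simp)] with z hz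
    ext a b
    exact pd_comm (hz.of_le (by norm_num)) b a
  have hr := hsymm.self_of_nhds
  have hrab : ∀ a b, hess v y a b = hess v y b a := fun a b => congrFun (congrFun hr b) a
  have hDv : ‖fderiv ℝ v y‖ ≤ 1 - θ := by
    have hR1 : ‖(R : E (m + 1) →L[ℝ] E (m + 1))‖ ≤ 1 :=
      ContinuousLinearMap.opNorm_le_bound _ zero_le_one fun z => by
        rw [one_mul]; exact (R.norm_map z).le
    have h1 := hDu _ hy
    rw [hv, (hasFDerivAt_rotate ((huC _ hy).differentiableAt (by simp))).fderiv]
    refine (ContinuousLinearMap.opNorm_comp_le _ _).trans ?_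
    calc _ ≤ (1 - θ) * 1 := mul_le_mul h1 hR1 (norm_nonneg _) (by linarith)
      _ = 1 - θ := mul_one _
  have hp : ∑ i, grad v y i ^ 2 ≤ (1 - θ) ^ 2 :=
    sum_sq_pd_le.trans (pow_le_pow_left₀ (norm_nonneg _) hDv 2)
  obtain ⟨P, hell, hT0, hA, heul, hP, hchain⟩ := exists_structure hθ hθ1 hk hl hr hp
    (by rw [heig y hy]; exact hcone _ hy)
  have hGM : |G k l (hess v y) (grad v y)| ≤ M := by
    rw [hGv y hy, hv]; exact (hψM _ hy).1
  have hp1 : ∀ a, |pd a v y| ≤ 1 := fun a => abs_pd_le a |>.trans (by linarith)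
  -- the coefficient `ρ_α` as a function on `ℝⁿ`
  set a : E (m + 1) → ℝ := fun y => pd α ρ (horiz y) with ha
  have hρev : ∀ᶠ z in 𝓝 y, ContDiffAt ℝ 3 ρ (horiz z) :=
    ((horizL m).continuous.continuousAt (x := y)).eventually
      ((contDiffAt_infty.1 hρ 3).eventually (by simp))
  have hρ3 := hρev.self_of_nhds
  have haC : ContDiffAt ℝ 2 a y :=
    (contDiffAt_pd hρ3 (by norm_num) α).comp y (f := fun z => horizL m z)
      (horizL m).contDiff.contDiffAt
  have had : ∀ {z}, ContDiffAt ℝ 3 ρ (horiz z) → DifferentiableAt ℝ (pd α ρ) (horiz z) := fun hz =>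
    (contDiffAt_pd hz (k' := 2) (by norm_num) α).differentiableAt (by simp)
  have hκ : ∀ s, |pd s a y| ≤ K := fun s => by
    refine Fin.lastCases ?_ (fun b => ?_) s
    · rw [ha, pd_comp_horiz_last (had hρ3), abs_zero]; exact hK
    · rw [ha, pd_comp_horiz_castSucc (had hρ3)]; exact hρK.2.1 α b
  have hζ : ∀ i j, |pd j (pd i a) y| ≤ K := fun i j => by
    refine Fin.lastCases (motive := fun i => |pd j (pd i a) y| ≤ K) ?_ (fun b => ?_) i
    · have e : pd (Fin.last m) a =ᶠ[𝓝 y] fun _ => 0 := by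
        filter_upwards [hρev] with z hz using pd_comp_horiz_last (had hz)
      rw [pd_congr e]; simpa [pd] using hK
    · have e : pd b.castSucc a =ᶠ[𝓝 y] fun z => pd b (pd α ρ) (horiz z) := by
        filter_upwards [hρev] with z hz using pd_comp_horiz_castSucc (had hz) b
      have hd : DifferentiableAt ℝ (pd b (pd α ρ)) (horiz y) :=
        (contDiffAt_pd (contDiffAt_pd hρ3 (k' := 2) (by norm_num) α) (k' := 1)
          (by norm_num) b).differentiableAt (by simp)
      rw [pd_congr e]
      refine Fin.lastCases ?_ (fun c => ?_) j
      · rw [pd_comp_horiz_last hd, abs_zero]; exact hK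
      · rw [pd_comp_horiz_castSucc hd]; exact hρK.2.2 α b c
  -- the coefficients of the tangential combination
  set τ : Fin (m + 1) → ℝ := Fin.snoc (α := fun _ => ℝ)
    (fun β => (if β = α then 1 else 0) - pd β.castSucc v y) (a y) with hτ
  have hτsum : ∀ f : Fin (m + 1) → ℝ, ∑ c, τ c * f c = f α.castSucc + a y * f (Fin.last m)
      - ∑ β : Fin m, pd β.castSucc v y * f β.castSucc := fun f => by
    rw [Fin.sum_univ_castSucc]
    simp only [hτ, Fin.snoc_castSucc, Fin.snoc_last, sub_mul, Finset.sum_sub_distrib, ite_mul,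
      one_mul, zero_mul, Finset.sum_ite_eq', Finset.mem_univ, if_true]
    ring
  -- Tangential entries are at most `1 + |v_β| ≤ 2`; the last one is `ρ_α`, at most `K`.
  have hτK : ∀ c, |τ c| ≤ K + 2 := fun c => by
    refine Fin.lastCases ?_ (fun β => ?_) c
    · simp only [hτ, Fin.snoc_last]
      have := hρK.1 α
      simp only [ha]; linarith
    · simp only [hτ, Fin.snoc_castSucc]
      have h1 := hp1 β.castSucc
      have h2 : |if β = α then (1 : ℝ) else 0| ≤ 1 := by split_ifs <;> simp
      have := abs_sub (if β = α then (1 : ℝ) else 0) (pd β.castSucc v y)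
      linarith
  have hWe : W = fun y => pd α.castSucc v y + a y * pd (Fin.last m) v y
      - (1 / 2) * ∑ β : Fin m, pd β.castSucc v y ^ 2 := hW
  have hψd : DifferentiableAt ℝ ψ (x₀ + R y, u (x₀ + R y)) := by
    refine (hψ.contDiffAt ?_).differentiableAt (by simp)
    exact mem_of_superset ((hΩ.prod isOpen_univ).mem_nhds ⟨hy, trivial⟩)
      (Set.prod_mono subset_closure subset_rfl)
  -- The right-hand side of the differentiated equation is defined to be its left-hand side, so that
  -- relation is `rfl`. The chain rule along coordinate lines enters only when this quantity is
  -- identified with the derivative of `ψ` and bounded by `M`.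
  refine hC (coeff k l v y) (hess v y) (fun i j => pd j (pd i a) y) (hess W y) P (grad v y) τ
    (fun s => pd s W y) (fun s => pd s a y)
    (fun c => ∑ i, ∑ j, coeff k l v y i j * pd j (pd i (pd c v)) y + ∑ s, P s * hess v y c s)
    (fun c i j => pd j (pd i (pd c v)) y) ‖fderiv ℝ W y‖ hell hT0 hA ?_ hrab ?_ hp1 hτK ?_ hκ
    (fun c => rfl) ?_ hζ ?_ (fun s => abs_pd_le s)
  · have h1 : |(k : ℝ) - l| ≤ m + 1 := by
      have a1 : (l : ℝ) < k := by exact_mod_cast hl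
      have a2 : (k : ℝ) < m + 1 := by exact_mod_cast hk
      have a3 : (0 : ℝ) ≤ l := Nat.cast_nonneg _
      rw [abs_of_pos (by linarith)]; linarith
    calc |∑ i, ∑ j, coeff k l v y i j * hess v y i j|
        = |((k : ℝ) - l) * G k l (hess v y) (grad v y)| := congrArg abs heul
      _ ≤ (m + 1) * M := by
        rw [abs_mul]; exact mul_le_mul h1 hGM (abs_nonneg _) (by positivity)
  · intro s
    refine (hP s).trans ?_
    have := ellConst_pos (m + 1)
    exact mul_le_mul_of_nonneg_left (add_le_add_left hGM _) (by positivity)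
  · intro s
    rw [hτsum, hWe, pd_auxForm (fun c => (hvC1 c).differentiableAt (by simp))
      (haC.differentiableAt (by simp))]
    simp only [hess, Matrix.of_apply, grad]
    ring
  · intro c
    have h1 := hchain (fun t => hess v (y + t • EuclideanSpace.single c (1 : ℝ)))
      (Matrix.of fun i j => pd c (pd j (pd i v)) y)
      (fun t => grad v (y + t • EuclideanSpace.single c (1 : ℝ))) (fun s => pd c (pd s v) y) ?_ ?_ ?_
      (by simp) (by simp)
    · have hF : HasFDerivAt (fun z => ψ (x₀ + R z, v z)) _ y :=
        HasFDerivAt.comp y (f := fun z => (x₀ + R z, v z)) (g := ψ)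
          (by rw [hv]; exact hψd.hasFDerivAt)
          (((R : E (m + 1) →L[ℝ] E (m + 1)).hasFDerivAt.const_add x₀).prodMk hvd.hasFDerivAt)
      have h2 := hasDerivAt_line hF.differentiableAt c
      have hline : ContinuousAt (fun t : ℝ => y + t • EuclideanSpace.single c (1 : ℝ)) 0 := by
        fun_prop
      have hev : (fun t : ℝ => G k l (hess v (y + t • EuclideanSpace.single c (1 : ℝ)))
          (grad v (y + t • EuclideanSpace.single c (1 : ℝ)))) =ᶠ[𝓝 0]
          fun t => ψ (x₀ + R (y + t • EuclideanSpace.single c (1 : ℝ)),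
            v (y + t • EuclideanSpace.single c (1 : ℝ))) := by
        have := hline.eventually (p := fun z => x₀ + R z ∈ Ω) (by simpa using hevΩ)
        filter_upwards [this] with t ht using hGv _ ht
      have h3 := h1.unique (h2.congr_of_eventuallyEq hev)
      have e : ∑ i, ∑ j, coeff k l v y i j * pd j (pd i (pd c v)) y + ∑ s, P s * hess v y c s
          = pd c (fun z => ψ (x₀ + R z, v z)) y := by
        rw [← h3]
        congr 1
        · refine Finset.sum_congr rfl fun i _ => Finset.sum_congr rfl fun j _ => ?_
          rw [Matrix.of_apply, pd_third_comm hvC i j c]; rfl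
        · refine Finset.sum_congr rfl fun s _ => ?_
          rw [hrab]; rfl
      rw [e, pd, hF.fderiv, ContinuousLinearMap.comp_apply, ← Real.norm_eq_abs]
      refine (ContinuousLinearMap.le_opNorm _ _).trans ?_
      have h4 : ‖fderiv ℝ ψ (x₀ + R y, u (x₀ + R y))‖ ≤ M := (hψM _ hy).2
      refine (mul_le_mul h4 ?_ (norm_nonneg _) hM).trans (mul_one M).le
      -- The product carries the sup norm, so `(R e_c, v_c)` has norm at most `1` and the bound `M`
      -- survives without a factor.
      rw [ContinuousLinearMap.prod_apply, Prod.norm_def]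
      refine max_le ?_ (hp1 c)
      exact ((R.norm_map _).trans (by simp)).le
    · have hline : ContinuousAt (fun t : ℝ => y + t • EuclideanSpace.single c (1 : ℝ)) 0 := by
        fun_prop
      exact hline.eventually (p := fun z => (hess v z).transpose = hess v z) (by simpa using hsymm)
    · intro i j
      exact hasDerivAt_line ((hvC2 i j).differentiableAt (by simp)) c
    · intro s
      exact hasDerivAt_line ((hvC1 s).differentiableAt (by simp)) c
  · intro i j
    have h1 : hess W y i j = pd j (pd i W) y := rfl
    rw [h1, hτsum, hWe, pd_pd_auxForm hvC haC]
    simp only [hess, Matrix.of_apply, grad, Finset.sum_add_distrib]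
    have : ∑ β : Fin m, pd j (pd β.castSucc v) y * pd i (pd β.castSucc v) y
        = ∑ β : Fin m, pd i (pd β.castSucc v) y * pd j (pd β.castSucc v) y :=
      Finset.sum_congr rfl fun β _ => mul_comm _ _
    rw [this]
    ring

end MinkowskiQuotient

theorem lemma4p3 (m : ℕ) (Ω : Set (MinkowskiQuotient.E (m + 1)))
    (hΩ_open : IsOpen Ω) (hΩ_conn : IsConnected Ω) (hΩ_bdd : Bornology.IsBounded Ω)
    (hΩ_smooth : MinkowskiQuotient.HasSmoothBoundary Ω)
    (θ₀ M : ℝ) (hθ₀ : 0 < θ₀) (hθ₁ : θ₀ < 1) :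
    ∃ δ₀ : ℝ, 0 < δ₀ ∧ ∃ C : ℝ, 0 < C ∧
      ∀ k l : ℕ, 2 ≤ k → k < m + 1 → l < k →
      ∀ ψ : MinkowskiQuotient.E (m + 1) × ℝ → ℝ,
        ContDiffOn ℝ ∞ ψ (closure Ω ×ˢ Set.univ) →
        (∀ x ∈ closure Ω, ∀ z : ℝ, 0 < ψ (x, z)) →
      ∀ u : MinkowskiQuotient.E (m + 1) → ℝ,
        ContDiffOn ℝ 3 u (closure Ω) →
        (∀ x ∈ Ω, ‖fderiv ℝ u x‖ ≤ 1 - θ₀) →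
        MinkowskiQuotient.IsEtaConvex k Ω u →
        MinkowskiQuotient.SolvesDirichlet k l Ω ψ u →
      ∀ μ₀ : ℝ, (∀ x ∈ closure Ω, |u x| ≤ μ₀) →
        (∀ x ∈ Ω, ∀ z : ℝ, |z| ≤ μ₀ → |ψ (x, z)| ≤ M ∧ ‖fderiv ℝ ψ (x, z)‖ ≤ M) →
      ∀ x₀ ∈ frontier Ω,
      ∀ (R : MinkowskiQuotient.E (m + 1) ≃ₗᵢ[ℝ] MinkowskiQuotient.E (m + 1)) (s : ℝ)
        (ρ : MinkowskiQuotient.E m → ℝ),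
        MinkowskiQuotient.IsBoundaryGraph Ω x₀ R s ρ →
      ∀ δ : ℝ, 0 < δ → δ ≤ δ₀ → δ ≤ s →
      ∀ v : MinkowskiQuotient.E (m + 1) → ℝ, (v = fun y => u (x₀ + R y)) →
      ∀ W : MinkowskiQuotient.E (m + 1) → ℝ, ∀ α : Fin m,
        W = MinkowskiQuotient.auxW ρ v α →
      ∀ y ∈ MinkowskiQuotient.omegaSet Ω x₀ R ρ δ,
        MinkowskiQuotient.linearized k l v W y ≤
          C * (1 + ‖fderiv ℝ W y‖ + ∑ i, MinkowskiQuotient.coeff k l v y i i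
            + ∑ i, ∑ j, MinkowskiQuotient.coeff k l v y i j
                * MinkowskiQuotient.pd i W y * MinkowskiQuotient.pd j W y) := by
  obtain ⟨δ₁, hδ₁, K, hK0, hK⟩ := MinkowskiQuotient.exists_uniform_bounds hΩ_bdd hΩ_smooth
  have hell := MinkowskiQuotient.ellConst_pos (m + 1)
  -- The ellipticity constant depends only on `n` and `θ₀`, and `K` only on `∂Ω`, so `C` is fixed
  -- before `k`, `l`, `ψ`, `u` and the coordinates. `|M|` replaces `M`, whose sign is not assumed.
  obtain ⟨C, hC, hest⟩ := MinkowskiQuotient.exists_absorption_constant m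
    (c₀ := θ₀ / ((m + 1 : ℕ) * MinkowskiQuotient.ellConst (m + 1)))
    (C₁ := (m + 1 : ℕ) * θ₀⁻¹ + 2 * (m + 1 : ℕ) ^ 2 * MinkowskiQuotient.ellConst (m + 1) * θ₀⁻¹ ^ 4)
    (by positivity) (by positivity) hK0 (abs_nonneg M)
  refine ⟨δ₁, hδ₁, C, hC, ?_⟩
  intro k l _ hkm hlk ψ hψ _ u hu hDu hcone hsol μ₀ hμ hψM x₀ hx₀ R s ρ hgr δ _ hδ1 hδs v hv W α hW
    y hy
  have hz : ‖MinkowskiQuotient.horiz y‖ < s := hy.2.2.2.trans_le hδs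
  refine MinkowskiQuotient.linearized_auxW_le hΩ_open hθ₀ hθ₁ hkm hlk hψ hu hDu hcone hsol.1
    (abs_nonneg M) (fun x hx => ?_) R hy.1 ?_ hK0
    (hK x₀ hx₀ R s ρ hgr _ (hy.2.2.2.trans_le hδ1) hz) α hest hv hW
  · have := hψM x hx (u x) (hμ x (subset_closure hx))
    exact ⟨this.1.trans (le_abs_self M), this.2.trans (le_abs_self M)⟩
  · exact hgr.smooth.contDiffAt (Metric.isOpen_ball.mem_nhds (by simpa using hz))
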